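/- In the $q$-Root Steiner Tree with Trunk problem ($q$-RST-T) one is given a finite directed graph $G=(V,A)$ and two sets $R,T\subseteq V$ with $|R|=q$, and the task is to compute the minimum size of a set $S\subseteq V$ such that in the induced subgraph $G[R\cup S\cup T]$ there is a vertex $v$, a directed path from $r$ to $v$ for every $r\in R$, and a directed path from $v$ to $t$ for every $t\in T$ (or to report that no such $S$ exists). Write $n=|V|$. Theorem. For every $q\ge 1$ the problem $q$-RST-T is fixed-parameter tractable with respect to $|T|$: for some computable function $f$ and some constant $b$ there is an algorithm that solves it in time $f(|T|)\cdot n^{b}$. Moreover, there is an algorithm (a program for a random access machine with logarithmic costs) that, for every $q\ge 1$, solves $q$-RST-T in $O(2^{2q+4|T|}\cdot n^{3q+O(1)})$ time, where the constants hidden in the $O(\cdot)$ notations do not depend on $q$, $|T|$ or $n$. -/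

import Mathlib

namespace SteinerTrunk

/-! The problem. -/

/-- An instance: a finite directed graph `G` on the vertices `0, …, n - 1`, a set `R` of roots and
a set `T` of terminals. -/
structure Instance where
  /-- the number of vertices -/
  n : ℕ
  /-- the directed graph -/
  G : Digraph (Fin n)
  /-- the roots -/
  R : Finset (Fin n)
  /-- the terminals -/
  T : Finset (Fin n)

/-- The subgraph `G[W]` of a directed graph induced by a set `W` of vertices. -/
def induced {V : Type*} (G : Digraph V) (W : Set V) : Digraph W where
  Adj u v := G.Adj u v

/-- There is a directed path (possibly of length zero) from `u` to `v`. -/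
def HasPath {V : Type*} (G : Digraph V) (u v : V) : Prop :=
  Relation.ReflTransGen G.Adj u v

/-- `S` is a feasible solution: in `G[R ∪ S ∪ T]` there is a vertex `v` (the trunk) that is
reachable from every root and from which every terminal is reachable. -/
def Instance.IsSolution (x : Instance) (S : Finset (Fin x.n)) : Prop :=
  let H := induced x.G {u | u ∈ x.R ∪ S ∪ x.T}
  ∃ v, (∀ r, r.1 ∈ x.R → HasPath H r v) ∧ (∀ t, t.1 ∈ x.T → HasPath H v t)

/-! The machine: a random access machine with logarithmic costs. It has scalar registers and
unbounded arrays, all holding natural numbers. A program mentions finitely many of them, by fixed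
names. -/

/-- A machine state: the contents of the registers and of the arrays. -/
structure State where
  /-- `reg r` is the content of register `r` -/
  reg : ℕ → ℕ
  /-- `arr a i` is the content of cell `i` of array `a` -/
  arr : ℕ → ℕ → ℕ

/-- Overwrite a register. -/
def State.setReg (s : State) (r v : ℕ) : State :=
  { s with reg := fun r' => if r' = r then v else s.reg r' }

/-- Overwrite an array cell. -/
def State.setArr (s : State) (a i v : ℕ) : State :=
  { s with arr := fun a' i' => if a' = a ∧ i' = i then v else s.arr a' i' }

/-- The elementary binary operations. -/
inductive Op where
  | add | sub | mul | div | lt | eq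

/-- Subtraction is truncated, division rounds down and comparisons return `0` or `1`. -/
def Op.apply : Op → ℕ → ℕ → ℕ
  | .add, x, y => x + y
  | .sub, x, y => x - y
  | .mul, x, y => x * y
  | .div, x, y => x / y
  | .lt, x, y => if x < y then 1 else 0
  | .eq, x, y => if x = y then 1 else 0

/-- Arithmetic expressions. -/
inductive Expr where
  /-- a constant -/
  | const (c : ℕ)
  /-- the content of a register -/
  | reg (r : ℕ)
  /-- the content of the cell of array `a` whose index is the value of an expression -/
  | load (a : ℕ) (i : Expr)
  /-- an elementary operation -/
  | bin (o : Op) (e f : Expr)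

/-- The value of an expression. -/
def Expr.val (s : State) : Expr → ℕ
  | .const c => c
  | .reg r => s.reg r
  | .load a i => s.arr a (i.val s)
  | .bin o e f => o.apply (e.val s) (f.val s)

/-- The logarithmic cost of touching the number `x`: its binary length plus one. -/
def len (x : ℕ) : ℕ := Nat.size x + 1

/-- The cost of evaluating an expression: every number and every address that is touched is charged
with its length. -/
def Expr.cost (s : State) : Expr → ℕ
  | .const c => len c
  | .reg r => len r + len (s.reg r)
  | .load a i => i.cost s + len a + len (i.val s) + len (s.arr a (i.val s))
  | .bin o e f => e.cost s + f.cost s + len (e.val s) + len (f.val s) +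
      len (o.apply (e.val s) (f.val s))

/-- Programs. -/
inductive Prog where
  /-- do nothing -/
  | skip
  /-- assign the value of `e` to register `r` -/
  | set (r : ℕ) (e : Expr)
  /-- assign the value of `e` to the cell of array `a` whose index is the value of `i` -/
  | store (a : ℕ) (i e : Expr)
  /-- sequential composition -/
  | seq (p p' : Prog)
  /-- run `p` if the value of `e` is nonzero, and `p'` otherwise -/
  | cond (e : Expr) (p p' : Prog)
  /-- run `p` as long as the value of `e` is nonzero -/
  | loop (e : Expr) (p : Prog)

/-- `Exec p s s' c`: program `p`, started in state `s`, halts in state `s'` after a computation of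
total cost `c`. -/
inductive Exec : Prog → State → State → ℕ → Prop where
  | skip (s : State) : Exec .skip s s 1
  | set (s : State) (r : ℕ) (e : Expr) :
      Exec (.set r e) s (s.setReg r (e.val s)) (e.cost s + len r + len (e.val s))
  | store (s : State) (a : ℕ) (i e : Expr) :
      Exec (.store a i e) s (s.setArr a (i.val s) (e.val s))
        (i.cost s + e.cost s + len a + len (i.val s) + len (e.val s))
  | seq {p p' : Prog} {s s' s'' : State} {c c' : ℕ} (h : Exec p s s' c) (h' : Exec p' s' s'' c') :
      Exec (.seq p p') s s'' (c + c')
  | cond_true {e : Expr} {p p' : Prog} {s s' : State} {c : ℕ} (he : e.val s ≠ 0)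
      (h : Exec p s s' c) : Exec (.cond e p p') s s' (e.cost s + c)
  | cond_false {e : Expr} {p p' : Prog} {s s' : State} {c : ℕ} (he : e.val s = 0)
      (h : Exec p' s s' c) : Exec (.cond e p p') s s' (e.cost s + c)
  | loop_true {e : Expr} {p : Prog} {s s' s'' : State} {c c' : ℕ} (he : e.val s ≠ 0)
      (h : Exec p s s' c) (h' : Exec (.loop e p) s' s'' c') :
      Exec (.loop e p) s s'' (e.cost s + c + c')
  | loop_false {e : Expr} {p : Prog} {s : State} (he : e.val s = 0) :
      Exec (.loop e p) s s (e.cost s)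

/-! Solving the problem within a time bound. -/

open Classical in
/-- The initial state for an instance: register `0` holds the number of vertices, array `0` the
adjacency matrix in row-major order, arrays `1` and `2` the characteristic vectors of `R` and `T`;
everything else is `0`. -/
noncomputable def Instance.init (x : Instance) : State where
  reg r := if r = 0 then x.n else 0
  arr a i :=
    if (a = 0 ∧ ∃ u v : Fin x.n, x.G.Adj u v ∧ i = u * x.n + v) ∨
      (a = 1 ∧ ∃ u ∈ x.R, i = (u : ℕ)) ∨ (a = 2 ∧ ∃ u ∈ x.T, i = (u : ℕ)) then 1 else 0

/-- `s` is a correct final state for the instance `x`: if there is a feasible solution, register `0`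
holds `1` and register `1` the minimum size of a feasible solution; otherwise register `0`
holds `0`. -/
def Instance.IsCorrectOutput (x : Instance) (s : State) : Prop :=
  ((∃ S, x.IsSolution S) →
    s.reg 0 = 1 ∧ IsLeast {k | ∃ S, x.IsSolution S ∧ S.card = k} (s.reg 1)) ∧
  ((¬ ∃ S, x.IsSolution S) → s.reg 0 = 0)

/-- On the instance `x`, program `p` halts with a correct output at cost at most `t`. -/
def SolvesWithin (p : Prog) (x : Instance) (t : ℕ) : Prop :=
  ∃ (s : State) (c : ℕ), Exec p x.init s c ∧ c ≤ t ∧ x.IsCorrectOutput s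

/-- For the fixed number `q` of roots, the problem is fixed-parameter tractable with respect to
`|T|`: one program solves all instances with `q` roots in time `f(|T|) * n ^ b`, where `f` is
computable and `b` is constant. -/
def IsFPT (q : ℕ) : Prop :=
  ∃ (p : Prog) (f : ℕ → ℕ) (b : ℕ), Computable f ∧
    ∀ x : Instance, x.R.card = q → SolvesWithin p x (f x.T.card * x.n ^ b)

end SteinerTrunk

/-!
The algorithm is a dynamic program over the positions of a token game, in the style of the
algorithm of Feldman and Ruhl for directed Steiner networks.

**The game.** Every root has a forward token and a backward token. Both start on the root. Forward
tokens walk along edges, backward tokens against edges; tokens that meet stay together, and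
entering an unoccupied vertex outside `R ∪ T` costs `1`. In the first part all pairs of tokens
stay together. In the second part terminals are collected by out-trees that hang off the tokens,
which are found by the usual dynamic program over subsets of the terminals. The game ends with all
tokens on one vertex `v` and all terminals collected. There is one further move: a forward token
on `f` and a backward token on `b` may exchange their places along a path from `f` to `b`, where
everything on the path is paid once and moves along. To keep the number of positions small, this
is split into single steps of a *carrier* that remembers the vertex `o` where it started and its
current vertex `z`. A position then consists of `2q` vertices, a set of terminals, `o` and `z`.

**Soundness.** The vertices that have been paid contain paths from all roots to the forward
tokens, from the backward tokens to the forward tokens, and from the backward tokens to the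
collected terminals. Hence a final position yields a solution with trunk `v` of at most the cost
of the play (`Ctx.PlayIn`, `Ctx.Sound.table`, `Ctx.exists_solution`).

**Completeness.** Let `W` be the vertex set of an optimal solution with trunk `v`, and let `C` be
the strong component of `v` in `W`. The tokens first walk from the roots into `C`, such that no
vertex is entered after it has been left (`tokens_gather`, `play_gather`). Let `D ⊆ C` be a
minimal strongly connected set that contains the tokens. Inside `D` they can be brought to one
vertex such that no vertex that has been left is used again, and so none is paid twice
(`tokens_meet`). The reason is this: if a token can leave its vertex `u` without cutting off
another token, it makes a step and `u` is given up. Otherwise choose a backward token `b` such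
that no backward token depends on `b`, and with as many vertices as possible on which `b` itself
depends on its way to the target. Then there is a forward token `f` that has to pass `b`, while
`b` can only be reached through `f`, and the exchange of `f` and `b` does not cut off anything
(`exists_exchange`). In the end the visited vertices are strongly connected and contain the
starting points, hence they are all of `D` by minimality (`play_core`). What is reachable from `D`
otherwise hangs off `D` in out-trees with disjoint vertex sets, which are collected when their
roots are visited (`exists_bundles`). Altogether every vertex of `W` is paid at most once
(`play_complete`).

**Running time.** The plays so obtained take at most `49 n⁴` rounds. The table of the dynamic
program has `(n ^ (2q) + 1) · 2 ^ (|T| + 1) · n ^ 2` entries: tuples of tokens, and one further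
index for the out-trees. One round treats all combinations of an entry with a vertex and a second
set of terminals, and `Ctx.rules` says that the table after `k` rounds knows all positions that
are reached by `k` moves. This bounds both the number of steps, up to a factor `O(q)`, and the
stored numbers. Therefore it is enough to count elementary steps and to bound the numbers that
occur; `Run.exec` converts this into logarithmic costs. The first part of the theorem is the
second one for fixed `q`.
-/

namespace SteinerTrunk

/-! ### Counting steps instead of logarithmic costs -/

/-- All numbers stored in the machine are at most `B`. -/
def State.Bdd (B : ℕ) (s : State) : Prop :=
  (∀ r, s.reg r ≤ B) ∧ ∀ a i, s.arr a i ≤ B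

/-- `Run B p s s' k`: program `p` leads from `s` to `s'` in `k` elementary steps, and every number
that is written on the way is at most `B`. -/
inductive Run (B : ℕ) : Prog → State → State → ℕ → Prop where
  | skip (s : State) : Run B .skip s s 1
  | set (s : State) (r : ℕ) (e : Expr) (h : e.val s ≤ B) :
      Run B (.set r e) s (s.setReg r (e.val s)) 1
  | store (s : State) (a : ℕ) (i e : Expr) (h : e.val s ≤ B) :
      Run B (.store a i e) s (s.setArr a (i.val s) (e.val s)) 1
  | seq {p p' : Prog} {s s' s'' : State} {k k' : ℕ} (h : Run B p s s' k) (h' : Run B p' s' s'' k') :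
      Run B (.seq p p') s s'' (k + k')
  | cond_true {e : Expr} {p p' : Prog} {s s' : State} {k : ℕ} (he : e.val s ≠ 0)
      (h : Run B p s s' k) : Run B (.cond e p p') s s' (1 + k)
  | cond_false {e : Expr} {p p' : Prog} {s s' : State} {k : ℕ} (he : e.val s = 0)
      (h : Run B p' s s' k) : Run B (.cond e p p') s s' (1 + k)
  | loop_true {e : Expr} {p : Prog} {s s' s'' : State} {k k' : ℕ} (he : e.val s ≠ 0)
      (h : Run B p s s' k) (h' : Run B (.loop e p) s' s'' k') :
      Run B (.loop e p) s s'' (1 + k + k')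
  | loop_false {e : Expr} {p : Prog} {s : State} (he : e.val s = 0) :
      Run B (.loop e p) s s 1

/-- The value of an expression is at most `Expr.width` times as long as the stored numbers. -/
def Expr.width : Expr → ℕ
  | .const c => c.size
  | .reg _ => 1
  | .load _ _ => 1
  | .bin _ e f => e.width + f.width + 1

/-- The cost of an expression is at most `Expr.weight` times the length of the stored numbers. -/
def Expr.weight : Expr → ℕ
  | .const c => len c
  | .reg r => len r + 2
  | .load a i => i.weight + len a + (i.width + 1) + 2
  | .bin _ e f => e.weight + f.weight + (e.width + 1) + (f.width + 1) + (e.width + f.width + 2)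

/-- Every elementary step of a program costs at most `Prog.weight` times the length of the stored
numbers. -/
def Prog.weight : Prog → ℕ
  | .skip => 1
  | .set r e => e.weight + len r + (e.width + 1)
  | .store a i e => i.weight + e.weight + len a + (i.width + 1) + (e.width + 1)
  | .seq p p' => p.weight + p'.weight
  | .cond e p p' => e.weight + p.weight + p'.weight
  | .loop e p => e.weight + p.weight

theorem size_add_le (x y : ℕ) : (x + y).size ≤ x.size + y.size + 1 := by
  rw [Nat.size_le]
  have hx := Nat.lt_size_self x
  have hy := Nat.lt_size_self y
  have h1 : 2 ^ x.size ≤ 2 ^ (x.size + y.size) := Nat.pow_le_pow_right (by norm_num) (by omega)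
  have h2 : 2 ^ y.size ≤ 2 ^ (x.size + y.size) := Nat.pow_le_pow_right (by norm_num) (by omega)
  rw [pow_succ]
  omega

theorem size_mul_le (x y : ℕ) : (x * y).size ≤ x.size + y.size := by
  rw [Nat.size_le, pow_add]
  exact Nat.mul_lt_mul'' (Nat.lt_size_self x) (Nat.lt_size_self y)

theorem Op.size_apply_le (o : Op) (x y : ℕ) : (o.apply x y).size ≤ x.size + y.size + 1 := by
  cases o with
  | add => exact size_add_le x y
  | sub => exact (Nat.size_le_size (Nat.sub_le x y)).trans (by omega)
  | mul => exact (size_mul_le x y).trans (by omega)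
  | div => exact (Nat.size_le_size (Nat.div_le_self x y)).trans (by omega)
  | lt => simp only [Op.apply]; split_ifs <;> simp
  | eq => simp only [Op.apply]; split_ifs <;> simp

theorem Expr.size_val_le {B : ℕ} (hB : 1 ≤ B) {s : State} (hs : s.Bdd B) (e : Expr) :
    (e.val s).size ≤ e.width * B.size := by
  have h1 : 1 ≤ B.size := Nat.size_pos.2 hB
  induction e with
  | const c => exact Nat.le_mul_of_pos_right _ h1
  | reg r => simpa [Expr.val, Expr.width] using Nat.size_le_size (hs.1 r)
  | load a i _ => simpa [Expr.val, Expr.width] using Nat.size_le_size (hs.2 a (i.val s))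
  | bin o e f he hf =>
    have := o.size_apply_le (e.val s) (f.val s)
    simp only [Expr.val, Expr.width]
    nlinarith

theorem Expr.cost_le {B : ℕ} (hB : 1 ≤ B) {s : State} (hs : s.Bdd B) (e : Expr) :
    e.cost s ≤ e.weight * B.size := by
  have h1 : 1 ≤ B.size := Nat.size_pos.2 hB
  induction e with
  | const c => exact Nat.le_mul_of_pos_right _ h1
  | reg r =>
    have := Nat.size_le_size (hs.1 r)
    simp only [Expr.cost, Expr.weight, len]
    nlinarith [Nat.zero_le r.size]
  | load a i hi =>
    have h2 := Nat.size_le_size (hs.2 a (i.val s))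
    have h3 := i.size_val_le hB hs
    simp only [Expr.cost, Expr.weight, len]
    nlinarith [Nat.zero_le a.size]
  | bin o e f he hf =>
    have h2 := o.size_apply_le (e.val s) (f.val s)
    have h3 := e.size_val_le hB hs
    have h4 := f.size_val_le hB hs
    simp only [Expr.cost, Expr.weight, len]
    nlinarith

theorem State.Bdd.setReg {B : ℕ} {s : State} (hs : s.Bdd B) (r : ℕ) {v : ℕ} (hv : v ≤ B) :
    (s.setReg r v).Bdd B := by
  refine ⟨fun r' => ?_, hs.2⟩
  simp only [State.setReg]
  split_ifs
  exacts [hv, hs.1 r']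

theorem State.Bdd.setArr {B : ℕ} {s : State} (hs : s.Bdd B) (a i : ℕ) {v : ℕ} (hv : v ≤ B) :
    (s.setArr a i v).Bdd B := by
  refine ⟨hs.1, fun a' i' => ?_⟩
  simp only [State.setArr]
  split_ifs
  exacts [hv, hs.2 a' i']

/-- `k` elementary steps with numbers up to `B` have logarithmic cost `O(k · log B)`; the constant
depends on the program only. -/
theorem Run.exec {B : ℕ} (hB : 1 ≤ B) {p : Prog} {s s' : State} {k : ℕ} (h : Run B p s s' k) :
    s.Bdd B → ∀ K, p.weight ≤ K → s'.Bdd B ∧ ∃ c, Exec p s s' c ∧ c ≤ k * (K * B.size) := by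
  have h1 : 1 ≤ B.size := Nat.size_pos.2 hB
  induction h with
  | skip s =>
    intro hs K hK
    simp only [Prog.weight] at hK
    exact ⟨hs, 1, .skip s, by nlinarith⟩
  | set s r e h =>
    intro hs K hK
    simp only [Prog.weight] at hK
    refine ⟨hs.setReg r h, _, .set s r e, ?_⟩
    have h2 := e.cost_le hB hs
    have h3 := e.size_val_le hB hs
    have h4 := Nat.mul_le_mul_right B.size hK
    simp only [len] at *
    nlinarith [Nat.zero_le r.size]
  | store s a i e h =>
    intro hs K hK
    simp only [Prog.weight] at hK
    refine ⟨hs.setArr a _ h, _, .store s a i e, ?_⟩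
    have h2 := e.cost_le hB hs
    have h3 := e.size_val_le hB hs
    have h5 := i.cost_le hB hs
    have h6 := i.size_val_le hB hs
    have h4 := Nat.mul_le_mul_right B.size hK
    simp only [len] at *
    nlinarith [Nat.zero_le a.size]
  | seq h h' ih ih' =>
    intro hs K hK
    simp only [Prog.weight] at hK
    obtain ⟨hs', c, hc, hck⟩ := ih hs K (by omega)
    obtain ⟨hs'', c', hc', hck'⟩ := ih' hs' K (by omega)
    exact ⟨hs'', c + c', .seq hc hc', by rw [add_mul]; omega⟩
  | cond_true he h ih =>
    rename_i e p p' s s' k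
    intro hs K hK
    simp only [Prog.weight] at hK
    obtain ⟨hs', c, hc, hck⟩ := ih hs K (by omega)
    have h2 := e.cost_le hB hs
    have h4 := Nat.mul_le_mul_right B.size (show e.weight ≤ K by omega)
    exact ⟨hs', _, .cond_true he hc, by rw [add_mul]; omega⟩
  | cond_false he h ih =>
    rename_i e p p' s s' k
    intro hs K hK
    simp only [Prog.weight] at hK
    obtain ⟨hs', c, hc, hck⟩ := ih hs K (by omega)
    have h2 := e.cost_le hB hs
    have h4 := Nat.mul_le_mul_right B.size (show e.weight ≤ K by omega)
    exact ⟨hs', _, .cond_false he hc, by rw [add_mul]; omega⟩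
  | loop_true he h h' ih ih' =>
    rename_i e p s s' s'' k k'
    intro hs K hK
    simp only [Prog.weight] at hK ih'
    obtain ⟨hs', c, hc, hck⟩ := ih hs K (by omega)
    obtain ⟨hs'', c', hc', hck'⟩ := ih' hs' K (by omega)
    have h2 := e.cost_le hB hs
    have h4 := Nat.mul_le_mul_right B.size (show e.weight ≤ K by omega)
    exact ⟨hs'', _, .loop_true he hc hc', by rw [add_mul, add_mul]; omega⟩
  | loop_false he =>
    rename_i e p s
    intro hs K hK
    simp only [Prog.weight] at hK
    have h2 := e.cost_le hB hs
    have h4 := Nat.mul_le_mul_right B.size (show e.weight ≤ K by omega)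
    exact ⟨hs, _, .loop_false he, by omega⟩

/-! ### Total correctness with step counts -/

/-- Started in `s`, program `p` halts within `k` steps in a state satisfying `Q`, and all numbers
written on the way are at most `B`. -/
def Ends (B : ℕ) (p : Prog) (s : State) (k : ℕ) (Q : State → Prop) : Prop :=
  ∃ s' k', Run B p s s' k' ∧ k' ≤ k ∧ Q s'

theorem Ends.mono {B : ℕ} {p : Prog} {s : State} {k l : ℕ} {P Q : State → Prop}
    (h : Ends B p s k P) (hk : k ≤ l) (hPQ : ∀ s', P s' → Q s') : Ends B p s l Q := by
  obtain ⟨s', k', h1, h2, h3⟩ := h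
  exact ⟨s', k', h1, h2.trans hk, hPQ s' h3⟩

theorem Ends.skip {B : ℕ} {s : State} {Q : State → Prop} (hQ : Q s) : Ends B .skip s 1 Q :=
  ⟨_, _, .skip s, le_rfl, hQ⟩

theorem Ends.set {B : ℕ} {s : State} {r : ℕ} {e : Expr} {Q : State → Prop} (h : e.val s ≤ B)
    (hQ : Q (s.setReg r (e.val s))) : Ends B (.set r e) s 1 Q :=
  ⟨_, _, .set s r e h, le_rfl, hQ⟩

theorem Ends.store {B : ℕ} {s : State} {a : ℕ} {i e : Expr} {Q : State → Prop} (h : e.val s ≤ B)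
    (hQ : Q (s.setArr a (i.val s) (e.val s))) : Ends B (.store a i e) s 1 Q :=
  ⟨_, _, .store s a i e h, le_rfl, hQ⟩

theorem Ends.seq {B : ℕ} {p p' : Prog} {s : State} {k k' : ℕ} {Q : State → Prop}
    (h : Ends B p s k fun s' => Ends B p' s' k' Q) : Ends B (.seq p p') s (k + k') Q := by
  obtain ⟨s', l, h1, h2, s'', l', h3, h4, h5⟩ := h
  exact ⟨s'', l + l', h1.seq h3, by omega, h5⟩

theorem Ends.cond {B : ℕ} {e : Expr} {p p' : Prog} {s : State} {k : ℕ} {Q : State → Prop}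
    (h : e.val s ≠ 0 → Ends B p s k Q) (h' : e.val s = 0 → Ends B p' s k Q) :
    Ends B (.cond e p p') s (1 + k) Q := by
  by_cases he : e.val s = 0
  · obtain ⟨s', l, h1, h2, h3⟩ := h' he
    exact ⟨s', 1 + l, .cond_false he h1, by omega, h3⟩
  · obtain ⟨s', l, h1, h2, h3⟩ := h he
    exact ⟨s', 1 + l, .cond_true he h1, by omega, h3⟩

/-- The rule for a loop that is known to make exactly `m` rounds. -/
theorem Ends.loop {B : ℕ} {e : Expr} {p : Prog} {m k : ℕ} {I : ℕ → State → Prop}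
    (hstep : ∀ j s, j < m → I j s → e.val s ≠ 0 ∧ Ends B p s k (I (j + 1)))
    (hend : ∀ s, I m s → e.val s = 0) {s : State} (h0 : I 0 s) :
    Ends B (.loop e p) s (m * (k + 1) + 1) (I m) := by
  have main : ∀ l j s, j + l = m → I j s → Ends B (.loop e p) s (l * (k + 1) + 1) (I m) := by
    intro l
    induction l with
    | zero =>
      intro j s hj hI
      obtain rfl : j = m := by omega
      exact ⟨s, 1, .loop_false (hend s hI), by omega, hI⟩
    | succ l ih =>
      intro j s hj hI
      obtain ⟨he, s', k1, h1, h2, h3⟩ := hstep j s (by omega) hI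
      obtain ⟨s'', k2, h4, h5, h6⟩ := ih (j + 1) s' (by omega) h3
      refine ⟨s'', 1 + k1 + k2, .loop_true he h1 h4, ?_, h6⟩
      rw [Nat.succ_mul]
      omega
  exact main m 0 s (by omega) h0

/-! ### Reachability inside a vertex set -/

section Reach

variable {V : Type*} {r : V → V → Prop} {S S' Z : Set V} {x y z u v : V}

/-- `y` is reachable from `x` by a walk that stays inside `S`. -/
def ReachIn (r : V → V → Prop) (S : Set V) (x y : V) : Prop :=
  x ∈ S ∧ Relation.ReflTransGen (fun a b => r a b ∧ b ∈ S) x y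

theorem ReachIn.refl (h : x ∈ S) : ReachIn r S x x := ⟨h, .refl⟩

theorem ReachIn.right_mem (h : ReachIn r S x y) : y ∈ S := by
  obtain ⟨h1, h2⟩ := h
  induction h2 with
  | refl => exact h1
  | tail _ h _ => exact h.2

theorem ReachIn.trans (h : ReachIn r S x y) (h' : ReachIn r S y z) : ReachIn r S x z :=
  ⟨h.1, h.2.trans h'.2⟩

theorem ReachIn.mono (h : ReachIn r S x y) (hS : S ⊆ S') : ReachIn r S' x y :=
  ⟨hS h.1, Relation.ReflTransGen.mono (fun _ _ hab => ⟨hab.1, hS hab.2⟩) _ _ h.2⟩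

theorem ReachIn.single (hx : x ∈ S) (hy : y ∈ S) (h : r x y) : ReachIn r S x y :=
  ⟨hx, .single ⟨h, hy⟩⟩

theorem ReachIn.head (hx : x ∈ S) (h : r x y) (h' : ReachIn r S y z) : ReachIn r S x z :=
  (ReachIn.single hx h'.1 h).trans h'

theorem ReachIn.tail (h' : ReachIn r S x y) (h : r y z) (hz : z ∈ S) : ReachIn r S x z :=
  h'.trans (.single h'.right_mem hz h)

theorem ReachIn.swap (h : ReachIn r S x y) : ReachIn (Function.swap r) S y x := by
  have hy := h.right_mem
  obtain ⟨h1, h2⟩ := h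
  induction h2 with
  | refl => exact .refl h1
  | tail hab hbc ih =>
    have hb := ReachIn.right_mem (r := r) ⟨h1, hab⟩
    exact .head hbc.2 (by exact hbc.1) (ih hb)

theorem reachIn_swap : ReachIn (Function.swap r) S x y ↔ ReachIn r S y x :=
  ⟨fun h => h.swap, fun h => h.swap⟩

/-- A walk either avoids `Z` or passes through a vertex of `Z`. -/
theorem ReachIn.avoid_or (h : ReachIn r S x y) (Z : Set V) :
    ReachIn r (S \ Z) x y ∨ ∃ u ∈ Z, ReachIn r S x u ∧ ReachIn r S u y := by
  have hy := h.right_mem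
  obtain ⟨h1, h2⟩ := h
  induction h2 using Relation.ReflTransGen.head_induction_on with
  | refl =>
    by_cases hz : y ∈ Z
    · exact .inr ⟨y, hz, .refl hy, .refl hy⟩
    · exact .inl (.refl ⟨hy, hz⟩)
  | head hac hcb ih =>
    rename_i a c
    by_cases hz : a ∈ Z
    · exact .inr ⟨a, hz, .refl h1, ⟨h1, .head hac hcb⟩⟩
    · rcases ih hac.2 with h | ⟨u, hu, h, h'⟩
      · exact .inl (.head ⟨h1, hz⟩ hac.1 h)
      · exact .inr ⟨u, hu, .head h1 hac.1 h, h'⟩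

theorem ReachIn.through (h : ReachIn r S x y) (h' : ¬ ReachIn r (S \ {u}) x y) :
    ReachIn r S x u ∧ ReachIn r S u y := by
  rcases h.avoid_or {u} with h1 | ⟨_, rfl, h1⟩
  exacts [absurd h1 h', h1]

/-- The first step of a walk can be chosen so that the walk never returns to its start. -/
theorem ReachIn.exists_step (h : ReachIn r S x y) (hne : x ≠ y) :
    ∃ x', r x x' ∧ ReachIn r (S \ {x}) x' y := by
  have key : ∀ a, Relation.ReflTransGen (fun a b => r a b ∧ b ∈ S) a y → a ∈ S →
      ReachIn r (S \ {x}) a y ∨ ∃ x', r x x' ∧ ReachIn r (S \ {x}) x' y := by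
    intro a ha
    induction ha using Relation.ReflTransGen.head_induction_on with
    | refl => exact fun hy => .inl (.refl ⟨hy, fun h => hne h.symm⟩)
    | head hac hcb ih =>
      rename_i a c
      intro haS
      rcases ih hac.2 with h | h
      · by_cases hax : a = x
        · exact .inr ⟨c, hax ▸ hac.1, h⟩
        · exact .inl (.head ⟨haS, hax⟩ hac.1 h)
      · exact .inr h
  rcases key x h.2 h.1 with h | h
  · exact absurd rfl h.1.2
  · exact h

theorem ReachIn.exists_last_step (h : ReachIn r S x y) (hne : x ≠ y) :
    ∃ y', r y' y ∧ ReachIn r (S \ {y}) x y' := by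
  obtain ⟨y', h1, h2⟩ := h.swap.exists_step hne.symm
  exact ⟨y', h1, reachIn_swap.1 h2⟩

/-- A walk only uses vertices that lie between its ends. -/
theorem ReachIn.between (h : ReachIn r S x y) :
    ReachIn r {a | ReachIn r S x a ∧ ReachIn r S a y} x y := by
  rcases h.avoid_or {a | ¬ (ReachIn r S x a ∧ ReachIn r S a y)} with h | ⟨u, hu, h⟩
  · refine h.mono ?_
    rintro a ⟨_, ha⟩
    simpa using ha
  · exact absurd h hu

theorem exists_simple_path [DecidableEq V] (S : Finset V) {x y : V} (h : ReachIn r S x y)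
    (hne : x ≠ y) :
    ∃ l : List V, (x :: (l ++ [y])).Nodup ∧ (x :: (l ++ [y])).IsChain r ∧ ∀ a ∈ l, a ∈ S := by
  induction hn : S.card generalizing S x with
  | zero =>
    rw [Finset.card_eq_zero] at hn
    simpa [hn] using h.1
  | succ n ih =>
    obtain ⟨x', hxx, hx'⟩ := h.exists_step hne
    have hxS : x ∈ S := by exact_mod_cast h.1
    have hy := h.right_mem
    rw [← Finset.coe_erase] at hx'
    by_cases hxy : x' = y
    · subst hxy
      exact ⟨[], by simpa using hne, by simpa using hxx, by simp⟩
    · obtain ⟨l, h1, h2, h3⟩ := ih (S.erase x) hx' hxy (by rw [Finset.card_erase_of_mem hxS]; omega)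
      have hx'm := hx'.1
      refine ⟨x' :: l, ?_, ?_, ?_⟩
      · rw [List.cons_append, List.nodup_cons]
        refine ⟨?_, h1⟩
        simp only [List.mem_cons, List.mem_append, List.not_mem_nil, or_false, not_or]
        exact ⟨fun h => by simp [← h] at hx'm, fun h => by simpa using h3 x h, hne⟩
      · rw [List.cons_append, List.isChain_cons_cons]
        exact ⟨hxx, h2⟩
      · intro a ha
        rcases List.mem_cons.1 ha with rfl | ha
        · exact Finset.mem_of_mem_erase (by exact_mod_cast hx'm)
        · exact Finset.mem_of_mem_erase (h3 a ha)

theorem reachIn_of_chain_head {l : List V} (h : (x :: l).IsChain r) (hS : ∀ a ∈ x :: l, a ∈ S) :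
    ∀ a ∈ x :: l, ReachIn r S x a := by
  induction l generalizing x with
  | nil =>
    intro a ha
    obtain rfl : a = x := by simpa using ha
    exact .refl (hS _ (by simp))
  | cons c l ih =>
    rw [List.isChain_cons_cons] at h
    intro a ha
    rcases List.mem_cons.1 ha with rfl | ha
    · exact .refl (hS _ (by simp))
    · exact .head (hS _ (by simp)) h.1 (ih h.2 (fun b hb => hS b (List.mem_cons_of_mem _ hb)) a ha)

theorem reachIn_of_chain_last {l : List V} (h : (l ++ [y]).IsChain r)
    (hS : ∀ a ∈ l ++ [y], a ∈ S) : ∀ a ∈ l ++ [y], ReachIn r S a y := by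
  induction l with
  | nil =>
    intro a ha
    obtain rfl : a = y := by simpa using ha
    exact .refl (hS _ (by simp))
  | cons c l ih =>
    have ih := ih (by rw [List.cons_append] at h; exact h.tail)
      (fun b hb => hS b (by simp only [List.cons_append, List.mem_cons]; exact .inr hb))
    intro a ha
    rw [List.cons_append] at ha
    rcases List.mem_cons.1 ha with rfl | ha
    · cases l with
      | nil =>
        simp only [List.cons_append, List.nil_append, List.isChain_cons_cons] at h
        exact .single (hS _ (by simp)) (hS _ (by simp)) h.1
      | cons c l =>
        simp only [List.cons_append, List.isChain_cons_cons] at h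
        exact .head (hS _ (by simp)) h.1 (ih c (by simp))
    · exact ih a ha

/-- `u ≠ x`, and every walk from `x` to `v` inside `S` passes through `u`. -/
def Needs (r : V → V → Prop) (S : Set V) (v u x : V) : Prop :=
  u ≠ x ∧ ¬ ReachIn r (S \ {u}) x v

theorem Needs.antisymm {f b : V} (h : Needs r S v b f) (h' : Needs r S v f b)
    (hf : ReachIn r S f v) : False := by
  by_cases hfv : f = v
  · subst hfv
    exact h.2 (.refl ⟨hf.1, h.1.symm⟩)
  · obtain ⟨f', h1, h2⟩ := hf.exists_step hfv
    rcases h2.avoid_or {b} with h3 | ⟨_, rfl, _, h3⟩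
    · refine h.2 (.head ⟨hf.1, h.1.symm⟩ h1 (h3.mono ?_))
      exact fun a ha => ⟨ha.1.1, ha.2⟩
    · exact h'.2 h3

theorem Needs.trans {f b g : V} (h : Needs r S v b f) (h' : Needs r S v f g)
    (hg : ReachIn r S g v) : Needs r S v b g := by
  refine ⟨?_, fun h1 => ?_⟩
  · rintro rfl
    exact h'.antisymm h hg
  · rcases h1.avoid_or {f} with h2 | ⟨_, rfl, _, h2⟩
    · exact h'.2 (h2.mono fun a ha => ⟨ha.1.1, ha.2⟩)
    · exact h.2 h2

theorem not_needs_self (h : v ∈ S) (hu : u ≠ v) : ¬ Needs r S v u v :=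
  fun h' => h'.2 (.refl ⟨h, hu.symm⟩)

theorem Needs.mem {f b : V} (h : Needs r S v b f) (hf : ReachIn r S f v) : b ∈ S := by
  by_contra hb
  exact h.2 (hf.mono fun a ha => ⟨ha, fun h => hb (h ▸ ha)⟩)

theorem reachIn_of_not_needs {f b : V} (h : ¬ Needs r S v b f) (hne : b ≠ f) :
    ReachIn r (S \ {b}) f v := by
  by_contra h'
  exact h ⟨hne, h'⟩

open Classical in
/-- The number of vertices of `A` that `x` needs on its way to `v`. -/
noncomputable def needCount (r : V → V → Prop) (A : Finset V) (v x : V) : ℕ :=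
  (A.filter fun u => Needs r A v u x).card

theorem needCount_le (A : Finset V) : needCount r A v x ≤ A.card := by
  classical exact Finset.card_filter_le _ _

theorem needCount_lt {A : Finset V} {f b : V} (h : Needs r A v b f) (hf : ReachIn r A f v) :
    needCount r A v b < needCount r A v f := by
  classical
  refine Finset.card_lt_card ?_
  rw [Finset.ssubset_iff_of_subset]
  · exact ⟨b, by simpa using ⟨h.mem hf, h⟩, fun hb => (Finset.mem_filter.1 hb).2.1 rfl⟩
  · intro u hu
    rw [Finset.mem_filter] at hu ⊢
    exact ⟨hu.1, hu.2.trans h hf⟩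

/-- Above every token there is a token that no other token needs. -/
theorem exists_outer {A T : Finset V} (hT : ∀ t ∈ T, ReachIn r A t v) (hx : x ∈ T) :
    ∃ y ∈ T, (y = x ∨ Needs r A v x y) ∧ ∀ t ∈ T, ¬ Needs r A v y t := by
  classical
  obtain ⟨y, hy, hmax⟩ := Finset.exists_max_image (T.filter fun y => y = x ∨ Needs r A v x y)
    (needCount r A v) ⟨x, by simp [hx]⟩
  rw [Finset.mem_filter] at hy
  refine ⟨y, hy.1, hy.2, fun t ht hyt => ?_⟩
  have := needCount_lt hyt (hT t ht)
  have h2 := hmax t (Finset.mem_filter.2 ⟨ht, .inr ?_⟩)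
  · omega
  · rcases hy.2 with rfl | h
    exacts [hyt, h.trans hyt (hT t ht)]

/-- If the vertices outside `C` all reach `v`, then one of them can be deleted such that the others
still do. -/
theorem exists_removable {A C : Finset V} (hCA : C ⊆ A) (hC : ∀ c ∈ C, ReachIn r C c v)
    (hA : ∀ a ∈ A, ReachIn r A a v) (hne : ∃ a ∈ A, a ∉ C) :
    ∃ u ∈ A, u ∉ C ∧ ∀ a ∈ A, a ≠ u → ReachIn r (A \ {u} : Set V) a v := by
  classical
  obtain ⟨u, hu, hmax⟩ := Finset.exists_max_image (A \ C) (needCount r A v)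
    (by obtain ⟨a, ha, ha'⟩ := hne; exact ⟨a, by simp [ha, ha']⟩)
  rw [Finset.mem_sdiff] at hu
  refine ⟨u, hu.1, hu.2, fun a ha hau => ?_⟩
  by_contra h
  by_cases haC : a ∈ C
  · exact h ((hC a haC).mono fun c hc => ⟨hCA hc, fun h => hu.2 (h ▸ hc)⟩)
  · have h1 := needCount_lt (b := u) ⟨hau.symm, h⟩ (hA a ha)
    have h2 := hmax a (Finset.mem_sdiff.2 ⟨ha, haC⟩)
    omega

end Reach

/-! ### The exchange of two tokens -/

section Tokens

variable {V : Type*} [DecidableEq V] {r : V → V → Prop} {v : V}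

/-- The heart of the exchange argument. The tokens in `F` have to walk to `v` and those in `B` have
to be reached from `v`, inside `A`. If no token can leave its vertex without cutting off another
token, then some `f ∈ F` and `b ∈ B` can be exchanged along a simple path `f, l, b`: the tokens
that do not lie on that path do not need its interior. -/
theorem exists_exchange {A F B : Finset V} (hvA : v ∈ A)
    (hF : ∀ f ∈ F, ReachIn r A f v) (hB : ∀ b ∈ B, ReachIn r A v b)
    (hstuck : ∀ u, u ∈ F ∨ u ∈ B → u ≠ v →
      (∃ f ∈ F, Needs r A v u f) ∨ ∃ b ∈ B, Needs (Function.swap r) A v u b)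
    (hdone : ∃ u, (u ∈ F ∨ u ∈ B) ∧ u ≠ v) :
    ∃ f ∈ F, ∃ b ∈ B, ∃ l : List V, (f :: (l ++ [b])).Nodup ∧ (f :: (l ++ [b])).IsChain r ∧
      (∀ x ∈ l, x ∈ A) ∧ v ∉ l ∧ needCount r A v b < needCount r A v f ∧
      (∀ g ∈ F, g ∉ f :: (l ++ [b]) → ReachIn r (A \ {x | x ∈ l} : Set V) g v) ∧
      (∀ c ∈ B, c ∉ f :: (l ++ [b]) → ReachIn r (A \ {x | x ∈ l} : Set V) v c) ∧
      ReachIn r (A \ {x | x ∈ l} : Set V) b v ∧ ReachIn r (A \ {x | x ∈ l} : Set V) v f := by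
  classical
  have hB' : ∀ b ∈ B, ReachIn (Function.swap r) A b v := fun b hb => (hB b hb).swap
  have claimB : ∀ b ∈ B, b ≠ v → (∀ c ∈ B, ¬ Needs (Function.swap r) A v b c) →
      ∃ f ∈ F, (∀ g ∈ F, ¬ Needs r A v f g) ∧ f ≠ v ∧ Needs r A v b f := by
    intro b hb hbv hbo
    rcases hstuck b (.inr hb) hbv with ⟨f, hf, h⟩ | ⟨c, hc, h⟩
    · obtain ⟨f', hf', h1, h2⟩ := exists_outer hF hf
      have h3 : Needs r A v b f' := by
        rcases h1 with rfl | h1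
        exacts [h, h.trans h1 (hF f' hf')]
      refine ⟨f', hf', h2, ?_, h3⟩
      rintro rfl
      exact not_needs_self (by exact_mod_cast hvA) hbv h3
    · exact absurd h (hbo c hc)
  have claimF : ∀ f ∈ F, f ≠ v → (∀ c ∈ F, ¬ Needs r A v f c) →
      ∃ b ∈ B, (∀ c ∈ B, ¬ Needs (Function.swap r) A v b c) ∧ b ≠ v ∧
        Needs (Function.swap r) A v f b := by
    intro f hf hfv hfo
    rcases hstuck f (.inl hf) hfv with ⟨c, hc, h⟩ | ⟨b, hb, h⟩
    · exact absurd h (hfo c hc)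
    · obtain ⟨b', hb', h1, h2⟩ := exists_outer hB' hb
      have h3 : Needs (Function.swap r) A v f b' := by
        rcases h1 with rfl | h1
        exacts [h, h.trans h1 (hB' b' hb')]
      refine ⟨b', hb', h2, ?_, h3⟩
      rintro rfl
      exact not_needs_self (by exact_mod_cast hvA) hfv h3
  -- the outer tokens of `B`
  let B₁ := B.filter fun b => b ≠ v ∧ ∀ c ∈ B, ¬ Needs (Function.swap r) A v b c
  have hmem : ∀ b, b ∈ B₁ ↔ b ∈ B ∧ b ≠ v ∧ ∀ c ∈ B, ¬ Needs (Function.swap r) A v b c :=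
    fun b => Finset.mem_filter
  have hB₁ : B₁.Nonempty := by
    obtain ⟨u, hu | hu, huv⟩ := hdone
    · obtain ⟨f, hf, h1, h2⟩ := exists_outer hF hu
      have hfv : f ≠ v := by
        rintro rfl
        rcases h1 with rfl | h1
        exacts [huv rfl, not_needs_self (by exact_mod_cast hvA) huv h1]
      obtain ⟨b, hb, hbo, hbv, -⟩ := claimF f hf hfv h2
      exact ⟨b, (hmem b).2 ⟨hb, hbv, hbo⟩⟩
    · obtain ⟨b, hb, h1, h2⟩ := exists_outer hB' hu
      refine ⟨b, (hmem b).2 ⟨hb, ?_, h2⟩⟩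
      rintro rfl
      rcases h1 with rfl | h1
      exacts [huv rfl, not_needs_self (by exact_mod_cast hvA) huv h1]
  obtain ⟨b, hb₁, hmax⟩ := Finset.exists_max_image B₁ (needCount r A v) hB₁
  obtain ⟨hb, hbv, hbo⟩ := (hmem b).1 hb₁
  obtain ⟨f, hf, hfo, hfv, hbf⟩ := claimB b hb hbv hbo
  have hmax' : ∀ c ∈ B, c ≠ v → (∀ d ∈ B, ¬ Needs (Function.swap r) A v c d) →
      ¬ Needs r A v b c := by
    intro c hc hcv hco hbc
    obtain ⟨g, hg, -, -, hcg⟩ := claimB c hc hcv hco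
    have h1 := needCount_lt hbc ((hF g hg).through hcg.2).2
    have h2 := hmax c ((hmem c).2 ⟨hc, hcv, hco⟩)
    omega
  have star : ∀ g ∈ F, (∀ c ∈ F, ¬ Needs r A v g c) → g ≠ v → Needs r A v b g →
      Needs (Function.swap r) A v g b := by
    intro g hg hgo hgv hbg
    obtain ⟨b', hb', hbo', hbv', hgb'⟩ := claimF g hg hgv hgo
    by_cases hbb : b' = b
    · rwa [← hbb]
    · exfalso
      have h1 := reachIn_swap.1 (reachIn_of_not_needs (hbo b' hb') (Ne.symm hbb))
      rcases h1.avoid_or {g} with h2 | ⟨_, rfl, -, h2⟩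
      · exact hgb'.2 (reachIn_swap.2 (h2.mono fun a ha => ⟨ha.1.1, ha.2⟩))
      · exact hmax' b' hb' hbv' hbo' ⟨Ne.symm hbb, fun h3 => hbg.2 (h2.trans h3)⟩
  have hfb := star f hf hfo hfv hbf
  have hfb' : ¬ ReachIn r (A \ {f} : Set V) v b := fun h => hfb.2 h.swap
  have hpath : ReachIn r A f b := ((hB b hb).through hfb').2
  obtain ⟨l, hnd, hch, hlA⟩ := exists_simple_path A hpath hfb.1
  have hfA : f ∈ A := by exact_mod_cast (hF f hf).1
  have hbA : b ∈ A := by exact_mod_cast (hB b hb).right_mem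
  have hfl : f ∉ l ++ [b] := (List.nodup_cons.1 hnd).1
  have hbl : b ∉ l := by
    have := (List.nodup_cons.1 hnd).2
    rw [List.nodup_append] at this
    exact fun h => this.2.2 b h b (by simp) rfl
  have hfl' : f ∉ l := fun h => hfl (by simp [h])
  have hsuf : ∀ S : Set V, (∀ x ∈ l, x ∈ S) → b ∈ S → ∀ x ∈ l ++ [b], ReachIn r S x b := by
    intro S h1 h2
    refine reachIn_of_chain_last hch.tail fun a ha => ?_
    rcases List.mem_append.1 ha with h | h
    · exact h1 a h
    · rwa [List.mem_singleton.1 h]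
  have hsuf' : ∀ S : Set V, (∀ x ∈ l, x ∈ S) → b ∈ S → f ∈ S → ∀ x ∈ f :: (l ++ [b]),
      ReachIn r S x b := by
    intro S h1 h2 h3
    refine reachIn_of_chain_last (l := f :: l) hch fun a ha => ?_
    rcases List.mem_append.1 ha with h | h
    · rcases List.mem_cons.1 h with rfl | h
      exacts [h3, h1 a h]
    · rwa [List.mem_singleton.1 h]
  have hpre : ∀ S : Set V, (∀ x ∈ l, x ∈ S) → b ∈ S → f ∈ S → ∀ x ∈ f :: (l ++ [b]),
      ReachIn r S f x := by
    intro S h1 h2 h3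
    refine reachIn_of_chain_head hch fun a ha => ?_
    rcases List.mem_cons.1 ha with rfl | ha
    · exact h3
    rcases List.mem_append.1 ha with h | h
    · exact h1 a h
    · rwa [List.mem_singleton.1 h]
  have hP : ∀ x ∈ l, ¬ ReachIn r (A \ {b} : Set V) x v := by
    intro x hx h
    refine hbf.2 (ReachIn.trans ?_ h)
    refine reachIn_of_chain_head (l := l) (hch.left_of_append (l₁ := f :: l)) (fun a ha => ?_) x
      (by simp [hx])
    rcases List.mem_cons.1 ha with rfl | ha
    · exact ⟨hfA, hfb.1⟩
    · exact ⟨hlA a ha, fun h => hbl (h ▸ ha)⟩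
  have hfl2 : ∀ x ∈ l, ReachIn r (A \ {f} : Set V) x b := fun x hx =>
    hsuf (A \ {f} : Set V) (fun a ha => ⟨hlA a ha, fun h => hfl' (h ▸ ha)⟩) ⟨hbA, hbf.1⟩ x
      (by simp [hx])
  have hD : ∀ x ∈ l, ¬ ReachIn r (A \ {f} : Set V) v x := fun x hx h =>
    hfb' (h.trans (hfl2 x hx))
  have hvl : v ∉ l := fun h => hP v h (.refl ⟨hvA, hbv.symm⟩)
  have sub1 : ∀ u : V, ((A : Set V) \ {u}) \ {x | x ∈ l} ⊆ (A : Set V) \ {x | x ∈ l} :=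
    fun u a ha => ⟨ha.1.1, ha.2⟩
  -- both ends of the path keep their connection to `v`
  have hbv' : ReachIn r (A \ {x | x ∈ l} : Set V) b v := by
    obtain ⟨b', h1, h2⟩ := ((hF f hf).through hbf.2).2.exists_step hbv
    rcases h2.avoid_or {x | x ∈ l} with h3 | ⟨x, hx, -, h3⟩
    · exact .head ⟨hbA, hbl⟩ h1 (h3.mono (sub1 b))
    · exact absurd h3 (hP x hx)
  have hvf' : ReachIn r (A \ {x | x ∈ l} : Set V) v f := by
    obtain ⟨f', h1, h2⟩ := ((hB b hb).through hfb').1.exists_last_step hfv.symm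
    rcases h2.avoid_or {x | x ∈ l} with h3 | ⟨x, hx, h3, -⟩
    · exact .tail (h3.mono (sub1 f)) h1 ⟨hfA, hfl'⟩
    · exact absurd h3 (hD x hx)
  have outF : ∀ g ∈ F, g ∉ f :: (l ++ [b]) → (∀ c ∈ F, ¬ Needs r A v g c) →
      ReachIn r (A \ {x | x ∈ l} : Set V) g v := by
    intro g hg hgX hgo
    by_contra hcon
    simp only [List.mem_cons, List.mem_append, List.not_mem_nil, or_false, not_or] at hgX
    obtain ⟨hgf, hgl, hgb⟩ := hgX
    have hgv : g ≠ v := fun h => hcon (by rw [h]; exact .refl ⟨hvA, hvl⟩)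
    have hbg : Needs r A v b g := by
      refine ⟨Ne.symm hgb, fun h => ?_⟩
      rcases h.avoid_or {x | x ∈ l} with h3 | ⟨x, hx, -, h3⟩
      exacts [hcon (h3.mono (sub1 b)), hP x hx h3]
    have hgb' := star g hg hgo hgv hbg
    have h1 : ReachIn r (A \ {f} : Set V) g b := by
      rcases (reachIn_of_not_needs (hfo g hg) (Ne.symm hgf)).avoid_or {x | x ∈ l} with
        h3 | ⟨x, hx, h3, -⟩
      · exact absurd (h3.mono (sub1 f)) hcon
      · exact h3.trans (hfl2 x hx)
    have h2 : Needs (Function.swap r) A v g f := by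
      refine ⟨hgf, fun h => hgb'.2 (reachIn_swap.2 ((reachIn_swap.1 h).trans ?_))⟩
      exact hsuf' (A \ {g} : Set V) (fun a ha => ⟨hlA a ha, fun h => hgl (h ▸ ha)⟩)
        ⟨hbA, Ne.symm hgb⟩ ⟨hfA, Ne.symm hgf⟩ f (by simp)
    have hfs : ReachIn (Function.swap r) A f v := ((hB b hb).through hfb').1.swap
    have h3 : ReachIn r (A \ {f} : Set V) v g := by
      by_contra h
      exact h2.antisymm ⟨Ne.symm hgf, fun h' => h (reachIn_swap.1 h')⟩ hfs
    exact hfb' (h3.trans h1)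
  have outB : ∀ c ∈ B, c ∉ f :: (l ++ [b]) → (∀ d ∈ B, ¬ Needs (Function.swap r) A v c d) →
      ReachIn r (A \ {x | x ∈ l} : Set V) v c := by
    intro c hc hcX hco
    by_contra hcon
    simp only [List.mem_cons, List.mem_append, List.not_mem_nil, or_false, not_or] at hcX
    obtain ⟨hcf, hcl, hcb⟩ := hcX
    have hcv : c ≠ v := fun h => hcon (by rw [h]; exact .refl ⟨hvA, hvl⟩)
    rcases (reachIn_swap.1 (reachIn_of_not_needs (hbo c hc) (Ne.symm hcb))).avoid_or
      {x | x ∈ l} with h3 | ⟨x, hx, -, h3⟩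
    · exact hcon (h3.mono (sub1 b))
    · exact hmax' c hc hcv hco ⟨Ne.symm hcb, fun h => hP x hx (h3.trans h)⟩
  refine ⟨f, hf, b, hb, l, hnd, hch, hlA, hvl, needCount_lt hbf (hF f hf), ?_, ?_, hbv', hvf'⟩
  · intro g hg hgX
    obtain ⟨g', hg', h1, hgo'⟩ := exists_outer hF hg
    rcases h1 with rfl | h1
    · exact outF g' hg' hgX hgo'
    have key : ∀ S : Set V, S ⊆ (A : Set V) → ReachIn r S g' v → ReachIn r S g v := by
      intro S hS h
      rcases h.avoid_or {g} with h3 | ⟨_, rfl, -, h3⟩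
      · exact absurd (h3.mono (Set.sdiff_subset_sdiff_left hS)) h1.2
      · exact h3
    by_cases hX : g' ∈ f :: (l ++ [b])
    · have hgX' := hgX
      simp only [List.mem_cons, List.mem_append, List.not_mem_nil, or_false, not_or] at hgX'
      have h2 : ReachIn r (A \ {g} : Set V) g' b :=
        hsuf' (A \ {g} : Set V) (fun a ha => ⟨hlA a ha, fun h => hgX'.2.1 (h ▸ ha)⟩)
          ⟨hbA, Ne.symm hgX'.2.2⟩ ⟨hfA, Ne.symm hgX'.1⟩ g' hX
      rcases hbv'.avoid_or {g} with h3 | ⟨_, rfl, -, h3⟩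
      · exact absurd (h2.trans (h3.mono fun a ha => ⟨ha.1.1, ha.2⟩)) h1.2
      · exact h3
    · exact key _ Set.sdiff_subset (outF g' hg' hX hgo')
  · intro c hc hcX
    obtain ⟨c', hc', h1, hco'⟩ := exists_outer hB' hc
    rcases h1 with rfl | h1
    · exact outB c' hc' hcX hco'
    have h1' : ¬ ReachIn r (A \ {c} : Set V) v c' := fun h => h1.2 h.swap
    by_cases hX : c' ∈ f :: (l ++ [b])
    · have hcX' := hcX
      simp only [List.mem_cons, List.mem_append, List.not_mem_nil, or_false, not_or] at hcX'
      have h2 : ReachIn r (A \ {c} : Set V) f c' :=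
        hpre (A \ {c} : Set V) (fun a ha => ⟨hlA a ha, fun h => hcX'.2.1 (h ▸ ha)⟩)
          ⟨hbA, Ne.symm hcX'.2.2⟩ ⟨hfA, Ne.symm hcX'.1⟩ c' hX
      rcases hvf'.avoid_or {c} with h3 | ⟨_, rfl, h3, -⟩
      · exact absurd ((h3.mono fun a ha => ⟨ha.1.1, ha.2⟩ : ReachIn r (A \ {c} : Set V) v f).trans
          h2) h1'
      · exact h3
    · rcases (outB c' hc' hX hco').avoid_or {c} with h3 | ⟨_, rfl, h3, -⟩
      · exact absurd (h3.mono (Set.sdiff_subset_sdiff_left Set.sdiff_subset)) h1'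
      · exact h3

end Tokens

/-! ### Moving all tokens to one vertex -/

section Tokens

variable {V : Type*} {r : V → V → Prop} {v : V}

theorem sum_needCount_le {A F : Finset V} {N : ℕ} (hFA : F ⊆ A) (hA : A.card ≤ N) :
    ∑ f ∈ F, needCount r A v f ≤ N ^ 2 := by
  calc ∑ f ∈ F, needCount r A v f ≤ ∑ _f ∈ F, N :=
        Finset.sum_le_sum fun f _ => (needCount_le A).trans hA
    _ = F.card * N := by simp
    _ ≤ N ^ 2 := by
      rw [sq]
      exact Nat.mul_le_mul_right _ ((Finset.card_le_card hFA).trans hA)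

variable [DecidableEq V]

/-- After an exchange along `f, l, b`, exactly the interior `l` of the path is given up. In this and
the following lemmas, `U` are the unvisited vertices, and `U ∪ F ∪ B` are those that have not been
visited and left. -/
theorem exchange_alive {F B U : Finset V} {f b : V} {l : List V} (hf : f ∈ F) (hb : b ∈ B)
    (hfl : f ∉ l) (hbl : b ∉ l) :
    U \ (f :: (l ++ [b])).toFinset ∪ insert b (F \ (f :: (l ++ [b])).toFinset) ∪
      insert f (B \ (f :: (l ++ [b])).toFinset) = (U ∪ F ∪ B).filter fun x => x ∉ l := by
  ext x
  simp only [Finset.mem_union, Finset.mem_sdiff, Finset.mem_insert, Finset.mem_filter,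
    List.mem_toFinset, List.mem_cons, List.mem_append, List.not_mem_nil, or_false]
  by_cases hxf : x = f
  · subst hxf; simp [hf, hfl]
  · by_cases hxb : x = b
    · subst hxb; simp [hb, hbl]
    · simp only [hxf, hxb, false_or, or_false]
      tauto

theorem step_alive {F U : Finset V} {u u' : V} (hu' : u' ∈ U ∪ F) (hne : u' ≠ u) (hu : u ∉ U) :
    U.erase u' ∪ insert u' (F.erase u) = (U ∪ F).erase u := by
  ext x
  simp only [Finset.mem_union, Finset.mem_insert, Finset.mem_erase] at *
  by_cases h1 : x = u'
  · subst h1; simp [hu', hne]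
  · by_cases h3 : x = u
    · subst h3; simp [hu, Ne.symm hne]
    · simp [h1, h3]

theorem disjoint_step {F U : Finset V} {u u' : V} (h : Disjoint U F) :
    Disjoint (U.erase u') (insert u' (F.erase u)) := by
  rw [Finset.disjoint_left] at h ⊢
  intro x hx
  have := @h x
  simp only [Finset.mem_insert, Finset.mem_erase] at *
  tauto

theorem erase_forward_alive {F B U : Finset V} {u u' : V} (hu' : u' ∈ U ∪ F ∪ B) :
    (U.erase u' ∪ insert u' (F.erase u) ∪ B).erase u = (U ∪ F ∪ B).erase u := by
  ext x
  simp only [Finset.mem_union, Finset.mem_insert, Finset.mem_erase] at *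
  by_cases h1 : x = u'
  · subst h1; simp [hu']
  · by_cases h3 : x = u
    · subst h3; simp
    · simp [h1, h3]

theorem vacate_backward {F B U : Finset V} {u u' : V} (hu' : u' ∈ U ∪ F ∪ B) (hne : u' ≠ u)
    (hu : u ∉ U) (huF : u ∉ F) :
    U.erase u' ∪ F ∪ insert u' (B.erase u) = (U ∪ F ∪ B).erase u := by
  rw [← step_alive hu' hne (by simp [hu, huF])]
  ext x
  simp only [Finset.mem_union, Finset.mem_insert, Finset.mem_erase]
  by_cases h1 : x = u' <;> simp [h1]

theorem vacate_forward {F B U : Finset V} {u u' : V} (hu' : u' ∈ U ∪ F ∪ B) (hne : u' ≠ u)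
    (hu : u ∉ U) (huB : u ∉ B) :
    U.erase u' ∪ insert u' (F.erase u) ∪ B = (U ∪ F ∪ B).erase u := by
  rw [Finset.union_right_comm] at hu' ⊢
  rw [vacate_backward hu' hne hu huB, Finset.union_right_comm]

theorem vacate_backward_disjoint {F B U : Finset V} {u u' : V} (h : Disjoint U (F ∪ B)) :
    Disjoint (U.erase u') (F ∪ insert u' (B.erase u)) := by
  rw [Finset.disjoint_union_right] at h ⊢
  exact ⟨h.1.mono_left (Finset.erase_subset _ _), disjoint_step h.2⟩

theorem vacate_forward_disjoint {F B U : Finset V} {u u' : V} (h : Disjoint U (F ∪ B)) :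
    Disjoint (U.erase u') (insert u' (F.erase u) ∪ B) := by
  rw [Finset.disjoint_union_right] at h ⊢
  exact ⟨disjoint_step h.1, h.2.mono_left (Finset.erase_subset _ _)⟩

/-- Let `G k F B U` say that tokens can be brought to the vertices `F` (walking forwards) and `B`
(walking backwards) in `k` rounds while the vertices in `U` have not been visited yet. If `G` is
closed under single steps into vertices that have not been left for good, and under exchanges, then
all tokens can be brought to `v`. Vertices that were visited and left are never used again. -/
theorem tokens_meet (N δ : ℕ) (G : ℕ → Finset V → Finset V → Finset V → Prop)
    (hmono : ∀ k l F B U, k ≤ l → G k F B U → G l F B U)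
    (hforward : ∀ k F B U u u', G k F B U → u ∈ F → r u u' → u' ∈ U ∪ F ∪ B →
      G (k + δ) (insert u' (F.erase u)) B (U.erase u'))
    (hbackward : ∀ k F B U u u', G k F B U → u ∈ B → r u' u → u' ∈ U ∪ F ∪ B →
      G (k + δ) F (insert u' (B.erase u)) (U.erase u'))
    (hexchange : ∀ k F B U f b l, G k F B U → f ∈ F → b ∈ B → (f :: (l ++ [b])).Nodup →
      (f :: (l ++ [b])).IsChain r → (∀ x ∈ l, x ∈ U ∪ F ∪ B) →
      G (k + δ) (insert b (F \ (f :: (l ++ [b])).toFinset))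
        (insert f (B \ (f :: (l ++ [b])).toFinset)) (U \ (f :: (l ++ [b])).toFinset)) :
    -- the measure: an exchange along a path without interior keeps `U ∪ F ∪ B`, but moves a forward
    -- token to a vertex that needs less; all other moves give up a vertex
    ∀ m k F B U, (U ∪ F ∪ B).card * (N ^ 2 + 1) + ∑ f ∈ F, needCount r (U ∪ F ∪ B) v f ≤ m →
      (U ∪ F ∪ B).card ≤ N → Disjoint U (F ∪ B) → v ∈ U ∪ F ∪ B → F.Nonempty → B.Nonempty →
      (∀ f ∈ F, ReachIn r ↑(U ∪ F ∪ B) f v) → (∀ b ∈ B, ReachIn r ↑(U ∪ F ∪ B) v b) →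
      G k F B U → ∃ U', G (k + 2 * m * δ) {v} {v} U' := by
  intro m
  induction m with
  | zero =>
    intro k F B U hm _ _ hv _ _ _ _ _
    have := Finset.card_pos.2 ⟨v, hv⟩
    have : 0 < (U ∪ F ∪ B).card * (N ^ 2 + 1) := by positivity
    omega
  | succ m ih =>
    intro k F B U hm hN hdisj hv hFne hBne hF hB hG
    have hk : k + 2 * (m + 1) * δ = k + 2 * δ + 2 * m * δ := by ring
    by_cases hdone : ∃ u, (u ∈ F ∨ u ∈ B) ∧ u ≠ v
    swap
    · push Not at hdone
      have h1 : F = {v} := Finset.eq_singleton_iff_nonempty_unique_mem.2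
        ⟨hFne, fun x hx => hdone x (.inl hx)⟩
      have h2 : B = {v} := Finset.eq_singleton_iff_nonempty_unique_mem.2
        ⟨hBne, fun x hx => hdone x (.inr hx)⟩
      subst h1 h2
      exact ⟨U, hmono k _ _ _ _ (by omega) hG⟩
    have hsmall : ∀ F' B' U' : Finset V, (U' ∪ F' ∪ B').card + 1 ≤ (U ∪ F ∪ B).card →
        (U' ∪ F' ∪ B').card * (N ^ 2 + 1) + ∑ f ∈ F', needCount r (U' ∪ F' ∪ B') v f ≤ m := by
      intro F' B' U' h
      have h1 := sum_needCount_le (r := r) (v := v) (A := U' ∪ F' ∪ B') (F := F') (N := N)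
        (fun x hx => by simp [hx]) (by omega)
      have h2 := Nat.mul_le_mul_right (N ^ 2 + 1) h
      rw [add_mul, one_mul] at h2
      omega
    by_cases hstuck : ∀ u, u ∈ F ∨ u ∈ B → u ≠ v →
      (∃ f ∈ F, Needs r ↑(U ∪ F ∪ B) v u f) ∨
        ∃ b ∈ B, Needs (Function.swap r) ↑(U ∪ F ∪ B) v u b
    · obtain ⟨f, hf, b, hb, l, hnd, hch, hl, hvl, hcount, h1, h2, h3, h4⟩ :=
        exists_exchange hv hF hB hstuck hdone
      have hfl := (List.nodup_cons.1 hnd).1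
      have hbl : b ∉ l := by
        have := (List.nodup_cons.1 hnd).2
        rw [List.nodup_append] at this
        exact fun h => this.2.2 b h b (by simp) rfl
      have hfl' : f ∉ l := fun h => hfl (by simp [h])
      have hA := exchange_alive (U := U) hf hb hfl' hbl
      have hXm : ∀ x, x ∈ (f :: (l ++ [b])).toFinset ↔ x = f ∨ x ∈ l ∨ x = b := by
        intro x
        simp only [List.mem_toFinset, List.mem_cons, List.mem_append, List.not_mem_nil, or_false]
      have hX : ∀ x, x ∈ (f :: (l ++ [b])).toFinset ↔ x ∈ f :: (l ++ [b]) :=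
        fun x => List.mem_toFinset
      have hex := hexchange k F B U f b l hG hf hb hnd hch hl
      generalize (f :: (l ++ [b])).toFinset = X at hA hXm hX hex
      have hAc : (↑(U \ X ∪ insert b (F \ X) ∪ insert f (B \ X)) : Set V) =
          (↑(U ∪ F ∪ B) : Set V) \ {x | x ∈ l} := by
        rw [hA, Finset.coe_filter]; rfl
      have hlex : (U \ X ∪ insert b (F \ X) ∪ insert f (B \ X)).card * (N ^ 2 + 1) +
          ∑ g ∈ insert b (F \ X), needCount r (U \ X ∪ insert b (F \ X) ∪ insert f (B \ X)) v g
            ≤ m := by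
        by_cases hl0 : l = []
        · have hA' : U \ X ∪ insert b (F \ X) ∪ insert f (B \ X) = U ∪ F ∪ B := by
            rw [hA, hl0]; simp
          rw [hA']
          have h5 : ∑ f ∈ insert b (F \ X), needCount r (U ∪ F ∪ B) v f <
              ∑ f ∈ F, needCount r (U ∪ F ∪ B) v f := by
            rw [Finset.sum_insert (by simp [hXm]), ← Finset.add_sum_erase _ _ hf]
            refine add_lt_add_of_lt_of_le hcount (Finset.sum_le_sum_of_subset fun x hx => ?_)
            rw [Finset.mem_sdiff, hXm] at hx
            rw [Finset.mem_erase]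
            exact ⟨fun h => hx.2 (.inl h), hx.1⟩
          omega
        · obtain ⟨c, hc⟩ := List.exists_mem_of_ne_nil l hl0
          refine hsmall _ _ _ (Nat.succ_le_of_lt (Finset.card_lt_card ?_))
          rw [hA, Finset.filter_ssubset]
          exact ⟨c, hl c hc, by simpa using hc⟩
      obtain ⟨U', hU'⟩ := ih (k + δ) _ _ _ hlex
        (by rw [hA]; exact (Finset.card_filter_le _ _).trans hN)
        (by
          rw [Finset.disjoint_left] at hdisj ⊢
          intro x hx
          have := @hdisj x
          simp only [Finset.mem_union, Finset.mem_sdiff, Finset.mem_insert] at hx this ⊢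
          rintro ((rfl | h) | (rfl | h))
          · exact hx.2 ((hXm _).2 (by simp))
          · exact this hx.1 (.inl h.1)
          · exact hx.2 ((hXm _).2 (by simp))
          · exact this hx.1 (.inr h.1))
        (by rw [hA]; simpa [hvl] using hv) ⟨b, by simp⟩ ⟨f, by simp⟩
        (by
          rw [hAc]
          intro g hg
          rcases Finset.mem_insert.1 hg with rfl | hg
          · exact h3
          · rw [Finset.mem_sdiff, hX] at hg
            exact h1 g hg.1 hg.2)
        (by
          rw [hAc]
          intro g hg
          rcases Finset.mem_insert.1 hg with rfl | hg
          · exact h4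
          · rw [Finset.mem_sdiff, hX] at hg
            exact h2 g hg.1 hg.2) hex
      exact ⟨U', hmono _ _ _ _ _ (by rw [hk]; omega) hU'⟩
    · -- some token can leave its vertex, which is then given up
      push Not at hstuck
      obtain ⟨u, hu, huv, hsF, hsB⟩ := hstuck
      have hF' : ∀ f ∈ F, f ≠ u → ReachIn r (↑(U ∪ F ∪ B) \ {u} : Set V) f v :=
        fun f hf hfu => reachIn_of_not_needs (hsF f hf) hfu.symm
      have hB' : ∀ b ∈ B, b ≠ u → ReachIn r (↑(U ∪ F ∪ B) \ {u} : Set V) v b :=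
        fun b hb hbu => reachIn_swap.1 (reachIn_of_not_needs (hsB b hb) hbu.symm)
      have huU : u ∉ U := fun h => Finset.disjoint_left.1 hdisj h (by simpa using hu)
      have finish : ∀ k' F' B' U', k' ≤ k + 2 * δ →
          U' ∪ F' ∪ B' = (U ∪ F ∪ B).erase u → Disjoint U' (F' ∪ B') → F'.Nonempty →
          B'.Nonempty → (∀ f ∈ F', ReachIn r (↑(U ∪ F ∪ B) \ {u} : Set V) f v) →
          (∀ b ∈ B', ReachIn r (↑(U ∪ F ∪ B) \ {u} : Set V) v b) → G k' F' B' U' →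
          ∃ U', G (k + 2 * (m + 1) * δ) {v} {v} U' := by
        intro k' F' B' U' hk' hA hd hFn hBn hFr hBr hG'
        have hAc : (↑(U' ∪ F' ∪ B') : Set V) = ↑(U ∪ F ∪ B) \ {u} := by rw [hA]; simp
        have hcard : ((U ∪ F ∪ B).erase u).card + 1 = (U ∪ F ∪ B).card :=
          Finset.card_erase_add_one (by simp; tauto)
        obtain ⟨U'', h⟩ := ih k' F' B' U' (hsmall _ _ _ (by rw [hA]; omega)) (by rw [hA]; omega)
          hd (by rw [hA]; exact Finset.mem_erase.2 ⟨huv.symm, hv⟩) hFn hBn (by rwa [hAc])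
          (by rwa [hAc]) hG'
        exact ⟨U'', hmono _ _ _ _ _ (by rw [hk]; omega) h⟩
      have stepF : u ∈ F → ∃ u', r u u' ∧ ReachIn r (↑(U ∪ F ∪ B) \ {u} : Set V) u' v :=
        fun h => (hF u h).exists_step huv
      have stepB : u ∈ B → ∃ u', r u' u ∧ ReachIn r (↑(U ∪ F ∪ B) \ {u} : Set V) v u' :=
        fun h => (hB u h).exists_last_step huv.symm
      have mem_of : ∀ x, x ∈ (↑(U ∪ F ∪ B) \ {u} : Set V) → x ∈ U ∪ F ∪ B ∧ x ≠ u := by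
        intro x hx
        exact ⟨by exact_mod_cast hx.1, by simpa using hx.2⟩
      have hdl := Finset.disjoint_left.1 hdisj
      have hreachF : ∀ u', ReachIn r (↑(U ∪ F ∪ B) \ {u} : Set V) u' v →
          ∀ g ∈ insert u' (F.erase u), ReachIn r (↑(U ∪ F ∪ B) \ {u} : Set V) g v := by
        intro u' h g hg
        rcases Finset.mem_insert.1 hg with rfl | hg
        exacts [h, hF' g (Finset.mem_of_mem_erase hg) (Finset.ne_of_mem_erase hg)]
      have hreachB : ∀ u', ReachIn r (↑(U ∪ F ∪ B) \ {u} : Set V) v u' →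
          ∀ g ∈ insert u' (B.erase u), ReachIn r (↑(U ∪ F ∪ B) \ {u} : Set V) v g := by
        intro u' h g hg
        rcases Finset.mem_insert.1 hg with rfl | hg
        exacts [h, hB' g (Finset.mem_of_mem_erase hg) (Finset.ne_of_mem_erase hg)]
      by_cases huF : u ∈ F
      · obtain ⟨f', hf1, hf2⟩ := stepF huF
        obtain ⟨hf3, hf4⟩ := mem_of f' hf2.1
        have hG1 := hforward k F B U u f' hG huF hf1 hf3
        have hd1 := vacate_forward_disjoint (u := u) (u' := f') hdisj
        by_cases huB : u ∈ B
        · obtain ⟨b', hb1, hb2⟩ := stepB huB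
          obtain ⟨hb3, hb4⟩ := mem_of b' hb2.right_mem
          have hb3' : b' ∈ U.erase f' ∪ insert f' (F.erase u) ∪ B := by
            simp only [Finset.mem_union, Finset.mem_insert, Finset.mem_erase] at hb3 ⊢
            by_cases h : b' = f'
            · exact .inl (.inr (.inl h))
            · rcases hb3 with (h1 | h1) | h1
              exacts [.inl (.inl ⟨h, h1⟩), .inl (.inr (.inr ⟨hb4, h1⟩)), .inr h1]
          have hG2 := hbackward _ _ _ _ u b' hG1 huB hb1 hb3'
          refine finish _ _ _ _ (by omega) ?_ (vacate_backward_disjoint hd1) ⟨f', by simp⟩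
            ⟨b', by simp⟩ (hreachF f' hf2) (hreachB b' hb2) hG2
          rw [vacate_backward hb3' hb4 (by simp [huU]) (by simp [hf4.symm]),
            erase_forward_alive hf3]
        · refine finish _ _ _ _ (by omega) (vacate_forward hf3 hf4 huU huB) hd1 ⟨f', by simp⟩ hBne
            (hreachF f' hf2) (fun g hg => hB' g hg fun h => huB (h ▸ hg)) hG1
      · have huB : u ∈ B := hu.resolve_left huF
        obtain ⟨b', hb1, hb2⟩ := stepB huB
        obtain ⟨hb3, hb4⟩ := mem_of b' hb2.right_mem
        have hG1 := hbackward k F B U u b' hG huB hb1 hb3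
        exact finish _ _ _ _ (by omega) (vacate_backward hb3 hb4 huU huF)
          (vacate_backward_disjoint hdisj) hFne ⟨b', by simp⟩
          (fun g hg => hF' g hg fun h => huF (h ▸ hg)) (hreachB b' hb2) hG1

/-- The first part of the token game: tokens walk into a strongly connected set `C`. Here `U` is a
set of vertices that have not been visited yet, and only vertices of `U ∪ F` are used. -/
theorem tokens_gather (C : Finset V) (δ : ℕ) (G : ℕ → Finset V → Finset V → Prop)
    (hv : v ∈ C) (hC : ∀ c ∈ C, ReachIn r C c v)
    (hmono : ∀ k l F U U', k ≤ l → U' ⊆ U → G k F U → G l F U')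
    (hforward : ∀ k F U u u', G k F U → u ∈ F → r u u' → u' ∈ U ∪ F →
      G (k + δ) (insert u' (F.erase u)) (U.erase u')) :
    ∀ m k F U, ((U ∪ F) \ C).card ≤ m → Disjoint U F → C ⊆ U ∪ F →
      (∀ a ∈ U ∪ F, ReachIn r ↑(U ∪ F) a v) → G k F U →
      ∃ F' U', F' ⊆ C ∧ C \ F' ⊆ U' ∧ (F.Nonempty → F'.Nonempty) ∧ G (k + m * δ) F' U' := by
  intro m
  induction m with
  | zero =>
    intro k F U hm _ hCU _ hG
    rw [Nat.le_zero, Finset.card_eq_zero, Finset.sdiff_eq_empty_iff_subset] at hm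
    refine ⟨F, U, fun x hx => hm (by simp [hx]), ?_, id, by simpa using hG⟩
    intro x hx
    rw [Finset.mem_sdiff] at hx
    exact (Finset.mem_union.1 (hCU hx.1)).resolve_right hx.2
  | succ m ih =>
    intro k F U hm hd hCU hA hG
    have hk : k + (m + 1) * δ = k + δ + m * δ := by ring
    by_cases hne : ∃ a ∈ U ∪ F, a ∉ C
    swap
    · push Not at hne
      refine ⟨F, U, fun x hx => hne x (by simp [hx]), ?_, id,
        hmono k _ F U U (by omega) subset_rfl hG⟩
      intro x hx
      rw [Finset.mem_sdiff] at hx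
      exact (Finset.mem_union.1 (hCU hx.1)).resolve_right hx.2
    obtain ⟨u, huA, huC, hu⟩ := exists_removable hCU hC hA hne
    have finish : ∀ k' F' U', k' ≤ k + δ → U' ∪ F' = (U ∪ F).erase u → Disjoint U' F' →
        (F.Nonempty → F'.Nonempty) → G k' F' U' →
        ∃ F' U', F' ⊆ C ∧ C \ F' ⊆ U' ∧ (F.Nonempty → F'.Nonempty) ∧
          G (k + (m + 1) * δ) F' U' := by
      intro k' F' U' hk' hA' hd' hFn hG'
      obtain ⟨F'', U'', h1, h2, h3, h4⟩ := ih k' F' U' (by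
          rw [hA', Finset.erase_sdiff_comm,
            Finset.card_erase_of_mem (by simp [huC]; simpa using huA)]
          omega) hd' (by
          rw [hA']
          exact fun c hc => Finset.mem_erase.2 ⟨fun h => huC (h ▸ hc), hCU hc⟩) (by
          rw [hA', Finset.coe_erase]
          exact fun a ha => hu a (Finset.mem_of_mem_erase ha) (Finset.ne_of_mem_erase ha)) hG'
      exact ⟨F'', U'', h1, h2, fun h => h3 (hFn h),
        hmono _ _ _ _ _ (by rw [hk]; omega) subset_rfl h4⟩
    have hdl := Finset.disjoint_left.1 hd
    by_cases huF : u ∈ F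
    · have huv : u ≠ v := fun h => huC (h ▸ hv)
      obtain ⟨u', h1, h2⟩ := (hA u huA).exists_step huv
      have h3 : u' ∈ U ∪ F := by exact_mod_cast h2.1.1
      have h4 : u' ≠ u := by simpa using h2.1.2
      exact finish _ _ _ le_rfl (step_alive h3 h4 fun h => hdl h huF) (disjoint_step hd)
        (fun _ => ⟨u', by simp⟩) (hforward k F U u u' hG huF h1 h3)
    · refine finish (k + δ) F (U.erase u) le_rfl ?_ (hd.mono_left (Finset.erase_subset _ _)) id
        (hmono _ _ _ _ _ (by omega) (Finset.erase_subset _ _) hG)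
      ext x
      simp only [Finset.mem_union, Finset.mem_erase]
      by_cases h3 : x = u
      · subst h3; tauto
      · tauto

end Tokens

/-! ### Out-trees that hang off the strongly connected core -/

section Bundles

variable {V : Type*} [DecidableEq V] {r : V → V → Prop} {v : V}

/-- Let `tree k u M c` say that in `k` rounds one can find an out-tree from `u` that covers the
mask `M` and has cost `c`, not counting `u`. A set `Z` of vertices reachable from `D` can be
dissolved vertex by vertex, farthest vertices first, such that each vertex hands what it covers to
its predecessor. -/
theorem exists_bundles (tree : ℕ → V → ℕ → ℕ → Prop) (w : V → ℕ)
    (hmono : ∀ k l u M c c', k ≤ l → c ≤ c' → tree k u M c → tree l u M c')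
    (hmove : ∀ k u p M c, tree k u M c → r p u → tree (k + 1) p M (c + w u))
    (hmerge : ∀ k u M c M' c', tree k u M c → tree k u M' c' → tree (k + 1) u (M ||| M') (c + c'))
    {D : Finset V} (hv : v ∈ D) (hD : ∀ d ∈ D, ReachIn r D v d) :
    ∀ j k (Z : Finset V) (m bc : V → ℕ), Z.card = j → Disjoint D Z →
      (∀ a ∈ D ∪ Z, ReachIn r ↑(D ∪ Z) v a) →
      (∀ u ∈ D ∪ Z, m u = 0 ∨ tree k u (m u) (bc u)) →
      ∃ m' bc' : V → ℕ, (∀ d ∈ D, m' d = 0 ∨ tree (k + 2 * j) d (m' d) (bc' d)) ∧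
        (∀ i, ∀ u ∈ D ∪ Z, (m u).testBit i → ∃ d ∈ D, (m' d).testBit i) ∧
        ∑ d ∈ D, bc' d ≤ ∑ u ∈ D ∪ Z, bc u + ∑ u ∈ Z, w u := by
  intro j
  induction j with
  | zero =>
    intro k Z m bc hZ _ _ hm
    rw [Finset.card_eq_zero] at hZ
    subst hZ
    rw [Finset.union_empty] at *
    exact ⟨m, bc, by simpa using hm, fun i u hu h => ⟨u, hu, h⟩, by simp⟩
  | succ j ih =>
    intro k Z m bc hZ hdisj hA hm
    have hdl := Finset.disjoint_left.1 hdisj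
    obtain ⟨u, huA, huD, hu⟩ := exists_removable (r := Function.swap r) (A := D ∪ Z) (C := D)
      (v := v) Finset.subset_union_left (fun c hc => (hD c hc).swap) (fun a ha => (hA a ha).swap)
      (by
        obtain ⟨z, hz⟩ := Finset.card_pos.1 (show 0 < Z.card by omega)
        exact ⟨z, by simp [hz], fun h => hdl h hz⟩)
    have huZ : u ∈ Z := (Finset.mem_union.1 huA).resolve_left huD
    have hvu : v ≠ u := fun h => huD (h ▸ hv)
    obtain ⟨p, hpu, hp⟩ := (hA u huA).exists_last_step hvu
    have hp' := hp.right_mem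
    have hpA : p ∈ (D ∪ Z).erase u := by
      rw [Finset.mem_erase]
      exact ⟨by simpa using hp'.2, by exact_mod_cast hp'.1⟩
    have hAe : D ∪ Z.erase u = (D ∪ Z).erase u := by
      rw [Finset.erase_union_distrib, Finset.erase_eq_of_notMem huD]
    have hsumA : ∑ x ∈ (D ∪ Z).erase u, bc x + bc u = ∑ x ∈ D ∪ Z, bc x :=
      Finset.sum_erase_add _ _ huA
    have hsumZ : ∑ x ∈ Z.erase u, w x + w u = ∑ x ∈ Z, w x := Finset.sum_erase_add _ _ huZ
    let m₁ : V → ℕ := fun x => if x = p then m p ||| m u else m x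
    let bc₁ : V → ℕ := fun x => if x = p then bc p + (bc u + w u) else bc x
    have hsum₁ : ∑ x ∈ (D ∪ Z).erase u, bc₁ x =
        ∑ x ∈ (D ∪ Z).erase u, bc x + (bc u + w u) := by
      rw [← Finset.sum_erase_add _ _ hpA, ← Finset.sum_erase_add _ (fun x => bc x) hpA]
      have : ∑ x ∈ ((D ∪ Z).erase u).erase p, bc₁ x = ∑ x ∈ ((D ∪ Z).erase u).erase p, bc x :=
        Finset.sum_congr rfl fun x hx => if_neg (Finset.ne_of_mem_erase hx)
      have h2 : bc₁ p = bc p + (bc u + w u) := if_pos rfl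
      rw [this, h2]
      ring
    by_cases hmu : m u = 0
    · obtain ⟨m', bc', h1, h2, h3⟩ := ih k (Z.erase u) m bc
        (by rw [Finset.card_erase_of_mem huZ]; omega)
        (hdisj.mono_right (Finset.erase_subset _ _))
        (by
          rw [hAe, Finset.coe_erase]
          exact fun a ha => reachIn_swap.1
            (hu a (Finset.mem_of_mem_erase ha) (Finset.ne_of_mem_erase ha)))
        (by
          rw [hAe]
          exact fun x hx => hm x (Finset.mem_of_mem_erase hx))
      rw [hAe] at h2 h3
      refine ⟨m', bc', fun d hd => (h1 d hd).imp id (hmono _ _ _ _ _ _ (by omega) le_rfl), ?_,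
        by omega⟩
      intro i x hx hxi
      refine h2 i x (Finset.mem_erase.2 ⟨?_, hx⟩) hxi
      rintro rfl
      simp [hmu] at hxi
    · obtain ⟨m', bc', h1, h2, h3⟩ := ih (k + 2) (Z.erase u) m₁ bc₁
        (by rw [Finset.card_erase_of_mem huZ]; omega)
        (hdisj.mono_right (Finset.erase_subset _ _))
        (by
          rw [hAe, Finset.coe_erase]
          exact fun a ha => reachIn_swap.1
            (hu a (Finset.mem_of_mem_erase ha) (Finset.ne_of_mem_erase ha)))
        (by
          rw [hAe]
          intro x hx
          by_cases hxp : x = p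
          · subst hxp
            have h4 := hmove k u x _ _ ((hm u huA).resolve_left hmu) hpu
            simp only [m₁, bc₁, if_true]
            right
            rcases hm x (Finset.mem_of_mem_erase hx) with h5 | h5
            · rw [h5, Nat.zero_or]
              exact hmono _ _ _ _ _ _ (by omega) (by omega) h4
            · exact hmerge _ _ _ _ _ _ (hmono _ _ _ _ _ _ (by omega) le_rfl h5) h4
          · simp only [m₁, bc₁, if_neg hxp]
            exact (hm x (Finset.mem_of_mem_erase hx)).imp id (hmono _ _ _ _ _ _ (by omega) le_rfl))
      rw [hAe] at h2 h3
      refine ⟨m', bc', fun d hd => (h1 d hd).imp id (hmono _ _ _ _ _ _ (by omega) le_rfl), ?_,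
        by omega⟩
      intro i x hx hxi
      by_cases hxu : x = u
      · subst hxu
        exact h2 i p hpA (by simp [m₁, Nat.testBit_or, hxi])
      · refine h2 i x (Finset.mem_erase.2 ⟨hxu, hx⟩) ?_
        by_cases hxp : x = p
        · subst hxp; simp [m₁, Nat.testBit_or, hxi]
        · simpa [m₁, hxp] using hxi

end Bundles

/-! ### The token game -/

/-- Replace the value `z` of a function by `p`. -/
def move {ι V : Type*} [DecidableEq V] (z p : V) (f : ι → V) : ι → V :=
  fun i => if f i = z then p else f i

theorem move_of_eq {ι V : Type*} [DecidableEq V] {z p : V} {f : ι → V} {i : ι} (h : f i = z) :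
    move z p f i = p := if_pos h

theorem move_of_ne {ι V : Type*} [DecidableEq V] {z p : V} {f : ι → V} {i : ι} (h : f i ≠ z) :
    move z p f i = f i := if_neg h

theorem image_move {ι V : Type*} [Fintype ι] [DecidableEq V] {z p : V} {f : ι → V}
    (h : z ∈ Finset.univ.image f) :
    Finset.univ.image (move z p f) = insert p ((Finset.univ.image f).erase z) := by
  ext x
  simp only [Finset.mem_image, Finset.mem_univ, true_and, Finset.mem_insert, Finset.mem_erase,
    move] at *
  constructor
  · rintro ⟨i, hi⟩
    split_ifs at hi with h1
    · exact .inl hi.symm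
    · exact .inr ⟨hi ▸ h1, i, hi⟩
  · rintro (rfl | ⟨hx, i, hi⟩)
    · obtain ⟨i, hi⟩ := h
      exact ⟨i, if_pos hi⟩
    · exact ⟨i, by rw [if_neg (hi ▸ hx), hi]⟩

section Game

variable {V : Type*} [DecidableEq V] {q : ℕ}

/-- The vertex `p` carries a token. -/
def Occ (f b : Fin q → V) (p : V) : Prop := ∃ i, f i = p ∨ b i = p

open Classical in
/-- The price for putting a token on `p`. -/
noncomputable def enterCost (w : V → ℕ) (f b : Fin q → V) (p : V) : ℕ :=
  if Occ f b p then 0 else w p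

/-- The moves of the token game in the graph `r` with vertex weights `w`. Here
`play k f b M o z c` says that the following position can be reached within `k` rounds at cost `c`:
the forward tokens are on `f`, the backward tokens on `b`, the terminals in the mask `M` are
covered, and the carrier, which is on `z` now, was on `o` before. As long as `M = 0`, every backward
token stays with its forward token. Moreover `tree k u M c` says that an out-tree from `u` that
covers `M` and has cost `c` is found in `k` rounds; the cost of `u` is not included. -/
structure Rules (r : V → V → Prop) (w : V → ℕ)
    (play : ℕ → (Fin q → V) → (Fin q → V) → ℕ → V → V → ℕ → Prop)
    (tree : ℕ → V → ℕ → ℕ → Prop) : Prop where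
  play_mono : ∀ {k l f b M o z c c'}, k ≤ l → c ≤ c' → play k f b M o z c → play l f b M o z c'
  reset : ∀ {k f b M o z c p}, play k f b M o z c → Occ f b p → play (k + 1) f b M p p c
  gather : ∀ {k f b o z c p}, play k f b 0 o z c → r z p →
    play (k + 1) (move z p f) (move z p b) 0 p p (c + enterCost w f b p)
  forward : ∀ {k f b M o z c p}, play k f b M o z c → M ≠ 0 → r z p →
    play (k + 1) (move z p f) b M o p (c + enterCost w f b p)
  backward : ∀ {k f b M o z c p}, play k f b M o z c → M ≠ 0 → r p z →
    play (k + 1) f (move z p b) M o z (c + enterCost w f b p)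
  pull : ∀ {k f b M o z c}, play k f b M o z c → play (k + 1) f (move z o b) M o z c
  collect : ∀ {k f b M o z c M' c'}, play k f b M o z c → tree k z M' c' →
    play (k + 1) f b (M ||| M') o z (c + c')
  tree_mono : ∀ {k l u M c c'}, k ≤ l → c ≤ c' → tree k u M c → tree l u M c'
  tree_move : ∀ {k u p M c}, tree k u M c → r p u → tree (k + 1) p M (c + w u)
  tree_merge : ∀ {k u M c M' c'}, tree k u M c → tree k u M' c' →
    tree (k + 1) u (M ||| M') (c + c')
  tree_start : ∀ k u, tree k u 1 0

variable {r : V → V → Prop} {w : V → ℕ}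
  {play : ℕ → (Fin q → V) → (Fin q → V) → ℕ → V → V → ℕ → Prop} {tree : ℕ → V → ℕ → ℕ → Prop}

theorem occ_iff {f b : Fin q → V} {p : V} :
    Occ f b p ↔ p ∈ Finset.univ.image f ∨ p ∈ Finset.univ.image b := by
  simp only [Occ, Finset.mem_image, Finset.mem_univ, true_and, exists_or]

/-- The invariant of the second part of the game, which is played on the core `D`. The vertices in
`U` are the unvisited ones. All visited vertices are connected with the tokens through visited
vertices, what hangs off them (bundles with masks `m` and costs `bc`) has been collected, and the
cost does not exceed `t` even if all of `U` has still to be paid. -/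
structure Legal (r : V → V → Prop) (w : V → ℕ)
    (play : ℕ → (Fin q → V) → (Fin q → V) → ℕ → V → V → ℕ → Prop) (D X : Finset V)
    (m bc : V → ℕ) (t : ℕ) (k : ℕ) (f b : Fin q → V) (o z : V) (U : Finset V) : Prop where
  sub : U ⊆ D
  disj : Disjoint X U
  fwd_mem : ∀ i, f i ∈ D \ U
  bwd_mem : ∀ i, b i ∈ D \ U
  carrier : ReachIn r ↑(D \ U) o z
  fwd : ∀ x ∈ D \ U, ∃ i, ReachIn r ↑(D \ U) x (f i)
  bwd : ∀ x ∈ D \ U, ∃ i, ReachIn r ↑(D \ U) (b i) x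
  playable : ∃ M c, play k f b M o z c ∧ M.testBit 0 ∧
    (∀ x ∈ D \ U, ∀ i, (m x).testBit i → M.testBit i) ∧ c + ∑ u ∈ U, (w u + bc u) ≤ t

variable {D X : Finset V} {m bc : V → ℕ} {t k : ℕ} {f b : Fin q → V} {o z p : V} {U : Finset V}

theorem ne_zero_of_testBit {M i : ℕ} (h : M.testBit i) : M ≠ 0 := by
  rintro rfl
  simp at h

theorem Legal.occ_mem (h : Legal r w play D X m bc t k f b o z U) (hp : Occ f b p) :
    p ∈ D \ U := by
  obtain ⟨i, rfl | rfl⟩ := hp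
  exacts [h.fwd_mem i, h.bwd_mem i]

theorem Legal.mono (hR : Rules r w play tree) (h : Legal r w play D X m bc t k f b o z U) {l : ℕ}
    (hkl : k ≤ l) : Legal r w play D X m bc t l f b o z U := by
  obtain ⟨M, c, h1, h2⟩ := h.playable
  exact { h with playable := ⟨M, c, hR.play_mono hkl le_rfl h1, h2⟩ }

theorem Legal.reset (hR : Rules r w play tree) (h : Legal r w play D X m bc t k f b o z U)
    (hp : Occ f b p) : Legal r w play D X m bc t (k + 1) f b p p U := by
  obtain ⟨M, c, h1, h2⟩ := h.playable
  exact { h with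
    playable := ⟨M, c, hR.reset h1 hp, h2⟩
    carrier := .refl (by exact_mod_cast h.occ_mem hp) }

theorem Legal.pull (hR : Rules r w play tree) (h : Legal r w play D X m bc t k f b o z U) :
    Legal r w play D X m bc t (k + 1) f (move z o b) o z U := by
  obtain ⟨M, c, h1, h2⟩ := h.playable
  refine { h with playable := ⟨M, c, hR.pull h1, h2⟩, bwd_mem := fun i => ?_, bwd := ?_ }
  · by_cases hi : b i = z
    · rw [move_of_eq hi]; exact_mod_cast h.carrier.1
    · rw [move_of_ne hi]; exact h.bwd_mem i
  · intro x hx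
    obtain ⟨i, hi⟩ := h.bwd x hx
    refine ⟨i, ?_⟩
    by_cases hiz : b i = z
    · rw [move_of_eq hiz]; exact h.carrier.trans (hiz ▸ hi)
    · rwa [move_of_ne hiz]

/-- Entering a vertex includes collecting what hangs off it. -/
theorem enter_playable (hR : Rules r w play tree) {k₀ M c : ℕ} {f' b' : Fin q → V} {o' : V}
    (hm : ∀ k, k₀ ≤ k → ∀ d ∈ D, m d = 0 ∨ tree k d (m d) (bc d)) (hk : k₀ ≤ k)
    (hpD : p ∈ D) (hp : p ∈ U ∨ Occ f b p) (hocc : ∀ p, Occ f b p → p ∈ D \ U)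
    (h1 : play k f' b' M o' p (c + enterCost w f b p)) (h2 : M.testBit 0)
    (h3 : ∀ x ∈ D \ U, ∀ i, (m x).testBit i → M.testBit i) (h4 : c + ∑ u ∈ U, (w u + bc u) ≤ t) :
    ∃ M c, play (k + 1) f' b' M o' p c ∧ M.testBit 0 ∧
      (∀ x ∈ D \ U.erase p, ∀ i, (m x).testBit i → M.testBit i) ∧
      c + ∑ u ∈ U.erase p, (w u + bc u) ≤ t := by
  by_cases ho : Occ f b p
  · have hpU := (Finset.mem_sdiff.1 (hocc p ho)).2
    rw [enterCost, if_pos ho] at h1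
    rw [Finset.erase_eq_of_notMem hpU]
    exact ⟨M, c, hR.play_mono (by omega) (by omega) h1, h2, h3, h4⟩
  · have hpU := hp.resolve_right ho
    rw [enterCost, if_neg ho] at h1
    have hs := Finset.sum_erase_add U (fun u => w u + bc u) hpU
    have hcov : ∀ M' : ℕ, (∀ i, M.testBit i → M'.testBit i) →
      (∀ i, (m p).testBit i → M'.testBit i) →
        ∀ x ∈ D \ U.erase p, ∀ i, (m x).testBit i → M'.testBit i := by
      intro M' hM hmp x hx i hi
      by_cases hxp : x = p
      · exact hmp i (hxp ▸ hi)
      · refine hM i (h3 x ?_ i hi)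
        simp only [Finset.mem_sdiff, Finset.mem_erase] at hx ⊢
        tauto
    rcases hm k hk p hpD with h0 | htree
    · exact ⟨M, _, hR.play_mono (by omega) le_rfl h1, h2, hcov M (fun _ => id) (by simp [h0]),
        by omega⟩
    · exact ⟨M ||| m p, _, hR.collect h1 htree, by rw [Nat.testBit_or, h2, Bool.true_or],
        hcov _ (fun i hi => by simp [Nat.testBit_or, hi]) (fun i hi => by
          simp [Nat.testBit_or, hi]), by omega⟩

theorem Legal.forward (hR : Rules r w play tree) (h : Legal r w play D X m bc t k f b o z U)
    {k₀ : ℕ} (hm : ∀ k, k₀ ≤ k → ∀ d ∈ D, m d = 0 ∨ tree k d (m d) (bc d)) (hk : k₀ ≤ k)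
    (hpD : p ∈ D) (hp : p ∈ U ∨ Occ f b p) (hr : r z p) (hz : ∃ i, f i = z) :
    Legal r w play D X m bc t (k + 2) (move z p f) b o p (U.erase p) := by
  obtain ⟨M, c, h1, h2, h3, h4⟩ := h.playable
  have hsub : D \ U ⊆ D \ U.erase p :=
    Finset.sdiff_subset_sdiff subset_rfl (Finset.erase_subset _ _)
  have hsub' : (↑(D \ U) : Set V) ⊆ ↑(D \ U.erase p) := Finset.coe_subset.2 hsub
  have hp' : p ∈ D \ U.erase p := by simp [hpD]
  have hzm : z ∈ D \ U := by exact_mod_cast h.carrier.right_mem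
  have hzp : ReachIn r ↑(D \ U.erase p) z p :=
    .single (hsub' (by exact_mod_cast hzm)) (by exact_mod_cast hp') hr
  have hx : ∀ x ∈ D \ U.erase p, x = p ∨ x ∈ D \ U := by
    intro x hx
    simp only [Finset.mem_sdiff, Finset.mem_erase] at hx ⊢
    tauto
  refine ⟨(Finset.erase_subset _ _).trans h.sub, h.disj.mono_right (Finset.erase_subset _ _),
    fun i => ?_, fun i => hsub (h.bwd_mem i), (h.carrier.mono hsub').trans hzp, ?_, ?_, ?_⟩
  · by_cases hi : f i = z
    · rwa [move_of_eq hi]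
    · rw [move_of_ne hi]; exact hsub (h.fwd_mem i)
  · intro x hxD
    rcases hx x hxD with rfl | hxD
    · obtain ⟨i, hi⟩ := hz
      exact ⟨i, by rw [move_of_eq hi]; exact .refl (by exact_mod_cast hp')⟩
    · obtain ⟨i, hi⟩ := h.fwd x hxD
      refine ⟨i, ?_⟩
      by_cases hiz : f i = z
      · rw [move_of_eq hiz]; exact ((hiz ▸ hi).mono hsub').trans hzp
      · rw [move_of_ne hiz]; exact hi.mono hsub'
  · intro x hxD
    rcases hx x hxD with rfl | hxD
    · obtain ⟨i, hi⟩ := h.bwd z hzm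
      exact ⟨i, (hi.mono hsub').trans hzp⟩
    · obtain ⟨i, hi⟩ := h.bwd x hxD
      exact ⟨i, hi.mono hsub'⟩
  · exact enter_playable hR hm (by omega) hpD hp (fun p hp => h.occ_mem hp)
      (hR.forward h1 (ne_zero_of_testBit h2) hr) h2 h3 h4

theorem Legal.backward (hR : Rules r w play tree) (h : Legal r w play D X m bc t k f b o z U)
    {k₀ : ℕ} (hm : ∀ k, k₀ ≤ k → ∀ d ∈ D, m d = 0 ∨ tree k d (m d) (bc d)) (hk : k₀ ≤ k)
    (hpD : p ∈ D) (hp : p ∈ U ∨ Occ f b p) (hr : r p z) (hz : ∃ i, b i = z) :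
    Legal r w play D X m bc t (k + 3) f (move z p b) p p (U.erase p) := by
  obtain ⟨M, c, h1, h2, h3, h4⟩ := h.playable
  have hsub : D \ U ⊆ D \ U.erase p :=
    Finset.sdiff_subset_sdiff subset_rfl (Finset.erase_subset _ _)
  have hsub' : (↑(D \ U) : Set V) ⊆ ↑(D \ U.erase p) := Finset.coe_subset.2 hsub
  have hp' : p ∈ D \ U.erase p := by simp [hpD]
  have hzm : z ∈ D \ U := by exact_mod_cast h.carrier.right_mem
  have hzp : ReachIn r ↑(D \ U.erase p) p z :=
    .single (by exact_mod_cast hp') (hsub' (by exact_mod_cast hzm)) hr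
  have hx : ∀ x ∈ D \ U.erase p, x = p ∨ x ∈ D \ U := by
    intro x hx
    simp only [Finset.mem_sdiff, Finset.mem_erase] at hx ⊢
    tauto
  refine ⟨(Finset.erase_subset _ _).trans h.sub, h.disj.mono_right (Finset.erase_subset _ _),
    fun i => hsub (h.fwd_mem i), fun i => ?_, .refl (by exact_mod_cast hp'), ?_, ?_, ?_⟩
  · by_cases hi : b i = z
    · rwa [move_of_eq hi]
    · rw [move_of_ne hi]; exact hsub (h.bwd_mem i)
  · intro x hxD
    rcases hx x hxD with rfl | hxD
    · obtain ⟨i, hi⟩ := h.fwd z hzm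
      exact ⟨i, hzp.trans (hi.mono hsub')⟩
    · obtain ⟨i, hi⟩ := h.fwd x hxD
      exact ⟨i, hi.mono hsub'⟩
  · intro x hxD
    rcases hx x hxD with rfl | hxD
    · obtain ⟨i, hi⟩ := hz
      exact ⟨i, by rw [move_of_eq hi]; exact .refl (by exact_mod_cast hp')⟩
    · obtain ⟨i, hi⟩ := h.bwd x hxD
      refine ⟨i, ?_⟩
      by_cases hiz : b i = z
      · rw [move_of_eq hiz]; exact hzp.trans ((hiz ▸ hi).mono hsub')
      · rw [move_of_ne hiz]; exact hi.mono hsub'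
  · obtain ⟨i, hi⟩ := hz
    have h5 := hR.reset (p := p) (hR.backward h1 (ne_zero_of_testBit h2) hr)
      ⟨i, .inr (move_of_eq hi)⟩
    exact enter_playable hR hm (by omega) hpD hp (fun p hp => h.occ_mem hp) h5 h2 h3 h4

/-- The carrier walks along a simple path: the forward tokens on the path move to its end, and the
backward tokens on the path move back to `o`. -/
theorem Legal.walk (hR : Rules r w play tree) {k₀ : ℕ}
    (hm : ∀ k, k₀ ≤ k → ∀ d ∈ D, m d = 0 ∨ tree k d (m d) (bc d)) {y : V} (l : List V) :
    ∀ {k z f b U}, k₀ ≤ k → (z :: l).getLast (by simp) = y →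
      Legal r w play D X m bc t k f b o z U → (∃ i, f i = z) →
      (z :: l).IsChain r → (z :: l).Nodup → o ∉ l → (∀ x ∈ l, x ∈ D ∧ (x ∈ U ∨ Occ f b x)) →
      Legal r w play D X m bc t (k + 3 * l.length)
        (fun i => if f i ∈ z :: l then y else f i) (fun i => if b i ∈ l then o else b i) o y
        (U \ l.toFinset) := by
  induction l with
  | nil =>
    intro k z f b U hk hy h _ _ _ _ _
    obtain rfl : z = y := by simpa using hy
    have h1 : (fun i => if f i ∈ [z] then z else f i) = f := by
      funext i
      simp only [List.mem_singleton]
      split_ifs with h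
      exacts [h.symm, rfl]
    rw [h1]
    simpa using h
  | cons p l ih =>
    intro k z f b U hk hy h hz hch hnd ho hl
    rw [List.getLast_cons (by simp)] at hy
    rw [List.isChain_cons_cons] at hch
    rw [List.mem_cons, not_or] at ho
    have hnd' := List.nodup_cons.1 hnd
    have hnd2 := List.nodup_cons.1 hnd'.2
    have hpz : p ≠ z := fun h => hnd'.1 (by simp [h])
    have h1 := (h.forward hR hm hk (hl p (by simp)).1 (hl p (by simp)).2 hch.1 hz).pull hR
    have h2 := ih (k := k + 2 + 1) (by omega) hy h1
      (by obtain ⟨i, hi⟩ := hz; exact ⟨i, move_of_eq hi⟩) hch.2 hnd'.2 ho.2 (by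
        intro x hx
        have hxp : x ≠ p := fun h => hnd2.1 (h ▸ hx)
        have hxz : x ≠ z := fun h => hnd'.1 (by simp [← h, hx])
        obtain ⟨h3, h4⟩ := hl x (by simp [hx])
        refine ⟨h3, h4.imp (fun h => Finset.mem_erase.2 ⟨hxp, h⟩) ?_⟩
        rintro ⟨i, rfl | rfl⟩
        · exact ⟨i, .inl (move_of_ne hxz)⟩
        · exact ⟨i, .inr (move_of_ne hxp)⟩)
    have e1 : (fun i => if move z p f i ∈ p :: l then y else move z p f i) =
        fun i => if f i ∈ z :: p :: l then y else f i := by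
      funext i
      by_cases hi : f i = z
      · rw [move_of_eq hi, if_pos (by simp), if_pos (by simp [hi])]
      · rw [move_of_ne hi]
        simp [hi]
    have e2 : (fun i => if move p o b i ∈ l then o else move p o b i) =
        fun i => if b i ∈ p :: l then o else b i := by
      funext i
      by_cases hi : b i = p
      · rw [move_of_eq hi, if_neg ho.2, if_pos (by simp [hi])]
      · rw [move_of_ne hi]
        simp [hi]
    have e3 : U.erase p \ l.toFinset = U \ (p :: l).toFinset := by
      ext x
      simp only [Finset.mem_sdiff, Finset.mem_erase, List.mem_toFinset, List.mem_cons]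
      tauto
    have e4 : k + 2 + 1 + 3 * l.length = k + 3 * (p :: l).length := by
      rw [List.length_cons]; ring
    rw [e1, e2, e3, e4] at h2
    exact h2

end Game

/-! ### Plays that follow a solution -/

section Game

variable {V : Type*} [DecidableEq V] {q : ℕ} {r : V → V → Prop} {w : V → ℕ}
  {play : ℕ → (Fin q → V) → (Fin q → V) → ℕ → V → V → ℕ → Prop} {tree : ℕ → V → ℕ → ℕ → Prop}

theorem image_ite_mem {ι : Type*} [Fintype ι] {f : ι → V} {L : List V} {y : V}
    (h : ∃ i, f i ∈ L) :
    Finset.univ.image (fun i => if f i ∈ L then y else f i) =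
      insert y (Finset.univ.image f \ L.toFinset) := by
  ext x
  simp only [Finset.mem_image, Finset.mem_univ, true_and, Finset.mem_insert, Finset.mem_sdiff,
    List.mem_toFinset]
  constructor
  · rintro ⟨i, hi⟩
    split_ifs at hi with h1
    · exact .inl hi.symm
    · exact .inr ⟨⟨i, hi⟩, hi ▸ h1⟩
  · rintro (rfl | ⟨⟨i, hi⟩, hx⟩)
    · obtain ⟨i, hi⟩ := h
      exact ⟨i, if_pos hi⟩
    · exact ⟨i, by rw [if_neg (hi ▸ hx), hi]⟩

/-- Before the tokens separate, what hangs off their vertices is collected, and the mask is made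
nonempty. -/
theorem collect_start (hR : Rules r w play tree) {m bc : V → ℕ} {k c : ℕ} {f : Fin q → V} {o z : V}
    (hm : ∀ l, k ≤ l → ∀ i, m (f i) = 0 ∨ tree l (f i) (m (f i)) (bc (f i)))
    (h0 : play k f f 0 o z c) (s : Finset V) : s ⊆ Finset.univ.image f →
    ∃ M o z c', play (k + 1 + 2 * s.card) f f M o z c' ∧ M.testBit 0 ∧
      (∀ x ∈ s, ∀ i, (m x).testBit i → M.testBit i) ∧ c' ≤ c + ∑ x ∈ s, bc x := by
  induction s using Finset.induction_on with
  | empty =>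
    intro _
    have := hR.collect h0 (hR.tree_start k z)
    exact ⟨_, _, _, _, this, by simp, by simp, by simp⟩
  | insert a s ha ih =>
    intro hs
    rw [Finset.insert_subset_iff] at hs
    obtain ⟨M, o, z, c', h1, h2, h3, h4⟩ := ih hs.2
    obtain ⟨j, -, rfl⟩ := Finset.mem_image.1 hs.1
    rw [Finset.card_insert_of_notMem ha, Finset.sum_insert ha]
    have h5 := hR.reset (p := f j) h1 ⟨j, .inl rfl⟩
    rcases hm (k + 1 + 2 * s.card + 1) (by omega) j with h6 | h6
    · refine ⟨M, _, _, c', hR.play_mono (by omega) le_rfl h5, h2, ?_, by omega⟩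
      intro x hx i hi
      rcases Finset.mem_insert.1 hx with rfl | hx
      · simp [h6] at hi
      · exact h3 x hx i hi
    · refine ⟨_, _, _, _, hR.play_mono (by omega) le_rfl (hR.collect h5 h6),
        by rw [Nat.testBit_or, h2, Bool.true_or], ?_, by omega⟩
      intro x hx i hi
      rw [Nat.testBit_or, Bool.or_eq_true]
      rcases Finset.mem_insert.1 hx with rfl | hx
      · exact .inr hi
      · exact .inl (h3 x hx i hi)

/-- The second part of the game. All tokens start on a minimal strongly connected set `D` that
contains their starting points. When they have met, every vertex of `D` has been visited: the
visited vertices are strongly connected too. -/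
theorem play_core (hR : Rules r w play tree) {D : Finset V} {m bc : V → ℕ} {v : V} {N k t c : ℕ}
    {f : Fin q → V} {o z : V} (hN : D.card ≤ N) (hfD : ∀ i, f i ∈ D) (hvf : ∃ i, f i = v)
    (hDto : ∀ d ∈ D, ReachIn r D d v) (hDfrom : ∀ d ∈ D, ReachIn r D v d)
    (hmin : ∀ Y ⊆ D, (∀ i, f i ∈ Y) → (∀ y ∈ Y, ReachIn r Y v y ∧ ReachIn r Y y v) → Y = D)
    (hm : ∀ l, k ≤ l → ∀ d ∈ D, m d = 0 ∨ tree l d (m d) (bc d))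
    (h0 : play k f f 0 o z c)
    (ht : c + ∑ x ∈ D \ Finset.univ.image f, w x + ∑ x ∈ D, bc x ≤ t) :
    ∃ M c', play (k + 1 + 2 * N + 1 + 2 * (N * (N ^ 2 + 1) + N ^ 2) * (3 * N + 4) + 1)
        (fun _ => v) (fun _ => v) M v v c' ∧ M.testBit 0 ∧
      (∀ d ∈ D, ∀ i, (m d).testBit i → M.testBit i) ∧ c' ≤ t := by
  set X := Finset.univ.image f with hX
  have hXD : X ⊆ D := by
    intro x hx
    obtain ⟨i, -, rfl⟩ := Finset.mem_image.1 hx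
    exact hfD i
  have hXm : ∀ i, f i ∈ X := fun i => Finset.mem_image_of_mem f (Finset.mem_univ i)
  have hvX : v ∈ X := by obtain ⟨i, rfl⟩ := hvf; exact hXm i
  obtain ⟨M, o, z, c', h1, h2, h3, h4⟩ :=
    collect_start hR (fun l hl i => hm l hl _ (hfD i)) h0 X subset_rfl
  have h1' := hR.reset (p := v) h1 (by obtain ⟨i, hi⟩ := hvf; exact ⟨i, .inl hi⟩)
  have hDX : D \ (D \ X) = X := Finset.sdiff_sdiff_eq_self hXD
  have hsum := Finset.sum_sdiff (f := bc) hXD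
  -- the starting position
  have hstart : Legal r w play D X m bc t (k + 1 + 2 * N + 1) f f v v (D \ X) := by
    have hXN := (Finset.card_le_card hXD).trans hN
    refine ⟨Finset.sdiff_subset, Finset.disjoint_sdiff, ?_, ?_, ?_, ?_, ?_, ?_⟩
    · rw [hDX]; exact hXm
    · rw [hDX]; exact hXm
    · rw [hDX]; exact .refl (by exact_mod_cast hvX)
    · rw [hDX]
      intro x hx
      obtain ⟨i, -, rfl⟩ := Finset.mem_image.1 hx
      exact ⟨i, .refl (by exact_mod_cast hx)⟩
    · rw [hDX]
      intro x hx
      obtain ⟨i, -, rfl⟩ := Finset.mem_image.1 hx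
      exact ⟨i, .refl (by exact_mod_cast hx)⟩
    · refine ⟨M, c', hR.play_mono (by omega) le_rfl h1', h2, by rwa [hDX], ?_⟩
      rw [Finset.sum_add_distrib]
      omega
  let G : ℕ → Finset V → Finset V → Finset V → Prop := fun l F B U => k ≤ l ∧ ∃ f b o z,
    Finset.univ.image f = F ∧ Finset.univ.image b = B ∧ Legal r w play D X m bc t l f b o z U
  have hmemD : ∀ {l : ℕ} {f b : Fin q → V} {o z : V} {U : Finset V},
      Legal r w play D X m bc t l f b o z U →
      ∀ {x}, x ∈ U ∪ Finset.univ.image f ∪ Finset.univ.image b →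
        x ∈ D ∧ (x ∈ U ∨ Occ f b x) := by
    intro l f b o z U h x hx
    rw [Finset.union_assoc, Finset.mem_union, Finset.mem_union, ← occ_iff] at hx
    refine ⟨?_, hx⟩
    rcases hx with hx | hx
    exacts [h.sub hx, (Finset.mem_sdiff.1 (h.occ_mem hx)).1]
  have hGmono : ∀ k l F B U, k ≤ l → G k F B U → G l F B U := by
    rintro l l' F B U hl ⟨h, f, b, o, z, hf, hb, hL⟩
    exact ⟨by omega, f, b, o, z, hf, hb, hL.mono hR hl⟩
  -- a single step takes at most four rounds, an exchange at most three for each vertex of its path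
  -- and one more
  have hmeet := tokens_meet (r := r) (v := v) N (3 * N + 4) G hGmono ?_ ?_ ?_
    (N * (N ^ 2 + 1) + N ^ 2) (k + 1 + 2 * N + 1) X X (D \ X)
  rotate_left
  · rintro l F B U u u' ⟨hl, f, b, o, z, rfl, rfl, hL⟩ hu hr hu'
    obtain ⟨i, -, hi⟩ := Finset.mem_image.1 hu
    obtain ⟨h5, h6⟩ := hmemD hL hu'
    exact ⟨by omega, _, _, _, _, image_move hu, rfl, Legal.mono hR (((hL.reset hR (p := u)
      ⟨i, .inl hi⟩)).forward hR hm (by omega) h5 h6 hr ⟨i, hi⟩) (by omega)⟩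
  · rintro l F B U u u' ⟨hl, f, b, o, z, rfl, rfl, hL⟩ hu hr hu'
    obtain ⟨i, -, hi⟩ := Finset.mem_image.1 hu
    obtain ⟨h5, h6⟩ := hmemD hL hu'
    exact ⟨by omega, _, _, _, _, rfl, image_move hu, Legal.mono hR (((hL.reset hR (p := u)
      ⟨i, .inr hi⟩)).backward hR hm (by omega) h5 h6 hr ⟨i, hi⟩) (by omega)⟩
  · rintro l F B U f₀ b₀ L ⟨hl, f, b, o, z, rfl, rfl, hL⟩ hf₀ hb₀ hnd hch hLm
    obtain ⟨i, -, hi⟩ := Finset.mem_image.1 hf₀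
    obtain ⟨j, -, hj⟩ := Finset.mem_image.1 hb₀
    have hfL := (List.nodup_cons.1 hnd).1
    have hLm' : ∀ x ∈ L ++ [b₀], x ∈ D ∧ (x ∈ U ∨ Occ f b x) := by
      intro x hx
      rcases List.mem_append.1 hx with hx | hx
      · exact hmemD hL (hLm x hx)
      · rw [List.mem_singleton.1 hx]
        exact hmemD hL (Finset.mem_union_right _ hb₀)
    have hlen : (f₀ :: (L ++ [b₀])).length ≤ N := by
      rw [← List.toFinset_card_of_nodup hnd]
      refine (Finset.card_le_card fun x hx => ?_).trans hN
      rcases List.mem_cons.1 (List.mem_toFinset.1 hx) with rfl | hx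
      · exact (hmemD hL (Finset.mem_union_left _ (Finset.mem_union_right _ hf₀))).1
      · exact (hLm' x hx).1
    have h5 := (hL.reset hR (p := f₀) ⟨i, .inl hi⟩).walk hR hm (y := b₀) (L ++ [b₀])
      (by omega) (by simp) ⟨i, hi⟩ hch hnd hfL hLm'
    refine ⟨by omega, _, fun i => if b i ∈ L ++ [b₀] then f₀ else b i, f₀, b₀,
      image_ite_mem ⟨i, by simp [hi]⟩, ?_, Legal.mono hR
      (k := l + 1 + 3 * (L ++ [b₀]).length) ?_ ?_⟩
    · rw [← image_ite_mem (y := f₀) ⟨j, by simp [hj]⟩]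
      congr 1
      funext a
      by_cases ha : b a = f₀
      · simp [ha]
      · simp only [List.mem_cons, ha, false_or]
    · rw [List.toFinset_cons, Finset.sdiff_insert, Finset.erase_eq_of_notMem]
      · exact h5
      · intro h
        exact (Finset.mem_sdiff.1 (hL.fwd_mem i)).2 (hi ▸ (Finset.mem_sdiff.1 h).1)
    · rw [List.length_cons] at hlen
      omega
  have hA : D \ X ∪ X ∪ X = D := by
    rw [Finset.union_assoc, Finset.union_self, Finset.sdiff_union_of_subset hXD]
  rw [hA] at hmeet
  obtain ⟨U, -, f', b', o', z', hf', hb', hL⟩ := hmeet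
    (Nat.add_le_add (Nat.mul_le_mul_right _ hN) (sum_needCount_le hXD hN)) hN
    (by rw [Finset.union_self]; exact Finset.sdiff_disjoint) (hXD hvX) ⟨v, hvX⟩ ⟨v, hvX⟩
    (fun x hx => hDto x (hXD hx)) (fun x hx => hDfrom x (hXD hx))
    ⟨by omega, f, f, v, v, rfl, rfl, hstart⟩
  have hf2 : f' = fun _ => v := by
    funext i
    have : f' i ∈ Finset.univ.image f' := Finset.mem_image_of_mem f' (Finset.mem_univ i)
    rwa [hf', Finset.mem_singleton] at this
  have hb2 : b' = fun _ => v := by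
    funext i
    have : b' i ∈ Finset.univ.image b' := Finset.mem_image_of_mem b' (Finset.mem_univ i)
    rwa [hb', Finset.mem_singleton] at this
  subst hf2 hb2
  obtain ⟨i₀, hi₀⟩ := hvf
  -- all tokens are on `v`, so the visited vertices both reach `v` and are reached from it
  have hDU : D \ U = D := by
    refine hmin _ Finset.sdiff_subset (fun i => ?_) fun y hy => ?_
    · exact Finset.mem_sdiff.2 ⟨hfD i, Finset.disjoint_left.1 hL.disj (hXm i)⟩
    · obtain ⟨_, h5⟩ := hL.fwd y hy
      obtain ⟨_, h6⟩ := hL.bwd y hy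
      exact ⟨h6, h5⟩
  obtain ⟨M, c, h5, h6, h7, h8⟩ := (hL.reset hR (p := v) ⟨i₀, .inl rfl⟩).playable
  rw [hDU] at h7
  exact ⟨M, c, h5, h6, h7, by omega⟩

/-- The first part of the game: the tokens walk from the roots into the strongly connected set
`C`. -/
theorem play_gather (hR : Rules r w play tree) {A C : Finset V} {v : V} {g : Fin q → V} {o z : V}
    (hCA : C ⊆ A) (hv : v ∈ C) (hC : ∀ c ∈ C, ReachIn r C c v)
    (hA : ∀ a ∈ A, ReachIn r A a v) (hg : ∀ i, g i ∈ A) (h0 : play 0 g g 0 o z 0) :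
    ∃ f o z c, play (2 * A.card) f f 0 o z c ∧ (∀ i, f i ∈ C) ∧
      c + ∑ x ∈ C \ Finset.univ.image f, w x ≤ ∑ x ∈ A, w x := by
  set R := Finset.univ.image g with hRdef
  have hRA : R ⊆ A := by
    intro x hx
    obtain ⟨i, -, rfl⟩ := Finset.mem_image.1 hx
    exact hg i
  let G : ℕ → Finset V → Finset V → Prop := fun k F U => ∃ f o z c, play k f f 0 o z c ∧
    Finset.univ.image f = F ∧ Disjoint U F ∧ c + ∑ x ∈ U, w x ≤ ∑ x ∈ A, w x
  have hAU : A \ R ∪ R = A := Finset.sdiff_union_of_subset hRA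
  have key := tokens_gather (r := r) (v := v) C 2 G hv hC ?_ ?_ A.card 0 R (A \ R)
  · rw [hAU] at key
    obtain ⟨F, U, h1, h2, -, f, o, z, c, h4, h5, -, h6⟩ := key
      (Finset.card_le_card Finset.sdiff_subset) Finset.sdiff_disjoint hCA hA
      ⟨g, o, z, 0, h0, rfl, Finset.sdiff_disjoint, by
        rw [zero_add]; exact Finset.sum_le_sum_of_subset Finset.sdiff_subset⟩
    refine ⟨f, o, z, c, hR.play_mono (by omega) le_rfl h4, fun i => h1 ?_, ?_⟩
    · rw [← h5]; exact Finset.mem_image_of_mem f (Finset.mem_univ i)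
    · rw [h5]
      exact (Nat.add_le_add_left (Finset.sum_le_sum_of_subset h2) c).trans h6
  · rintro k l F U U' hkl hU ⟨f, o, z, c, h1, h2, h3, h4⟩
    exact ⟨f, o, z, c, hR.play_mono hkl le_rfl h1, h2, h3.mono_left hU,
      (Nat.add_le_add_left (Finset.sum_le_sum_of_subset hU) c).trans h4⟩
  · rintro k F U u u' ⟨f, o, z, c, h1, rfl, h3, h4⟩ hu hr hu'
    obtain ⟨i, -, hi⟩ := Finset.mem_image.1 hu
    have h5 := hR.gather (hR.reset (p := u) h1 ⟨i, .inl hi⟩) hr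
    refine ⟨_, _, _, _, h5, image_move hu, disjoint_step h3, ?_⟩
    rw [enterCost]
    by_cases ho : Occ f f u'
    · have hF : u' ∈ Finset.univ.image f := by simpa using occ_iff.1 ho
      rw [if_pos ho, Finset.erase_eq_of_notMem fun h => Finset.disjoint_left.1 h3 h hF]
      exact h4
    · have hU : u' ∈ U := (Finset.mem_union.1 hu').resolve_right fun h => ho (occ_iff.2 (.inl h))
      have := Finset.sum_erase_add U w hU
      rw [if_neg ho]
      omega

/-- A solution of weight `t` with vertex set `W` and trunk `v` leads to a play of cost at most `t`:
the tokens gather in the strong component `C` of `v`, and meet in a minimal strongly connected part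
`D` of it; what is reachable from `v` but not in `D` is covered by out-trees. -/
theorem play_complete (hR : Rules r w play tree) {W : Finset V} {v : V} {g : Fin q → V} {o z : V}
    {m : V → ℕ} {N : ℕ} (hq : 0 < q) (hN : W.card ≤ N) (hvW : v ∈ W)
    (hto : ∀ i, ReachIn r W (g i) v)
    (hfrom : ∀ u, m u ≠ 0 → ReachIn r W v u) (hm : ∀ u, m u = 0 ∨ tree 0 u (m u) 0)
    (h0 : play 0 g g 0 o z 0) :
    ∃ M v c, play (2 * N + 1 + 2 * N + 1 + 2 * (N * (N ^ 2 + 1) + N ^ 2) * (3 * N + 4) + 1)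
        (fun _ => v) (fun _ => v) M v v c ∧ v ∈ W ∧ M.testBit 0 ∧
      (∀ u i, (m u).testBit i → M.testBit i) ∧ c ≤ ∑ u ∈ W, w u := by
  classical
  let A := W.filter fun u => ReachIn r W u v
  let O := W.filter fun u => ReachIn r W v u
  let C := A ∩ O
  have memA : ∀ x, x ∈ A ↔ ReachIn r W x v := fun x =>
    Finset.mem_filter.trans ⟨fun h => h.2, fun h => ⟨by exact_mod_cast h.1, h⟩⟩
  have memO : ∀ x, x ∈ O ↔ ReachIn r W v x := fun x =>
    Finset.mem_filter.trans ⟨fun h => h.2, fun h => ⟨by exact_mod_cast h.right_mem, h⟩⟩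
  have memC : ∀ x, x ∈ C ↔ ReachIn r W x v ∧ ReachIn r W v x := fun x => by
    rw [Finset.mem_inter, memA, memO]
  have hvv : ReachIn r W v v := .refl (by exact_mod_cast hvW)
  have hvC : v ∈ C := (memC v).2 ⟨hvv, hvv⟩
  have hCto : ∀ c ∈ C, ReachIn r C c v := fun c hc => by
    rw [memC] at hc
    exact hc.1.between.mono fun a ha => by
      rw [Finset.mem_coe, memC]; exact ⟨ha.2, hc.2.trans ha.1⟩
  have hCfrom : ∀ c ∈ C, ReachIn r C v c := fun c hc => by
    rw [memC] at hc
    exact hc.2.between.mono fun a ha => by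
      rw [Finset.mem_coe, memC]; exact ⟨ha.2.trans hc.1, ha.1⟩
  have hAto : ∀ a ∈ A, ReachIn r A a v := fun a ha =>
    ((memA a).1 ha).between.mono fun x hx => by rw [Finset.mem_coe, memA]; exact hx.2
  have hOfrom : ∀ a ∈ O, ReachIn r O v a := fun a ha =>
    ((memO a).1 ha).between.mono fun x hx => by rw [Finset.mem_coe, memO]; exact hx.1
  have hCA : C ⊆ A := Finset.inter_subset_left
  have hCO : C ⊆ O := Finset.inter_subset_right
  have hAW : A ⊆ W := Finset.filter_subset _ _
  have hOW : O ⊆ W := Finset.filter_subset _ _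
  obtain ⟨f, o, z, c, h1, h2, h3⟩ := play_gather hR hCA hvC hCto hAto
    (fun i => (memA _).2 (hto i)) h0
  let v₀ := f ⟨0, hq⟩
  have hv₀C : v₀ ∈ C := h2 _
  -- a minimal strongly connected set containing the tokens
  obtain ⟨D, hD, hDmin⟩ := Finset.exists_min_image
    (C.powerset.filter fun Y : Finset V =>
      (∀ i, f i ∈ Y) ∧ ∀ y ∈ Y, ReachIn r ↑Y v₀ y ∧ ReachIn r ↑Y y v₀)
    Finset.card ⟨C, by
      simp only [Finset.mem_filter, Finset.mem_powerset_self, true_and]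
      exact ⟨h2, fun y hy => ⟨(hCto _ hv₀C).trans (hCfrom y hy), (hCto y hy).trans
        (hCfrom _ hv₀C)⟩⟩⟩
  rw [Finset.mem_filter, Finset.mem_powerset] at hD
  obtain ⟨hDC, hfD, hDsc⟩ := hD
  have hmin : ∀ Y ⊆ D, (∀ i, f i ∈ Y) → (∀ y ∈ Y, ReachIn r Y v₀ y ∧ ReachIn r Y y v₀) →
      Y = D := fun Y hYD hY hYsc => Finset.eq_of_subset_of_card_le hYD
    (hDmin Y (Finset.mem_filter.2 ⟨Finset.mem_powerset.2 (hYD.trans hDC), hY, hYsc⟩))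
  have hDO := hDC.trans hCO
  have hDZ : D ∪ O \ D = O := Finset.union_sdiff_of_subset hDO
  -- what is reachable but not in `D` hangs off `D` in the form of out-trees
  obtain ⟨m', bc, h4, h5, h6⟩ := exists_bundles (r := r) (v := v₀) tree w
    (fun k l u M c c' hk hc h => hR.tree_mono hk hc h) (fun k u p M c h hr => hR.tree_move h hr)
    (fun k u M c M' c' h h' => hR.tree_merge h h') (hfD ⟨0, hq⟩) (fun d hd => (hDsc d hd).1)
    (O \ D).card 0 (O \ D) m (fun _ => 0) rfl Finset.disjoint_sdiff
    (by
      rw [hDZ]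
      exact fun a ha => ((hCto _ hv₀C).mono (Finset.coe_subset.2 hCO)).trans (hOfrom a ha))
    (fun u _ => hm u)
  rw [hDZ] at h5 h6
  have hXD : Finset.univ.image f ⊆ D := by
    intro x hx
    obtain ⟨i, -, rfl⟩ := Finset.mem_image.1 hx
    exact hfD i
  have hZN : (O \ D).card ≤ N :=
    (Finset.card_le_card (Finset.sdiff_subset.trans hOW)).trans hN
  have hAN := (Finset.card_le_card hAW).trans hN
  -- the vertices of `A` outside `C` are paid in the first part of the game, those of `D` in the
  -- second part, and those of `O` outside `D` by the out-trees
  have e1 := Finset.sum_sdiff (f := w) hDO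
  have e2 := Finset.sum_sdiff (f := w) hXD
  have e3 := Finset.sum_sdiff (f := w) (hXD.trans hDC)
  have e4 := Finset.sum_union_inter (s₁ := A) (s₂ := O) (f := w)
  have e5 : ∑ u ∈ A ∪ O, w u ≤ ∑ u ∈ W, w u :=
    Finset.sum_le_sum_of_subset (Finset.union_subset hAW hOW)
  have e6 : ∑ u ∈ A ∩ O, w u = ∑ u ∈ C, w u := rfl
  rw [Finset.sum_const_zero, zero_add] at h6
  obtain ⟨M, c', h7, h8, h9, h10⟩ := play_core hR (m := m') (bc := bc) (v := v₀) (N := N)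
    (k := 2 * N) (t := ∑ u ∈ W, w u)
    ((Finset.card_le_card (hDO.trans hOW)).trans hN) hfD ⟨_, rfl⟩ (fun d hd => (hDsc d hd).2)
    (fun d hd => (hDsc d hd).1) hmin
    (fun l hl d hd => (h4 d hd).imp id (hR.tree_mono (by omega) le_rfl))
    (hR.play_mono (by omega) le_rfl h1) (by omega)
  refine ⟨M, v₀, c', h7, hOW (hCO hv₀C), h8, fun u i hi => ?_, h10⟩
  have hu0 : m u ≠ 0 := ne_zero_of_testBit hi
  obtain ⟨d, hd, hdi⟩ := h5 i u ((memO u).2 (hfrom u hu0)) hi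
  exact h9 d hd i hdi

end Game

/-! ### Tuples of vertices as numbers -/

/-- The number whose first `k` digits in base `n` are given by `d`. -/
def enc (n k : ℕ) (d : ℕ → ℕ) : ℕ := ∑ i ∈ Finset.range k, d i * n ^ i

/-- The `i`-th digit of `σ` in base `n`. -/
def dig (n σ i : ℕ) : ℕ := σ / n ^ i % n

theorem enc_succ (n k : ℕ) (d : ℕ → ℕ) : enc n (k + 1) d = enc n k d + d k * n ^ k :=
  Finset.sum_range_succ _ _

theorem enc_congr {n k : ℕ} {d e : ℕ → ℕ} (h : ∀ i < k, d i = e i) : enc n k d = enc n k e :=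
  Finset.sum_congr rfl fun i hi => by rw [h i (Finset.mem_range.1 hi)]

theorem enc_lt {n k : ℕ} {d : ℕ → ℕ} (h : ∀ i < k, d i < n) : enc n k d < n ^ k := by
  induction k with
  | zero => simp [enc]
  | succ k ih =>
    rw [enc_succ, pow_succ]
    have h1 := ih fun i hi => h i (by omega)
    have h2 := Nat.mul_le_mul_right (n ^ k) (Nat.succ_le_of_lt (h k (by omega)))
    rw [Nat.succ_mul, mul_comm n] at h2
    omega

theorem enc_add (n k l : ℕ) (d : ℕ → ℕ) :
    enc n (k + l) d = enc n k d + n ^ k * enc n l fun i => d (k + i) := by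
  rw [enc, Finset.sum_range_add, enc, enc, Finset.mul_sum]
  congr 1
  refine Finset.sum_congr rfl fun i _ => ?_
  rw [pow_add]; ring

theorem dig_lt {n : ℕ} (hn : 0 < n) (σ i : ℕ) : dig n σ i < n := Nat.mod_lt _ hn

theorem dig_enc {n k : ℕ} {d : ℕ → ℕ} (h : ∀ i < k, d i < n) {i : ℕ} (hi : i < k) :
    dig n (enc n k d) i = d i := by
  have hn : 0 < n := (Nat.zero_le _).trans_lt (h i hi)
  obtain ⟨l, rfl⟩ : ∃ l, k = i + (1 + l) := ⟨k - i - 1, by omega⟩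
  rw [dig, enc_add, Nat.add_mul_div_left _ _ (by positivity),
    Nat.div_eq_of_lt (enc_lt fun j hj => h j (by omega)), zero_add, enc_add]
  rw [pow_one, Nat.add_mul_mod_self_left]
  have : enc n 1 (fun j => d (i + j)) = d i := by simp [enc]
  rw [this, Nat.mod_eq_of_lt (h i (by omega))]

/-- Among the digits of `σ` with value `z`, replace those with index below `q` by `A` and the others
by `C`. -/
def moveCode (n q σ z A C : ℕ) : ℕ :=
  enc n (q + q) fun i => if dig n σ i = z then (if i < q then A else C) else dig n σ i

/-- The number of digits of `σ` with value `p`. -/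
def occCount (n q σ p : ℕ) : ℕ :=
  ∑ i ∈ Finset.range (q + q), if dig n σ i = p then 1 else 0

theorem moveCode_lt {n q σ z A C : ℕ} (hA : A < n) (hC : C < n) :
    moveCode n q σ z A C < n ^ (q + q) := by
  refine enc_lt fun i _ => ?_
  split_ifs
  exacts [hA, hC, dig_lt (by omega) _ _]

/-! ### Expressions, and the scan of a tuple

The registers of the program: `0` holds the number `n` of vertices, `1` the number `q` of roots,
`2` the number of masks, `3` the number of steps to be made, `4` the number of different steps,
`5` the loop counter, `6` a power of `n`, `7` the code of the initial tokens, `8` the number with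
`2 q` digits `1` in base `n`, `9` a root, `10` to `16` the data of the current step, `25` the best
entry found; the others are for intermediate results. The arrays `0`, `1`, `2` are the input, `3`
is the table of the dynamic program, and `4` the table of the unions of two masks. -/

instance : Add Expr := ⟨.bin .add⟩
instance : Sub Expr := ⟨.bin .sub⟩
instance : Mul Expr := ⟨.bin .mul⟩
instance : Div Expr := ⟨.bin .div⟩

/-- Remainder. -/
def Expr.rem (e f : Expr) : Expr := e - e / f * f

/-- The value `1` if `e` and `f` agree, and `0` otherwise. -/
def Expr.same (e f : Expr) : Expr := .bin .eq e f

/-- The value `1` if `e` is less than `f`, and `0` otherwise. -/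
def Expr.less (e f : Expr) : Expr := .bin .lt e f

section Val

variable (s : State) (e f : Expr)

@[simp] theorem val_add : (e + f).val s = e.val s + f.val s := rfl
@[simp] theorem val_sub : (e - f).val s = e.val s - f.val s := rfl
@[simp] theorem val_mul : (e * f).val s = e.val s * f.val s := rfl
@[simp] theorem val_div : (e / f).val s = e.val s / f.val s := rfl
@[simp] theorem val_const (c : ℕ) : (Expr.const c).val s = c := rfl
@[simp] theorem val_reg (r : ℕ) : (Expr.reg r).val s = s.reg r := rfl
@[simp] theorem val_load (a : ℕ) : (Expr.load a e).val s = s.arr a (e.val s) := rfl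
@[simp] theorem val_same : (e.same f).val s = if e.val s = f.val s then 1 else 0 := rfl
@[simp] theorem val_less : (e.less f).val s = if e.val s < f.val s then 1 else 0 := rfl
@[simp] theorem val_rem : (e.rem f).val s = e.val s % f.val s := by
  simp only [Expr.rem, val_sub, val_mul, val_div]
  rw [mul_comm, ← Nat.mod_eq_sub_mul_div]

@[simp] theorem setReg_reg (r v r' : ℕ) :
    (s.setReg r v).reg r' = if r' = r then v else s.reg r' := rfl
@[simp] theorem setReg_arr (r v : ℕ) : (s.setReg r v).arr = s.arr := rfl
@[simp] theorem setArr_reg (a i v : ℕ) : (s.setArr a i v).reg = s.reg := rfl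

end Val

theorem setArr_arr_self (s : State) (a i v : ℕ) :
    (s.setArr a i v).arr a = fun j => if j = i then v else s.arr a j := by
  funext j
  simp [State.setArr]

theorem setArr_arr_of_ne (s : State) {a a' : ℕ} (i v : ℕ) (h : a' ≠ a) :
    (s.setArr a i v).arr a' = s.arr a' := by
  funext j
  simp [State.setArr, h]

theorem Ends.set_seq {B : ℕ} {s : State} {r : ℕ} {e : Expr} {p : Prog} {k : ℕ} {Q : State → Prop}
    (h : e.val s ≤ B) (hQ : Ends B p (s.setReg r (e.val s)) k Q) :
    Ends B (.seq (.set r e) p) s (k + 1) Q :=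
  (Ends.seq (k := 1) (k' := k) (Ends.set h hQ)).mono (by omega) fun _ h => h

theorem Ends.store_seq {B : ℕ} {s : State} {a : ℕ} {i e : Expr} {p : Prog} {k : ℕ}
    {Q : State → Prop} (h : e.val s ≤ B) (hQ : Ends B p (s.setArr a (i.val s) (e.val s)) k Q) :
    Ends B (.seq (.store a i e) p) s (k + 1) Q :=
  (Ends.seq (k := 1) (k' := k) (Ends.store h hQ)).mono (by omega) fun _ h => h

/-- One round of `scanProg`. -/
def scanBody : Prog :=
  .seq (.set 24 ((Expr.reg 20).rem (.reg 0))) <|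
  .seq (.set 20 (.reg 20 / .reg 0)) <|
  .seq (.set 23 (.reg 23 + (Expr.reg 24).same (.reg 11))) <|
  .seq (.set 21 (.reg 21 + ((Expr.reg 24).same (.reg 13) *
      ((Expr.reg 19).less (.reg 1) * .reg 17 + (.const 1 - (Expr.reg 19).less (.reg 1)) * .reg 18) +
      (.const 1 - (Expr.reg 24).same (.reg 13)) * .reg 24) * .reg 22)) <|
  .seq (.set 22 (.reg 22 * .reg 0)) <|
  .set 19 (.reg 19 + .const 1)

/-- Computes `moveCode` and `occCount` for the tuple with number `reg 16 - 1`: the number of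
vertices is in register `0`, the number of roots in register `1`, the vertex `p` in register `11`,
the vertex `z` in register `13`, and its replacements in registers `17` and `18`. The results are
in registers `21` and `23`. -/
def scanProg : Prog :=
  .seq (.set 19 (.const 0)) <| .seq (.set 20 (.reg 16 - .const 1)) <|
  .seq (.set 21 (.const 0)) <| .seq (.set 22 (.const 1)) <|
  .seq (.set 23 (.const 0)) <|
  .loop ((Expr.reg 19).less (.reg 1 + .reg 1)) scanBody

theorem scanProg_spec {B n q σ z p A C : ℕ} {s : State} (h0 : s.reg 0 = n) (h1 : s.reg 1 = q)
    (h11 : s.reg 11 = p) (h13 : s.reg 13 = z) (h16 : s.reg 16 = σ + 1) (h17 : s.reg 17 = A)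
    (h18 : s.reg 18 = C) (hA : A < n) (hC : C < n) (hσ : σ ≤ B) (hB : n ^ (q + q) ≤ B)
    (hq : q + q ≤ B) (hn : n ≤ B) :
    Ends B scanProg s ((q + q) * 7 + 6) fun s' => (∀ r < 19, s'.reg r = s.reg r) ∧
      s'.arr = s.arr ∧ s'.reg 21 = moveCode n q σ z A C ∧ s'.reg 23 = occCount n q σ p := by
  have hn0 : 0 < n := by omega
  have hB1 : 1 ≤ B := by omega
  let d : ℕ → ℕ := fun i => if dig n σ i = z then (if i < q then A else C) else dig n σ i
  have hd : ∀ i, d i < n := by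
    intro i
    simp only [d]
    split_ifs
    exacts [hA, hC, dig_lt hn0 _ _]
  have hocc : ∀ j, ∑ i ∈ Finset.range j, (if dig n σ i = p then 1 else 0) ≤ j := by
    intro j
    calc _ ≤ ∑ i ∈ Finset.range j, 1 := Finset.sum_le_sum fun i _ => by split_ifs <;> simp
      _ = j := by simp
  let I : ℕ → State → Prop := fun j s' => (∀ r < 19, s'.reg r = s.reg r) ∧ s'.arr = s.arr ∧
    s'.reg 19 = j ∧ s'.reg 20 = σ / n ^ j ∧ s'.reg 21 = enc n j d ∧ s'.reg 22 = n ^ j ∧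
    s'.reg 23 = ∑ i ∈ Finset.range j, if dig n σ i = p then 1 else 0
  have key : ∀ s', I 0 s' → Ends B (.loop ((Expr.reg 19).less (.reg 1 + .reg 1)) _) s'
      ((q + q) * (6 + 1) + 1) (I (q + q)) := fun s' => Ends.loop (I := I) (k := 6)
    (p := scanBody) (by
      rintro j s' hj ⟨hf, ha, h19, h20, h21, h22, h23⟩
      have f0 := (hf 0 (by norm_num)).trans h0
      have f1 := (hf 1 (by norm_num)).trans h1
      have f11 := (hf 11 (by norm_num)).trans h11
      have f13 := (hf 13 (by norm_num)).trans h13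
      have f17 := (hf 17 (by norm_num)).trans h17
      have f18 := (hf 18 (by norm_num)).trans h18
      have hdj : σ / n ^ j % n = dig n σ j := rfl
      have hdl := dig_lt hn0 σ j
      have hpow : n ^ (j + 1) ≤ B := (Nat.pow_le_pow_right hn0 (by omega)).trans hB
      have hval : ((if dig n σ j = z then 1 else 0) * ((if j < q then 1 else 0) * A +
          (1 - if j < q then 1 else 0) * C) + (1 - if dig n σ j = z then 1 else 0) * dig n σ j) =
          d j := by
        simp only [d]
        split_ifs <;> simp
      refine ⟨by simp [h19, f1, hj], ?_⟩
      refine Ends.set_seq (by simp [h20, f0]; omega) ?_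
      refine Ends.set_seq
        (by simpa [h20, f0] using (Nat.div_le_self _ _).trans ((Nat.div_le_self _ _).trans hσ)) ?_
      refine Ends.set_seq ?_ ?_
      · have h5 := hocc (j + 1)
        rw [Finset.sum_range_succ] at h5
        simp only [val_add, val_reg, setReg_reg, val_same, val_rem, h23, h20, f0, f11, hdj]
        norm_num only [f11, h23, if_true, if_false]
        omega
      refine Ends.set_seq ?_ ?_
      · simp only [val_add, val_reg, val_sub, val_mul, val_same, val_less, val_const, val_rem,
          val_div, setReg_reg]
        norm_num only [h19, h20, h21, h22, h23, f0, f1, f11, f13, f17, f18, hdj, hval,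
          if_true, if_false]
        rw [← enc_succ]
        exact (enc_lt fun i _ => hd i).le.trans hpow
      refine Ends.set_seq (by simpa [h22, f0, ← pow_succ] using hpow) ?_
      refine Ends.set (by simp [h19]; omega) ⟨fun r hr => ?_, by simp [ha], ?_, ?_, ?_, ?_, ?_⟩
      · simp only [setReg_reg]
        rw [if_neg (by omega), if_neg (by omega), if_neg (by omega), if_neg (by omega),
          if_neg (by omega), if_neg (by omega), hf r hr]
      · simp [h19]
      · simp [h20, f0, pow_succ, Nat.div_div_eq_div_mul]
      · simp only [val_add, val_reg, val_sub, val_mul, val_same, val_less, val_const, val_rem,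
          val_div, setReg_reg]
        norm_num only [h19, h20, h21, h22, h23, f0, f1, f11, f13, f17, f18, hdj, hval,
          if_true, if_false]
        rw [← enc_succ]
      · simp [h22, f0, pow_succ]
      · rw [Finset.sum_range_succ]
        simp [h20, f0, f11, h23, hdj]) (by
      rintro s' ⟨hf, ha, h19, -⟩
      simp [h19, (hf 1 (by norm_num)).trans h1])
  refine Ends.set_seq (by simp) ?_
  refine Ends.set_seq (by simpa [h16] using hσ) ?_
  refine Ends.set_seq (by simp) ?_
  refine Ends.set_seq (by simpa using hB1) ?_
  refine Ends.set_seq (by simp) ?_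
  refine (key _ ⟨fun r hr => ?_, by simp, by simp, by simp [h16], by simp [enc], by simp,
    by simp⟩).mono le_rfl ?_
  · simp only [setReg_reg]
    rw [if_neg (by omega), if_neg (by omega), if_neg (by omega), if_neg (by omega),
      if_neg (by omega)]
  · rintro s' ⟨hf, ha, -, -, h21, -, h23⟩
    exact ⟨hf, ha, h21, h23⟩

/-! ### One step of the dynamic program -/

/-- The constants of the dynamic program: the number `n` of vertices, the number `q` of roots, the
number `E` of masks, the adjacency matrix, the characteristic vectors of the roots and the
terminals, and the table of the unions of two masks. -/
structure Ctx where
  /-- the number of vertices -/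
  n : ℕ
  /-- the number of roots -/
  q : ℕ
  /-- the number of masks -/
  E : ℕ
  /-- the adjacency matrix, in row-major order -/
  adj : ℕ → ℕ
  /-- the characteristic vector of the roots -/
  root : ℕ → ℕ
  /-- the characteristic vector of the terminals -/
  term : ℕ → ℕ
  /-- the union of `M` and `M'` is stored at `M * E + M'` -/
  union : ℕ → ℕ

/-- Vertices outside `R ∪ T` have weight `1`, the others weight `0`. -/
def Ctx.weight (x : Ctx) (u : ℕ) : ℕ := if x.root u + x.term u = 0 then 1 else 0

/-- The cell of the table that belongs to an item. For `σ = 0` the item is an out-tree from `z` that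
covers the mask `M`; for `σ > 0` it is a position of the token game, where `σ - 1` encodes the
tokens, `M` is the mask, and the carrier went from `o` to `z`. -/
def Ctx.idx (x : Ctx) (σ M o z : ℕ) : ℕ := ((σ * x.E + M) * x.n + o) * x.n + z

/-- Raise the entry of a table at `j` to `v`. -/
def relaxAt (D : ℕ → ℕ) (j v : ℕ) : ℕ → ℕ := fun i => if i = j then max (D j) v else D i

theorem le_relaxAt (D : ℕ → ℕ) (j v i : ℕ) : D i ≤ relaxAt D j v i := by
  unfold relaxAt
  split_ifs with h
  · exact h ▸ le_max_left _ _
  · exact le_rfl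

theorem le_relaxAt_self (D : ℕ → ℕ) (j v : ℕ) : v ≤ relaxAt D j v j := by
  simp [relaxAt]

theorem relaxAt_le {D : ℕ → ℕ} {j v b : ℕ} (hD : ∀ i, D i ≤ b) (hv : v ≤ b) (i : ℕ) :
    relaxAt D j v i ≤ b := by
  unfold relaxAt
  split_ifs
  exacts [max_le (hD j) hv, hD i]

/-- The price, in the table, for a step along an edge that is present if `a = 1`: a step along a
missing edge costs more than any solution. -/
def edgeCost (n a : ℕ) : ℕ := (1 - a) * (n + 1)

/-- The price of occupying `p` when the tokens are encoded by `σ`. -/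
def Ctx.enter (x : Ctx) (σ p : ℕ) : ℕ :=
  (if occCount x.n x.q σ p = 0 then 1 else 0) * x.weight p

/-- The moves of the tokens from a position `(σ, M, o, z)` that involve the vertex `p`. An
entry of the table is `n + 1 - c` for an item of cost `c`, and `0` for an item that has not been
found; this makes `0` the neutral initial value, and truncated subtraction turns every move that is
charged `n + 1` into no move at all. The four moves reset the carrier to an occupied vertex `p`,
walk forwards to `p`, walk backwards to `p`, and let the backward tokens on `z` jump to `o`. As
long as `M = 0`, a step forwards takes the backward tokens along. -/
def Ctx.moves (x : Ctx) (σ M o z p : ℕ) (D : ℕ → ℕ) : ℕ → ℕ :=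
  let s := x.idx (σ + 1) M o z
  let D := relaxAt D (x.idx (moveCode x.n x.q σ z z z + 1) M p p)
    (D s - (if occCount x.n x.q σ p = 0 then 1 else 0) * (x.n + 1))
  let D := relaxAt D (x.idx (moveCode x.n x.q σ z p (if M = 0 then p else z) + 1) M
    (if M = 0 then p else o) p) (D s - (x.enter σ p + edgeCost x.n (x.adj (z * x.n + p))))
  let D := relaxAt D (x.idx (moveCode x.n x.q σ z z p + 1) M o z)
    (D s - (x.enter σ p + edgeCost x.n (x.adj (p * x.n + z)) +
      (if M = 0 then 1 else 0) * (x.n + 1)))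
  relaxAt D (x.idx (moveCode x.n x.q σ z z o + 1) M o z) (D s - 0)

/-- Extend the out-tree from `z` by a new root `p`. -/
def Ctx.grow (x : Ctx) (M o z p : ℕ) (D : ℕ → ℕ) : ℕ → ℕ :=
  relaxAt D (x.idx 0 M o p) (D (x.idx 0 M o z) - (x.weight z + edgeCost x.n (x.adj (p * x.n + z))))

/-- Combine an item with an out-tree for the mask `M'`. If the costs are `c` and `c'`, the entries
add up to `(n + 1 - (c + c')) + (n + 1)`. Out-trees are stored with `o = 0`. -/
def Ctx.join (x : Ctx) (σ M o z M' : ℕ) (D : ℕ → ℕ) : ℕ → ℕ :=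
  relaxAt D (x.idx σ (x.union (M * x.E + M')) o z)
    (D (x.idx σ M o z) + D (x.idx 0 M' 0 z) - (x.n + 1))

/-- All updates of the table that use the item `(σ, M, o, z)`, the vertex `p` and the mask `M'`. -/
def Ctx.pass (x : Ctx) (σ M o z p M' : ℕ) (D : ℕ → ℕ) : ℕ → ℕ :=
  x.join σ M o z M' (if σ = 0 then x.grow M o z p D else x.moves (σ - 1) M o z p D)

/-- The number of the step that treats given data. -/
def Ctx.code (x : Ctx) (σ M o z p M' : ℕ) : ℕ := (x.idx σ M o z * x.n + p) * x.E + M'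

/-- The step with number `y`. -/
def Ctx.passAt (x : Ctx) (y : ℕ) : (ℕ → ℕ) → ℕ → ℕ :=
  let s := y / x.E / x.n
  x.pass (s / x.n / x.n / x.E) (s / x.n / x.n % x.E) (s / x.n % x.n) (s % x.n) (y / x.E % x.n)
    (y % x.E)

theorem Ctx.passAt_code (x : Ctx) {σ M o z p M' : ℕ} (hM : M < x.E) (ho : o < x.n) (hz : z < x.n)
    (hp : p < x.n) (hM' : M' < x.E) : x.passAt (x.code σ M o z p M') = x.pass σ M o z p M' := by
  have key : ∀ {a b c : ℕ}, b < c → (a * c + b) / c = a ∧ (a * c + b) % c = b := by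
    intro a b c h
    have hc : 0 < c := by omega
    constructor
    · rw [mul_comm, Nat.mul_add_div hc, Nat.div_eq_of_lt h, add_zero]
    · rw [mul_comm, Nat.mul_add_mod, Nat.mod_eq_of_lt h]
  simp only [passAt, code, idx, (key hM).1, (key hM).2, (key ho).1, (key ho).2, (key hz).1,
    (key hz).2, (key hp).1, (key hp).2, (key hM').1, (key hM').2]

theorem Ctx.idx_inj (x : Ctx) {σ M o z σ' M' o' z' : ℕ} (hM : M < x.E) (ho : o < x.n)
    (hz : z < x.n) (hM' : M' < x.E) (ho' : o' < x.n) (hz' : z' < x.n)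
    (h : x.idx σ M o z = x.idx σ' M' o' z') : σ = σ' ∧ M = M' ∧ o = o' ∧ z = z' := by
  have key : ∀ {a b a' b' c : ℕ}, b < c → b' < c → a * c + b = a' * c + b' → a = a' ∧ b = b' := by
    intro a b a' b' c hb hb' h
    have hc : 0 < c := by omega
    have h1 : (a * c + b) / c = (a' * c + b') / c := by rw [h]
    rw [mul_comm, Nat.mul_add_div hc, Nat.div_eq_of_lt hb, mul_comm, Nat.mul_add_div hc,
      Nat.div_eq_of_lt hb'] at h1
    have h2 : a = a' := by omega
    subst h2
    exact ⟨rfl, by omega⟩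
  obtain ⟨h1, h2⟩ := key hz hz' h
  obtain ⟨h3, h4⟩ := key ho ho' h1
  obtain ⟨h5, h6⟩ := key hM hM' h3
  exact ⟨h5, h6, h4, h2⟩

theorem Ctx.idx_lt (x : Ctx) {σ M o z N : ℕ} (hσ : σ ≤ N) (hM : M < x.E) (ho : o < x.n)
    (hz : z < x.n) : x.idx σ M o z < (N + 1) * x.E * x.n * x.n := by
  have key : ∀ {a b c m : ℕ}, a < m → b < c → a * c + b < m * c := by
    intro a b c m ha hb
    have := Nat.mul_le_mul_right c (Nat.succ_le_of_lt ha)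
    rw [Nat.succ_mul] at this
    omega
  exact key (key (key (by omega) hM) ho) hz

theorem Ctx.idx_zero (x : Ctx) (M z : ℕ) : x.idx 0 M 0 z = M * x.n * x.n + z := by
  simp [idx]

/-- Raise the cell of the table with index `t` to `v`. -/
def relaxProg (t v : Expr) : Prog :=
  .seq (.set 26 t) <| .seq (.set 27 v) <|
  .cond ((Expr.load 3 (.reg 26)).less (.reg 27)) (.store 3 (.reg 26) (.reg 27)) .skip

/-- States that agree up to the table and the registers from `m` on. -/
def SameTo (m : ℕ) (s s' : State) : Prop :=
  (∀ r < m, s'.reg r = s.reg r) ∧ ∀ a, a ≠ 3 → s'.arr a = s.arr a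

theorem SameTo.refl (m : ℕ) (s : State) : SameTo m s s := ⟨fun _ _ => rfl, fun _ _ => rfl⟩

theorem SameTo.trans {m : ℕ} {s s' s'' : State} (h : SameTo m s s') (h' : SameTo m s' s'') :
    SameTo m s s'' :=
  ⟨fun r hr => (h'.1 r hr).trans (h.1 r hr), fun a ha => (h'.2 a ha).trans (h.2 a ha)⟩

theorem SameTo.mono {m l : ℕ} {s s' : State} (h : SameTo m s s') (hl : l ≤ m) : SameTo l s s' :=
  ⟨fun r hr => h.1 r (hr.trans_le hl), h.2⟩

theorem SameTo.setReg {m r : ℕ} (hr : m ≤ r) (s : State) (v : ℕ) : SameTo m s (s.setReg r v) :=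
  ⟨fun r' hr' => by rw [setReg_reg, if_neg (by omega)], fun _ _ => rfl⟩

theorem relaxProg_spec {B j v : ℕ} {s : State} {te ve : Expr} {D : ℕ → ℕ} (ht : te.val s = j)
    (hv : ve.val (s.setReg 26 j) = v) (hD : s.arr 3 = D) (hjB : j ≤ B) (hvB : v ≤ B) :
    Ends B (relaxProg te ve) s 4 fun s' => SameTo 26 s s' ∧ s'.arr 3 = relaxAt D j v := by
  refine Ends.set_seq (by rwa [ht]) (Ends.set_seq (by rwa [ht, hv]) ?_)
  rw [ht, hv]
  have hs : SameTo 26 s ((s.setReg 26 j).setReg 27 v) :=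
    (SameTo.setReg le_rfl _ _).trans (SameTo.setReg (by norm_num) _ _)
  refine Ends.cond (k := 1) (fun h => Ends.store (by simpa using hvB) ⟨⟨hs.1, fun a ha => ?_⟩, ?_⟩)
    fun h => Ends.skip ⟨hs, ?_⟩
  · rw [setArr_arr_of_ne _ _ _ ha]
    exact hs.2 a ha
  · have h1 : D j < v := by simpa [hD] using h
    rw [setArr_arr_self]
    funext i
    simp [relaxAt, hD, max_eq_right h1.le]
  · have h1 : v ≤ D j := by simpa [hD] using h
    funext i
    simp only [setReg_arr, hD, relaxAt, max_eq_left h1]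
    split_ifs with h2
    exacts [by rw [h2], rfl]

/-- The index of an item. -/
def idxExpr (σ M o z : Expr) : Expr := ((σ * .reg 2 + M) * .reg 0 + o) * .reg 0 + z

/-- A move of the tokens: the tokens on `z` are replaced by `A` and `C`, the carrier becomes
`(o, z')`, and the price is `c`. -/
def tokenProg (A C o z' c : Expr) : Prog :=
  .seq (.set 17 A) <| .seq (.set 18 C) <| .seq scanProg <|
  relaxProg (idxExpr (.reg 21 + .const 1) (.reg 15) o z') (.load 3 (.reg 12) - c)

/-- The registers and arrays hold the data for a step of the dynamic program. -/
structure Loaded (x : Ctx) (σ M o z p M' : ℕ) (s : State) : Prop where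
  n : s.reg 0 = x.n
  q : s.reg 1 = x.q
  E : s.reg 2 = x.E
  M' : s.reg 10 = M'
  p : s.reg 11 = p
  src : s.reg 12 = x.idx σ M o z
  z : s.reg 13 = z
  o : s.reg 14 = o
  M : s.reg 15 = M
  σ : s.reg 16 = σ
  adj : s.arr 0 = x.adj
  root : s.arr 1 = x.root
  term : s.arr 2 = x.term
  union : s.arr 4 = x.union

theorem Loaded.of_same {x : Ctx} {σ M o z p M' : ℕ} {s s' : State} (h : Loaded x σ M o z p M' s)
    (hs : SameTo 17 s s') : Loaded x σ M o z p M' s' where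
  n := (hs.1 _ (by norm_num)).trans h.n
  q := (hs.1 _ (by norm_num)).trans h.q
  E := (hs.1 _ (by norm_num)).trans h.E
  M' := (hs.1 _ (by norm_num)).trans h.M'
  p := (hs.1 _ (by norm_num)).trans h.p
  src := (hs.1 _ (by norm_num)).trans h.src
  z := (hs.1 _ (by norm_num)).trans h.z
  o := (hs.1 _ (by norm_num)).trans h.o
  M := (hs.1 _ (by norm_num)).trans h.M
  σ := (hs.1 _ (by norm_num)).trans h.σ
  adj := (hs.2 _ (by norm_num)).trans h.adj
  root := (hs.2 _ (by norm_num)).trans h.root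
  term := (hs.2 _ (by norm_num)).trans h.term
  union := (hs.2 _ (by norm_num)).trans h.union

/-- The bounds on the data of a step that keep all numbers below `B`. -/
structure Ctx.Bound (x : Ctx) (B : ℕ) : Prop where
  size : (x.n ^ (x.q + x.q) + 1) * x.E * x.n * x.n ≤ B
  one_le : 1 ≤ x.E
  n_lt : x.n + 1 ≤ B
  q_le : x.q + x.q ≤ B
  pow_le : x.n ^ (x.q + x.q) ≤ B

theorem tokenProg_spec {x : Ctx} {B σ M o z p M' : ℕ} {s : State} {D : ℕ → ℕ}
    {Ae Ce oe ze ce : Expr} {A C o' z' c : ℕ}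
    (hB : x.Bound B) (h : Loaded x (σ + 1) M o z p M' s) (hD : s.arr 3 = D)
    (hDn : ∀ i, D i ≤ x.n + 1) (hσ : σ < x.n ^ (x.q + x.q)) (hM : M < x.E) (hA : A < x.n)
    (hC : C < x.n) (ho : o' < x.n) (hz : z' < x.n)
    (hAe : Ae.val s = A) (hCe : Ce.val (s.setReg 17 A) = C)
    (hoe : ∀ s', SameTo 17 s s' → oe.val s' = o') (hze : ∀ s', SameTo 17 s s' → ze.val s' = z')
    (hce : ∀ s', SameTo 17 s s' → s'.reg 23 = occCount x.n x.q σ p → ce.val s' = c) :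
    Ends B (tokenProg Ae Ce oe ze ce) s (x.q * 14 + 12) fun s' => SameTo 17 s s' ∧
      s'.arr 3 = relaxAt D (x.idx (moveCode x.n x.q σ z A C + 1) M o' z')
        (D (x.idx (σ + 1) M o z) - c) := by
  have hnB := hB.n_lt
  have hpB := hB.pow_le
  refine Ends.set_seq (by omega) (Ends.set_seq (by rw [hAe, hCe]; omega) ?_)
  rw [hAe, hCe]
  have hs : SameTo 17 s ((s.setReg 17 A).setReg 18 C) :=
    (SameTo.setReg le_rfl _ _).trans (SameTo.setReg (by norm_num) _ _)
  have h1 := h.of_same hs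
  refine (Ends.seq (k' := 4) ((scanProg_spec h1.n h1.q h1.p h1.z h1.σ (by simp) (by simp) hA hC
    (by omega) hpB hB.q_le (by omega)).mono le_rfl ?_)).mono (by omega) fun _ h => h
  rintro s' ⟨hf, ha, h21, h23⟩
  have hs' : SameTo 17 s s' := hs.trans ⟨fun r hr => hf r (by omega), fun a _ => by rw [ha]⟩
  have h2 := h.of_same hs'
  have hlt := moveCode_lt (q := x.q) (σ := σ) (z := z) hA hC
  refine (relaxProg_spec (D := D) (j := x.idx (moveCode x.n x.q σ z A C + 1) M o' z')
    (v := D (x.idx (σ + 1) M o z) - c) ?_ ?_ ?_ ?_ ?_).mono le_rfl ?_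
  · simp only [idxExpr, val_add, val_mul, val_reg, val_const, h2.n, h2.E, h2.M, h21, hoe s' hs',
      hze s' hs']
    rfl
  · simp only [val_sub, val_load, val_reg, setReg_arr, ha, hD]
    rw [hce _ (hs'.trans (SameTo.setReg (by norm_num) _ _)) (by simpa using h23)]
    simp [h2.src]
  · simp [ha, hD]
  · exact (x.idx_lt hlt hM ho hz).le.trans hB.size
  · exact (Nat.sub_le _ _).trans ((hDn _).trans hnB)
  · rintro s'' ⟨h3, h4⟩
    exact ⟨hs'.trans (h3.mono (by norm_num)), h4⟩

/-! ### The program: one step -/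

theorem Ctx.moves_le (x : Ctx) (σ M o z p : ℕ) {D : ℕ → ℕ} (hD : ∀ i, D i ≤ x.n + 1) (i : ℕ) :
    x.moves σ M o z p D i ≤ x.n + 1 := by
  have key : ∀ {D : ℕ → ℕ} {j v c : ℕ}, (∀ i, D i ≤ x.n + 1) →
      ∀ i, relaxAt D j (D v - c) i ≤ x.n + 1 :=
    fun hD => relaxAt_le hD ((Nat.sub_le _ _).trans (hD _))
  exact key (key (key (key hD))) i

theorem Ctx.grow_le (x : Ctx) (M o z p : ℕ) {D : ℕ → ℕ} (hD : ∀ i, D i ≤ x.n + 1) (i : ℕ) :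
    x.grow M o z p D i ≤ x.n + 1 :=
  relaxAt_le hD ((Nat.sub_le _ _).trans (hD _)) i

theorem Ctx.join_le (x : Ctx) (σ M o z M' : ℕ) {D : ℕ → ℕ} (hD : ∀ i, D i ≤ x.n + 1) (i : ℕ) :
    x.join σ M o z M' D i ≤ x.n + 1 := by
  refine relaxAt_le hD ?_ i
  have h1 := hD (x.idx σ M o z)
  have h2 := hD (x.idx 0 M' 0 z)
  omega

theorem Ctx.pass_le (x : Ctx) (σ M o z p M' : ℕ) {D : ℕ → ℕ} (hD : ∀ i, D i ≤ x.n + 1) (i : ℕ) :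
    x.pass σ M o z p M' D i ≤ x.n + 1 := by
  refine x.join_le _ _ _ _ _ (fun i => ?_) i
  split_ifs
  exacts [x.grow_le _ _ _ _ hD i, x.moves_le _ _ _ _ _ hD i]

/-- The weight of a vertex. -/
def weightExpr (u : Expr) : Expr := (Expr.load 1 u + .load 2 u).same (.const 0)

/-- The price for occupying the vertex in register `11`. -/
def enterExpr : Expr := (Expr.reg 23).same (.const 0) * weightExpr (.reg 11)

/-- The price for using the edge from `u` to `v`. -/
def edgeExpr (u v : Expr) : Expr :=
  (.const 1 - .load 0 (u * .reg 0 + v)) * (.reg 0 + .const 1)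

/-- The value of `e` if the mask is empty, and that of `f` otherwise. -/
def ifEmpty (e f : Expr) : Expr :=
  (Expr.reg 15).same (.const 0) * e + (.const 1 - (Expr.reg 15).same (.const 0)) * f

theorem ifEmpty_val (e f : Expr) (s : State) :
    (ifEmpty e f).val s = if s.reg 15 = 0 then e.val s else f.val s := by
  by_cases h : s.reg 15 = 0 <;> simp [ifEmpty, h]

theorem weightExpr_val {x : Ctx} {σ M o z p M' : ℕ} {s : State} (h : Loaded x σ M o z p M' s)
    (u : Expr) : (weightExpr u).val s = x.weight (u.val s) := by
  simp only [weightExpr, val_same, val_add, val_load, val_const, h.root, h.term, Ctx.weight]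

theorem enterExpr_val {x : Ctx} {σ M o z p M' : ℕ} {s : State}
    (h : Loaded x (σ + 1) M o z p M' s) (h23 : s.reg 23 = occCount x.n x.q σ p) :
    enterExpr.val s = x.enter σ p := by
  simp only [enterExpr, val_mul, val_same, val_reg, val_const, weightExpr_val h, h23, h.p,
    Ctx.enter]

theorem edgeExpr_val {x : Ctx} {σ M o z p M' : ℕ} {s : State} (h : Loaded x σ M o z p M' s)
    (u v : Expr) : (edgeExpr u v).val s = edgeCost x.n (x.adj (u.val s * x.n + v.val s)) := by
  simp only [edgeExpr, val_mul, val_sub, val_load, val_reg, val_const, val_add, h.n, h.adj,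
    edgeCost]

/-- The moves of the tokens. -/
def movesProg : Prog :=
  .seq (tokenProg (.reg 13) (.reg 13) (.reg 11) (.reg 11)
    ((Expr.reg 23).same (.const 0) * (.reg 0 + .const 1))) <|
  .seq (tokenProg (.reg 11) (ifEmpty (.reg 11) (.reg 13)) (ifEmpty (.reg 11) (.reg 14)) (.reg 11)
    (enterExpr + edgeExpr (.reg 13) (.reg 11))) <|
  .seq (tokenProg (.reg 13) (.reg 11) (.reg 14) (.reg 13)
    (enterExpr + edgeExpr (.reg 11) (.reg 13) +
      (Expr.reg 15).same (.const 0) * (.reg 0 + .const 1))) <|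
  tokenProg (.reg 13) (.reg 14) (.reg 14) (.reg 13) (.const 0)

/-- The extension of an out-tree. -/
def growProg : Prog :=
  relaxProg (idxExpr (.const 0) (.reg 15) (.reg 14) (.reg 11))
    (.load 3 (.reg 12) - (weightExpr (.reg 13) + edgeExpr (.reg 11) (.reg 13)))

/-- The combination of an item with an out-tree. -/
def joinProg : Prog :=
  relaxProg (idxExpr (.reg 16) (.load 4 (.reg 15 * .reg 2 + .reg 10)) (.reg 14) (.reg 13))
    (.load 3 (.reg 12) + .load 3 (.reg 10 * .reg 0 * .reg 0 + .reg 13) - (.reg 0 + .const 1))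

section Spec

variable {x : Ctx} {B σ M o z p M' : ℕ} {s : State} {D : ℕ → ℕ}

theorem movesProg_spec (hB : x.Bound B) (h : Loaded x (σ + 1) M o z p M' s) (hD : s.arr 3 = D)
    (hDn : ∀ i, D i ≤ x.n + 1) (hσ : σ < x.n ^ (x.q + x.q)) (hM : M < x.E) (ho : o < x.n)
    (hz : z < x.n) (hp : p < x.n) :
    Ends B movesProg s (x.q * 56 + 48) fun s' => SameTo 17 s s' ∧
      s'.arr 3 = x.moves σ M o z p D := by
  have key : ∀ {D : ℕ → ℕ} {j v c : ℕ}, (∀ i, D i ≤ x.n + 1) →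
      ∀ i, relaxAt D j (D v - c) i ≤ x.n + 1 :=
    fun hD => relaxAt_le hD ((Nat.sub_le _ _).trans (hD _))
  unfold movesProg
  refine Ends.mono (k := x.q * 14 + 12 + (x.q * 14 + 12 + (x.q * 14 + 12 + (x.q * 14 + 12))))
    (Ends.seq ?_) (by omega) fun _ h => h
  refine (tokenProg_spec (A := z) (C := z) (o' := p) (z' := p)
    (c := (if occCount x.n x.q σ p = 0 then 1 else 0) * (x.n + 1)) hB h hD hDn hσ hM hz hz hp hp
    ?_ ?_ ?_ ?_ ?_).mono le_rfl ?_
  · simp [h.z]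
  · simp [h.z]
  · exact fun s' hs => (h.of_same hs).p
  · exact fun s' hs => (h.of_same hs).p
  · intro s' hs h23
    simp only [val_mul, val_same, val_reg, val_const, val_add, h23, (h.of_same hs).n]
  rintro s₁ ⟨hs₁, hD₁⟩
  have h₁ := h.of_same hs₁
  refine Ends.seq ?_
  refine (tokenProg_spec (A := p) (C := if M = 0 then p else z) (o' := if M = 0 then p else o)
    (z' := p) (c := x.enter σ p + edgeCost x.n (x.adj (z * x.n + p))) hB h₁ hD₁ (key hDn) hσ hM hp
    (by split_ifs <;> assumption) (by split_ifs <;> assumption) hp ?_ ?_ ?_ ?_ ?_).mono le_rfl ?_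
  · simp [h₁.p]
  · simp [ifEmpty_val, h₁.p, h₁.M, h₁.z]
  · intro s' hs
    simp [ifEmpty_val, (h₁.of_same hs).p, (h₁.of_same hs).M, (h₁.of_same hs).o]
  · exact fun s' hs => (h₁.of_same hs).p
  · intro s' hs h23
    rw [val_add, enterExpr_val (h₁.of_same hs) h23, edgeExpr_val (h₁.of_same hs)]
    simp [(h₁.of_same hs).p, (h₁.of_same hs).z]
  rintro s₂ ⟨hs₂, hD₂⟩
  have h₂ := h₁.of_same hs₂
  refine Ends.seq ?_
  refine (tokenProg_spec (A := z) (C := p) (o' := o) (z' := z)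
    (c := x.enter σ p + edgeCost x.n (x.adj (p * x.n + z)) +
      (if M = 0 then 1 else 0) * (x.n + 1)) hB h₂ hD₂ (key (key hDn)) hσ hM hz hp ho hz
    ?_ ?_ ?_ ?_ ?_).mono le_rfl ?_
  · simp [h₂.z]
  · simp [h₂.p]
  · exact fun s' hs => (h₂.of_same hs).o
  · exact fun s' hs => (h₂.of_same hs).z
  · intro s' hs h23
    rw [val_add, val_add, enterExpr_val (h₂.of_same hs) h23, edgeExpr_val (h₂.of_same hs)]
    simp [(h₂.of_same hs).p, (h₂.of_same hs).z, (h₂.of_same hs).M, (h₂.of_same hs).n]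
  rintro s₃ ⟨hs₃, hD₃⟩
  have h₃ := h₂.of_same hs₃
  refine (tokenProg_spec (A := z) (C := o) (o' := o) (z' := z) (c := 0) hB h₃ hD₃
    (key (key (key hDn))) hσ hM hz ho ho hz ?_ ?_ ?_ ?_ ?_).mono le_rfl ?_
  · simp [h₃.z]
  · simp [h₃.o]
  · exact fun s' hs => (h₃.of_same hs).o
  · exact fun s' hs => (h₃.of_same hs).z
  · exact fun s' hs _ => rfl
  rintro s₄ ⟨hs₄, hD₄⟩
  exact ⟨((hs₁.trans hs₂).trans hs₃).trans hs₄, hD₄⟩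

theorem growProg_spec (hB : x.Bound B) (h : Loaded x 0 M o z p M' s) (hD : s.arr 3 = D)
    (hDn : ∀ i, D i ≤ x.n + 1) (hM : M < x.E) (ho : o < x.n) (hp : p < x.n) :
    Ends B growProg s 4 fun s' => SameTo 17 s s' ∧ s'.arr 3 = x.grow M o z p D := by
  have h' := h.of_same (s' := s.setReg 26 (x.idx 0 M o p)) (SameTo.setReg (by norm_num) _ _)
  refine (relaxProg_spec (D := D) (j := x.idx 0 M o p) ?_ ?_ hD
    ((x.idx_lt (Nat.zero_le _) hM ho hp).le.trans hB.size)
    (((Nat.sub_le _ _).trans (hDn (x.idx 0 M o z))).trans hB.n_lt)).mono le_rfl fun s' hs =>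
      ⟨hs.1.mono (by norm_num), hs.2⟩
  · simp only [idxExpr, val_add, val_mul, val_reg, val_const, h.n, h.E, h.M, h.o, h.p]
    rfl
  · rw [val_sub, val_add, weightExpr_val h', edgeExpr_val h']
    simp [h.src, h.p, h.z, hD]

theorem joinProg_spec (hB : x.Bound B) (h : Loaded x σ M o z p M' s) (hD : s.arr 3 = D)
    (hDn : ∀ i, D i ≤ x.n + 1) (hσ : σ ≤ x.n ^ (x.q + x.q)) (ho : o < x.n) (hz : z < x.n)
    (hU : x.union (M * x.E + M') < x.E) :
    Ends B joinProg s 4 fun s' => SameTo 17 s s' ∧ s'.arr 3 = x.join σ M o z M' D := by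
  refine (relaxProg_spec (D := D) (j := x.idx σ (x.union (M * x.E + M')) o z)
    (v := D (x.idx σ M o z) + D (x.idx 0 M' 0 z) - (x.n + 1)) ?_ ?_ hD
    ((x.idx_lt hσ hU ho hz).le.trans hB.size) ?_).mono le_rfl fun s' hs =>
      ⟨hs.1.mono (by norm_num), hs.2⟩
  · simp only [idxExpr, val_add, val_mul, val_reg, val_load, h.n, h.E, h.M, h.o, h.z, h.σ, h.M',
      h.union]
    rfl
  · simp [h.src, h.z, h.n, h.M', hD, Ctx.idx_zero]
  · have h1 := hDn (x.idx σ M o z)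
    have h2 := hDn (x.idx 0 M' 0 z)
    have h3 := hB.n_lt
    omega

/-- One step of the dynamic program; its number modulo the number in register `4` is decoded
first. -/
def stepProg : Prog :=
  .seq (.set 12 ((Expr.reg 5).rem (.reg 4))) <|
  .seq (.set 10 ((Expr.reg 12).rem (.reg 2))) <|
  .seq (.set 12 (.reg 12 / .reg 2)) <|
  .seq (.set 11 ((Expr.reg 12).rem (.reg 0))) <|
  .seq (.set 12 (.reg 12 / .reg 0)) <|
  .seq (.set 13 ((Expr.reg 12).rem (.reg 0))) <|
  .seq (.set 16 (.reg 12 / .reg 0)) <|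
  .seq (.set 14 ((Expr.reg 16).rem (.reg 0))) <|
  .seq (.set 16 (.reg 16 / .reg 0)) <|
  .seq (.set 15 ((Expr.reg 16).rem (.reg 2))) <|
  .seq (.set 16 (.reg 16 / .reg 2)) <|
  .seq (.cond (.reg 16) movesProg growProg) <|
  .seq joinProg <|
  .set 5 (.reg 5 + .const 1)

/-- The registers and arrays hold the constants of the dynamic program. -/
structure Ready (x : Ctx) (s : State) : Prop where
  n : s.reg 0 = x.n
  q : s.reg 1 = x.q
  E : s.reg 2 = x.E
  adj : s.arr 0 = x.adj
  root : s.arr 1 = x.root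
  term : s.arr 2 = x.term
  union : s.arr 4 = x.union

theorem stepProg_spec {j Y : ℕ} (hB : x.Bound B) (h : Ready x s) (h4 : s.reg 4 = Y)
    (h5 : s.reg 5 = j) (hY : Y = (x.n ^ (x.q + x.q) + 1) * x.E * x.n * x.n * x.n * x.E)
    (hn : 0 < x.n) (hj : j + 1 ≤ B) (hD : s.arr 3 = D) (hDn : ∀ i, D i ≤ x.n + 1)
    (hU : ∀ M < x.E, ∀ M' < x.E, x.union (M * x.E + M') < x.E) :
    Ends B stepProg s (x.q * 56 + 65) fun s' => (∀ r < 10, r ≠ 5 → s'.reg r = s.reg r) ∧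
      (∀ a, a ≠ 3 → s'.arr a = s.arr a) ∧ s'.reg 5 = j + 1 ∧ s'.arr 3 = x.passAt (j % Y) D := by
  have hE : 0 < x.E := hB.one_le
  have hYpos : 0 < Y := by rw [hY]; positivity
  set y := j % Y with hy
  have hyY : y < Y := Nat.mod_lt _ hYpos
  have hyB : y ≤ B := (Nat.mod_le _ _).trans (by omega)
  have hmod : ∀ {a b : ℕ}, a ≤ B → a % b ≤ B := fun h => (Nat.mod_le _ _).trans h
  have hdiv : ∀ {a b : ℕ}, a ≤ B → a / b ≤ B := fun h => (Nat.div_le_self _ _).trans h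
  unfold stepProg
  refine Ends.mono (k := x.q * 56 + 54 + 11) ?_ (by omega) fun _ h => h
  refine Ends.set_seq (by simpa [h4, h5] using hyB) ?_
  refine Ends.set_seq (by simpa [h4, h5, h.E] using hmod hyB) ?_
  refine Ends.set_seq (by simpa [h4, h5, h.E] using hdiv hyB) ?_
  refine Ends.set_seq (by simpa [h4, h5, h.E, h.n] using hmod (hdiv hyB)) ?_
  refine Ends.set_seq (by simpa [h4, h5, h.E, h.n] using hdiv (hdiv hyB)) ?_
  refine Ends.set_seq (by simpa [h4, h5, h.E, h.n] using hmod (hdiv (hdiv hyB))) ?_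
  refine Ends.set_seq (by simpa [h4, h5, h.E, h.n] using hdiv (hdiv (hdiv hyB))) ?_
  refine Ends.set_seq (by simpa [h4, h5, h.E, h.n] using hmod (hdiv (hdiv (hdiv hyB)))) ?_
  refine Ends.set_seq (by simpa [h4, h5, h.E, h.n] using hdiv (hdiv (hdiv (hdiv hyB)))) ?_
  refine Ends.set_seq (by simpa [h4, h5, h.E, h.n] using hmod (hdiv (hdiv (hdiv (hdiv hyB))))) ?_
  refine Ends.set_seq (by simpa [h4, h5, h.E, h.n] using hdiv (hdiv (hdiv (hdiv (hdiv hyB))))) ?_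
  generalize hs₀ : State.setReg _ 16 _ = s₀
  have e1 : ∀ r < 10, s₀.reg r = s.reg r := by
    intro r hr
    rw [← hs₀]
    simp only [setReg_reg]
    rw [if_neg (by omega), if_neg (by omega), if_neg (by omega), if_neg (by omega),
      if_neg (by omega), if_neg (by omega), if_neg (by omega), if_neg (by omega),
      if_neg (by omega), if_neg (by omega), if_neg (by omega)]
  have e2 : s₀.arr = s.arr := by rw [← hs₀]; rfl
  set S := y / x.E / x.n with hS
  set σ := S / x.n / x.n / x.E with hσdef
  set M := S / x.n / x.n % x.E with hMdef
  set o := S / x.n % x.n with hodef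
  set z := S % x.n with hzdef
  set p := y / x.E % x.n with hpdef
  set M' := y % x.E with hM'def
  have hidx : S = x.idx σ M o z := by
    rw [Ctx.idx, hσdef, hMdef, Nat.div_add_mod', hodef, Nat.div_add_mod', hzdef, Nat.div_add_mod']
  have hL : Loaded x σ M o z p M' s₀ := by
    constructor
    · rw [e1 _ (by norm_num), h.n]
    · rw [e1 _ (by norm_num), h.q]
    · rw [e1 _ (by norm_num), h.E]
    · rw [← hs₀]; simp [h4, h5, h.E, hy, hM'def]
    · rw [← hs₀]; simp [h4, h5, h.E, h.n, hy, hpdef]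
    · rw [← hidx, ← hs₀]; simp [h4, h5, h.E, h.n, hy, hS]
    · rw [← hs₀]; simp [h4, h5, h.E, h.n, hy, hS, hzdef]
    · rw [← hs₀]; simp [h4, h5, h.E, h.n, hy, hS, hodef]
    · rw [← hs₀]; simp [h4, h5, h.E, h.n, hy, hS, hMdef]
    · rw [← hs₀]; simp [h4, h5, h.E, h.n, hy, hS, hσdef]
    · rw [e2, h.adj]
    · rw [e2, h.root]
    · rw [e2, h.term]
    · rw [e2, h.union]
  have hMlt : M < x.E := Nat.mod_lt _ hE
  have holt : o < x.n := Nat.mod_lt _ hn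
  have hzlt : z < x.n := Nat.mod_lt _ hn
  have hplt : p < x.n := Nat.mod_lt _ hn
  have hM'lt : M' < x.E := Nat.mod_lt _ hE
  have hσle : σ ≤ x.n ^ (x.q + x.q) := by
    refine Nat.lt_succ_iff.1 ?_
    rw [hσdef, hS]
    refine Nat.div_lt_of_lt_mul (Nat.div_lt_of_lt_mul (Nat.div_lt_of_lt_mul
      (Nat.div_lt_of_lt_mul (Nat.div_lt_of_lt_mul ?_))))
    refine hyY.trans_eq ?_
    rw [hY, Nat.succ_eq_add_one]
    ring
  have hpass : x.passAt y D = x.join σ M o z M'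
      (if σ = 0 then x.grow M o z p D else x.moves (σ - 1) M o z p D) := rfl
  refine (Ends.seq (k := x.q * 56 + 49) (k' := 5) ?_).mono (by omega) fun _ h => h
  refine Ends.mono (k := 1 + (x.q * 56 + 48)) (P := fun s' => SameTo 17 s₀ s' ∧ s'.arr 3 =
    (if σ = 0 then x.grow M o z p D else x.moves (σ - 1) M o z p D)) (Ends.cond ?_ ?_)
    (by omega) ?_
  · intro h16
    rw [val_reg, hL.σ] at h16
    obtain ⟨τ, hτ⟩ := Nat.exists_eq_succ_of_ne_zero h16
    rw [if_neg h16]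
    rw [hτ] at hL hσle ⊢
    exact movesProg_spec hB hL (by rw [e2, hD]) hDn hσle hMlt holt hzlt hplt
  · intro h16
    rw [val_reg, hL.σ] at h16
    rw [if_pos h16]
    rw [h16] at hL
    exact (growProg_spec hB hL (by rw [e2, hD]) hDn hMlt holt hplt).mono (by omega) fun _ h => h
  rintro s₁ ⟨hs₁, hD₁⟩
  refine Ends.seq (k := 4) (k' := 1) ?_
  refine (joinProg_spec hB (hL.of_same hs₁) hD₁ ?_ hσle holt hzlt
    (hU _ hMlt _ hM'lt)).mono le_rfl ?_
  · intro i
    split_ifs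
    exacts [x.grow_le _ _ _ _ hDn i, x.moves_le _ _ _ _ _ hDn i]
  rintro s₂ ⟨hs₂, hD₂⟩
  have hs : SameTo 17 s₀ s₂ := hs₁.trans hs₂
  have h5' : s₂.reg 5 = j := by rw [hs.1 _ (by norm_num), e1 _ (by norm_num), h5]
  refine Ends.set (by simpa [h5'] using hj) ⟨fun r hr hr5 => ?_, fun a ha => ?_, by simp [h5'], ?_⟩
  · rw [setReg_reg, if_neg hr5, hs.1 r (by omega), e1 r hr]
  · rw [setReg_arr, hs.2 a ha, e2]
  · rw [setReg_arr, hD₂, hpass]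

end Spec

/-! ### The program: preparation -/

/-- The number of vertices below `j` that are marked by `c`. -/
def rank (c : ℕ → ℕ) (j : ℕ) : ℕ := Nat.count (fun v => c v ≠ 0) j

/-- The `i`-th vertex that is marked by `c`. -/
noncomputable def marked (c : ℕ → ℕ) (i : ℕ) : ℕ := Nat.nth (fun v => c v ≠ 0) i

theorem rank_succ (c : ℕ → ℕ) (j : ℕ) : rank c (j + 1) = rank c j + if c j ≠ 0 then 1 else 0 :=
  Nat.count_succ _ _

theorem rank_mono (c : ℕ → ℕ) {i j : ℕ} (h : i ≤ j) : rank c i ≤ rank c j := Nat.count_monotone _ h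

theorem rank_le (c : ℕ → ℕ) (j : ℕ) : rank c j ≤ j := Nat.count_le _

theorem marked_rank {c : ℕ → ℕ} {j : ℕ} (h : c j ≠ 0) : marked c (rank c j) = j :=
  Nat.nth_count (p := fun v => c v ≠ 0) h

theorem marked_lt {c : ℕ → ℕ} {i j : ℕ} (h : i < rank c j) : marked c i < j :=
  Nat.nth_lt_of_lt_count h

/-- The table after the first `j` vertices have been read: it contains the trivial out-trees with
the artificial mask `1`, and those that consist of a terminal. The `i`-th terminal has mask
`2 ^ (i + 1)`. The artificial bit `0` allows to leave the empty mask, and thus to begin the second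
part of the game, when there is no terminal to be collected. -/
structure Seeded (n : ℕ) (term : ℕ → ℕ) (j : ℕ) (D : ℕ → ℕ) : Prop where
  le : ∀ i, D i ≤ n + 1
  sound : ∀ i, D i ≠ 0 → (∃ u < j, i = 1 * n * n + u) ∨
    ∃ u < j, term u ≠ 0 ∧ i = 2 ^ (rank term u + 1) * n * n + u
  start : ∀ u < j, n + 1 ≤ D (1 * n * n + u)
  term : ∀ u < j, term u ≠ 0 →
    n + 1 ≤ D (2 ^ (rank term u + 1) * n * n + u)

theorem setArr_eq_relaxAt {s : State} {D : ℕ → ℕ} {j v : ℕ} (hD : s.arr 3 = D)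
    (hv : ∀ i, D i ≤ v) : (s.setArr 3 j v).arr 3 = relaxAt D j v := by
  rw [setArr_arr_self, hD]
  funext i
  rw [relaxAt, max_eq_right (hv j)]

theorem Seeded.succ {n j : ℕ} {term D D' : ℕ → ℕ} (h : Seeded n term j D)
    (hD' : D' = (if term j ≠ 0 then
      relaxAt D (2 ^ (rank term j + 1) * n * n + j) (n + 1) else D)) :
    Seeded n term (j + 1) (relaxAt D' (1 * n * n + j) (n + 1)) := by
  have hle : ∀ i, D i ≤ D' i := by
    intro i
    rw [hD']
    split_ifs
    exacts [le_relaxAt _ _ _ _, le_rfl]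
  refine ⟨relaxAt_le (fun i => ?_) le_rfl, fun i hi => ?_, fun u hu => ?_, fun u hu hut => ?_⟩
  · rw [hD']
    split_ifs
    exacts [relaxAt_le h.le le_rfl i, h.le i]
  · by_cases hi1 : i = 1 * n * n + j
    · exact .inl ⟨j, by omega, hi1⟩
    rw [relaxAt, if_neg hi1, hD'] at hi
    have hlift : D i ≠ 0 → (∃ u < j + 1, i = 1 * n * n + u) ∨ ∃ u < j + 1, term u ≠ 0 ∧
        i = 2 ^ (rank term u + 1) * n * n + u := by
      intro hi
      rcases h.sound i hi with ⟨u, hu, h1⟩ | ⟨u, hu, h1⟩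
      exacts [.inl ⟨u, by omega, h1⟩, .inr ⟨u, by omega, h1⟩]
    split_ifs at hi with hj
    · by_cases hi2 : i = 2 ^ (rank term j + 1) * n * n + j
      · exact .inr ⟨j, by omega, hj, hi2⟩
      · rw [relaxAt, if_neg hi2] at hi
        exact hlift hi
    · exact hlift hi
  · rcases Nat.lt_succ_iff_lt_or_eq.1 hu with hu | rfl
    · exact (h.start u hu).trans ((hle _).trans (le_relaxAt _ _ _ _))
    · exact le_relaxAt_self _ _ _
  · rcases Nat.lt_succ_iff_lt_or_eq.1 hu with hu | rfl
    · exact (h.term u hu hut).trans ((hle _).trans (le_relaxAt _ _ _ _))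
    · refine le_trans ?_ (le_relaxAt _ _ _ _)
      rw [hD', if_pos hut]
      exact le_relaxAt_self _ _ _

/-- Register a root: registers `7` and `8` receive another digit. -/
def rootProg : Prog :=
  .seq (.set 7 (.reg 7 + .reg 5 * .reg 6)) <| .seq (.set 6 (.reg 6 * .reg 0)) <|
  .seq (.set 8 (.reg 8 * .reg 0 + .const 1)) <| .seq (.set 1 (.reg 1 + .const 1)) <|
  .set 9 (.reg 5)

/-- Register a terminal. -/
def termProg : Prog :=
  .seq (.store 3 (.reg 2 * .reg 0 * .reg 0 + .reg 5) (.reg 0 + .const 1)) <|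
  .set 2 (.reg 2 * .const 2)

/-- Read a vertex. -/
def readProg : Prog :=
  .seq (.cond (.load 1 (.reg 5)) rootProg .skip) <|
  .seq (.cond (.load 2 (.reg 5)) termProg .skip) <|
  .seq (.store 3 (.const 1 * .reg 0 * .reg 0 + .reg 5) (.reg 0 + .const 1)) <|
  .set 5 (.reg 5 + .const 1)

/-- The situation after the first `j` vertices have been read. -/
structure ReadInv (n : ℕ) (adj root term : ℕ → ℕ) (j : ℕ) (s : State) : Prop where
  size : s.reg 0 = n
  roots : s.reg 1 = rank root j
  masks : s.reg 2 = 2 ^ (rank term j + 1)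
  pos : s.reg 5 = j
  pw : s.reg 6 = n ^ rank root j
  code : s.reg 7 = enc n (rank root j) (marked root)
  rep : s.reg 8 = enc n (rank root j) fun _ => 1
  last : rank root j ≠ 0 → root (s.reg 9) ≠ 0 ∧ s.reg 9 < j
  adjArr : s.arr 0 = adj
  rootArr : s.arr 1 = root
  termArr : s.arr 2 = term
  union : s.arr 4 = fun _ => 0
  seeded : Seeded n term j (s.arr 3)

theorem enc_one_succ (n k : ℕ) : enc n (k + 1) (fun _ => 1) = enc n k (fun _ => 1) * n + 1 := by
  rw [enc, Finset.sum_range_succ', enc, Finset.sum_mul]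
  simp [pow_succ]

theorem readProg_spec {B n j : ℕ} {adj root term : ℕ → ℕ} {s : State}
    (h : ReadInv n adj root term j s) (hj : j < n) (hn : n + 1 ≤ B)
    (hroot : n ^ (rank root n) ≤ B)
    (hterm : 2 ^ (rank term n + 1) ≤ B) :
    Ends B readProg s 12 (ReadInv n adj root term (j + 1)) := by
  have hn0 : 0 < n := by omega
  unfold readProg
  refine Ends.mono (k := 1 + 5 + (1 + 2 + (1 + 1)))
    (Ends.seq (Ends.mono (k := 1 + 5) (P := fun s' => s'.reg 0 = n ∧
      s'.reg 1 = rank root (j + 1) ∧ s'.reg 2 = s.reg 2 ∧ s'.reg 5 = j ∧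
      s'.reg 6 = n ^ rank root (j + 1) ∧
      s'.reg 7 = enc n (rank root (j + 1)) (marked root) ∧
      s'.reg 8 = enc n (rank root (j + 1)) (fun _ => 1) ∧
      (rank root (j + 1) ≠ 0 → root (s'.reg 9) ≠ 0 ∧ s'.reg 9 < j + 1) ∧ s'.arr = s.arr)
      (Ends.cond (k := 5) (fun hr => ?_) fun hr => ?_) le_rfl ?_)) (by norm_num) fun _ h => h
  · simp only [val_load, val_reg, h.pos, h.rootArr] at hr
    have hc : rank root (j + 1) =
        rank root j + 1 := by rw [rank_succ, if_pos hr]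
    have hnth : marked root (rank root j) = j :=
      marked_rank hr
    have hcn : rank root (j + 1) ≤ rank root n :=
      rank_mono _ (by omega)
    have hpw : n ^ rank root (j + 1) ≤ B :=
      (Nat.pow_le_pow_right hn0 hcn).trans hroot
    have hq : rank root (j + 1) ≤ B :=
      ((rank_le _ _).trans (by omega)).trans hn
    have e1 : enc n (rank root j) (marked root) +
        j * n ^ rank root j =
        enc n (rank root (j + 1)) (marked root) := by
      rw [hc, enc_succ, hnth]
    have hdig : ∀ i < rank root (j + 1),
        marked root i < n :=
      fun i hi => (marked_lt hi).trans_le (by omega)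
    have b1 := (enc_lt hdig).le.trans hpw
    have e2 : enc n (rank root j) (fun _ => 1) * n + 1 =
        enc n (rank root (j + 1)) fun _ => 1 := by rw [hc, enc_one_succ]
    have b2 : enc n (rank root (j + 1)) (fun _ => 1) ≤ B := by
      rcases Nat.lt_or_ge 1 n with h1 | h1
      · exact (enc_lt fun _ _ => h1).le.trans hpw
      · obtain rfl : n = 1 := by omega
        simpa [enc] using hq
    refine Ends.set_seq (by simpa [h.code, h.pos, h.pw, e1] using b1) ?_
    refine Ends.set_seq (by simpa [h.size, h.pw, ← pow_succ, ← hc] using hpw) ?_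
    refine Ends.set_seq (by simpa [h.size, h.rep, e2] using b2) ?_
    refine Ends.set_seq (by simpa [h.roots, ← hc] using hq) ?_
    refine Ends.set (by simp [h.pos]; omega) ⟨?_, ?_, ?_, ?_, ?_, ?_, ?_, ?_, ?_⟩
    · simp [h.size]
    · simp [h.roots, hc]
    · simp
    · simp [h.pos]
    · simp [h.size, h.pw, ← pow_succ, ← hc]
    · simp [h.code, h.pos, h.pw, e1]
    · simp [h.size, h.rep, e2]
    · intro _
      simpa [h.pos] using hr
    · simp
  · simp only [val_load, val_reg, h.pos, h.rootArr] at hr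
    have hc : rank root (j + 1) = rank root j := by
      rw [rank_succ, if_neg (by simpa using hr), add_zero]
    rw [hc]
    exact (Ends.skip ⟨h.size, h.roots, rfl, h.pos, h.pw, h.code, h.rep,
      fun h9 => ⟨(h.last h9).1, (h.last h9).2.trans j.lt_succ_self⟩, rfl⟩).mono (by norm_num)
      fun _ h => h
  rintro s₁ ⟨h0, h1, h2, h5, h6, h7, h8, h9, ha⟩
  have hD := h.seeded.le
  refine Ends.seq (Ends.mono (k := 1 + 2) (P := fun s' => (∀ r, r ≠ 2 → s'.reg r = s₁.reg r) ∧
      s'.reg 2 = 2 ^ (rank term (j + 1) + 1) ∧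
      (∀ a, a ≠ 3 → s'.arr a = s.arr a) ∧ s'.arr 3 = (if term j ≠ 0 then relaxAt (s.arr 3)
        (2 ^ (rank term j + 1) * n * n + j) (n + 1) else s.arr 3))
    (Ends.cond (k := 2) (fun ht => ?_) fun ht => ?_) le_rfl ?_)
  · simp only [val_load, val_reg, h5, ha, h.termArr] at ht
    have hc : rank term (j + 1) =
        rank term j + 1 := by rw [rank_succ, if_pos ht]
    have hcn : rank term (j + 1) ≤ rank term n :=
      rank_mono _ (by omega)
    have hb : 2 ^ (rank term (j + 1) + 1) ≤ B :=
      (Nat.pow_le_pow_right (by norm_num) (by omega)).trans hterm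
    refine Ends.store_seq (by simpa [h0] using hn) ?_
    refine Ends.set (by simpa [h2, h.masks, ← pow_succ, ← hc] using hb) ⟨fun r hr => by simp [hr],
      by simp [h2, h.masks, ← pow_succ, ← hc], fun a ha3 => ?_, ?_⟩
    · rw [setReg_arr, setArr_arr_of_ne _ _ _ ha3, ha]
    · rw [setReg_arr, if_pos ht]
      simp only [val_add, val_mul, val_reg, val_const, h0, h2, h5, h.masks]
      exact setArr_eq_relaxAt (by rw [ha]) hD
  · simp only [val_load, val_reg, h5, ha, h.termArr] at ht
    refine (Ends.skip ⟨fun _ _ => rfl, ?_, fun a _ => by rw [ha], ?_⟩).mono (by norm_num)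
      fun _ h => h
    · rw [h2, h.masks, rank_succ, if_neg (by simpa using ht), add_zero]
    · rw [if_neg (by simpa using ht), ha]
  rintro s₂ ⟨hf, h2', ha', h3'⟩
  have hsd := h.seeded.succ h3'
  have hle : ∀ i, s₂.arr 3 i ≤ n + 1 := by
    intro i
    rw [h3']
    split_ifs
    exacts [relaxAt_le hD le_rfl i, hD i]
  have g0 := (hf 0 (by norm_num)).trans h0
  have g5 := (hf 5 (by norm_num)).trans h5
  refine Ends.store_seq (by simpa [g0] using hn) ?_
  refine Ends.set (by simp [g5]; omega) ?_
  have hf' : ∀ r, r ≠ 5 → r ≠ 2 → ∀ t a i v, ((s₂.setArr a i v).setReg 5 t).reg r = s₁.reg r := by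
    intro r h5 h2 t a i v
    simp only [setReg_reg, setArr_reg, if_neg h5, hf r h2]
  refine ⟨?_, ?_, ?_, ?_, ?_, ?_, ?_, ?_, ?_, ?_, ?_, ?_, ?_⟩
  · rw [hf' 0 (by norm_num) (by norm_num), h0]
  · rw [hf' 1 (by norm_num) (by norm_num), h1]
  · simp [h2']
  · simp [g5]
  · rw [hf' 6 (by norm_num) (by norm_num), h6]
  · rw [hf' 7 (by norm_num) (by norm_num), h7]
  · rw [hf' 8 (by norm_num) (by norm_num), h8]
  · rw [hf' 9 (by norm_num) (by norm_num)]
    exact h9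
  · rw [setReg_arr, setArr_arr_of_ne _ _ _ (by norm_num), ha' 0 (by norm_num), h.adjArr]
  · rw [setReg_arr, setArr_arr_of_ne _ _ _ (by norm_num), ha' 1 (by norm_num), h.rootArr]
  · rw [setReg_arr, setArr_arr_of_ne _ _ _ (by norm_num), ha' 2 (by norm_num), h.termArr]
  · rw [setReg_arr, setArr_arr_of_ne _ _ _ (by norm_num), ha' 4 (by norm_num), h.union]
  · rw [setReg_arr]
    simp only [val_add, val_mul, val_reg, val_const, g0, g5]
    rw [setArr_eq_relaxAt rfl hle]
    exact hsd

/-- One round of the computation of the unions of all pairs of masks. -/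
def unionProg : Prog :=
  .seq (.set 11 (.reg 5 / .reg 2)) <| .seq (.set 10 ((Expr.reg 5).rem (.reg 2))) <|
  .seq (.store 4 (.reg 5) (.const 2 * .load 4 (.reg 11 / .const 2 * .reg 2 + .reg 10 / .const 2) +
    ((Expr.reg 11).rem (.const 2) + (Expr.reg 10).rem (.const 2) -
      (Expr.reg 11).rem (.const 2) * (Expr.reg 10).rem (.const 2)))) <|
  .set 5 (.reg 5 + .const 1)

/-- The recursion behind `unionProg`: the union of two masks from that of their halves. -/
theorem lor_eq (a b : ℕ) :
    a ||| b = 2 * (a / 2 ||| b / 2) + (a % 2 + b % 2 - a % 2 * (b % 2)) := by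
  have h1 : (a ||| b) / 2 = a / 2 ||| b / 2 := Nat.or_div_two
  have h2 : (a ||| b) % 2 = a % 2 + b % 2 - a % 2 * (b % 2) := by
    have h3 : (a ||| b) % 2 = a % 2 ||| b % 2 := by
      simpa using Nat.or_mod_two_pow (a := a) (b := b) (n := 1)
    rw [h3]
    rcases Nat.mod_two_eq_zero_or_one a with ha | ha <;>
    rcases Nat.mod_two_eq_zero_or_one b with hb | hb <;>
    rw [ha, hb] <;> rfl
  rw [← h1, ← h2]
  omega

theorem unionProg_spec {B E t j : ℕ} {s : State} (hE : E = 2 ^ t) (h2 : s.reg 2 = E)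
    (h5 : s.reg 5 = j) (hj : j < E * E) (hB : E * E ≤ B) (hU0 : s.arr 4 0 = 0)
    (hU : ∀ a < E, ∀ b < E, a * E + b < j → s.arr 4 (a * E + b) = a ||| b) :
    Ends B unionProg s 4 fun s' => (∀ r < 10, r ≠ 5 → s'.reg r = s.reg r) ∧ s'.reg 5 = j + 1 ∧
      (∀ a, a ≠ 4 → s'.arr a = s.arr a) ∧ s'.arr 4 0 = 0 ∧
      ∀ a < E, ∀ b < E, a * E + b < j + 1 → s'.arr 4 (a * E + b) = a ||| b := by
  have hE0 : 0 < E := by rw [hE]; positivity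
  have hEB : E ≤ B := (Nat.le_mul_of_pos_left E hE0).trans hB
  set a := j / E with ha
  set b := j % E with hb
  have hab : a * E + b = j := Nat.div_add_mod' _ _
  have haE : a < E := Nat.div_lt_of_lt_mul hj
  have hbE : b < E := Nat.mod_lt _ hE0
  have hval : 2 * s.arr 4 (a / 2 * E + b / 2) + (a % 2 + b % 2 - a % 2 * (b % 2)) = a ||| b := by
    rw [lor_eq a b]
    congr 2
    rcases Nat.eq_zero_or_pos j with h0 | h0
    · have ha0 : a = 0 := by rw [ha, h0, Nat.zero_div]
      have hb0 : b = 0 := by rw [hb, h0, Nat.zero_mod]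
      simp [ha0, hb0, hU0]
    · refine hU _ (by omega) _ (by omega) ?_
      rcases Nat.eq_zero_or_pos a with h | h
      · rw [h] at hab ⊢
        omega
      · have : (a / 2 + 1) * E ≤ a * E := Nat.mul_le_mul_right E (by omega)
        rw [Nat.succ_mul] at this
        omega
  have hlt : a ||| b < E := by
    rw [hE] at haE hbE ⊢
    exact Nat.or_lt_two_pow haE hbE
  refine Ends.set_seq (by simp [h5, h2, ← ha]; omega) ?_
  refine Ends.set_seq (by simp [h5, h2, ← hb]; omega) ?_
  refine Ends.store_seq (by simp [h5, h2, ← ha, ← hb, hval]; omega) ?_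
  refine Ends.set (by simp [h5]; omega) ⟨fun r hr hr5 => ?_, by simp [h5], fun c hc => ?_, ?_, ?_⟩
  · simp only [setReg_reg, setArr_reg]
    rw [if_neg hr5, if_neg (by omega), if_neg (by omega)]
  · rw [setReg_arr, setArr_arr_of_ne _ _ _ hc]; rfl
  · simp only [setReg_arr, setArr_arr_self]
    simp only [val_add, val_mul, val_sub, val_div, val_rem, val_load, val_const, val_reg,
      setReg_reg, setReg_arr]
    norm_num only [if_true, if_false, h5, h2, ← ha, ← hb, hval]
    split_ifs with h0
    · have ha0 : a = 0 := by rw [ha, ← h0, Nat.zero_div]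
      have hb0 : b = 0 := by rw [hb, ← h0, Nat.zero_mod]
      rw [ha0, hb0]; rfl
    · exact hU0
  · intro a' ha' b' hb' hlt'
    simp only [setReg_arr, setArr_arr_self]
    simp only [val_add, val_mul, val_sub, val_div, val_rem, val_load, val_const, val_reg,
      setReg_reg, setReg_arr]
    norm_num only [if_true, if_false, h5, h2, ← ha, ← hb, hval]
    split_ifs with h0
    · have e1 : a' = a := by
        rw [ha, ← h0, mul_comm, Nat.mul_add_div hE0, Nat.div_eq_of_lt hb', add_zero]
      have e2 : b' = b := by rw [hb, ← h0, mul_comm, Nat.mul_add_mod, Nat.mod_eq_of_lt hb']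
      rw [e1, e2]
    · exact hU a' ha' b' hb' (by omega)

/-! ### The program: all parts together -/

/-- The number of different steps of the dynamic program. -/
def Ctx.period (x : Ctx) : ℕ := (x.n ^ (x.q + x.q) + 1) * x.E * x.n * x.n * x.n * x.E

/-- The table after `j` steps. -/
def Ctx.table (x : Ctx) (D : ℕ → ℕ) : ℕ → ℕ → ℕ
  | 0 => D
  | j + 1 => x.passAt (j % x.period) (x.table D j)

theorem Ctx.table_le (x : Ctx) {D : ℕ → ℕ} (hD : ∀ i, D i ≤ x.n + 1) (j i : ℕ) :
    x.table D j i ≤ x.n + 1 := by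
  induction j generalizing i with
  | zero => exact hD i
  | succ j ih => exact x.pass_le _ _ _ _ _ _ ih i

/-- All tokens are on their roots. -/
noncomputable def Ctx.startCode (x : Ctx) : ℕ :=
  enc x.n (x.q + x.q) fun i => marked x.root (if i < x.q then i else i - x.q)

/-- The properties of the initial table. -/
structure Ctx.Started (x : Ctx) (D : ℕ → ℕ) : Prop where
  le : ∀ i, D i ≤ x.n + 1
  sound : ∀ i, D i ≠ 0 → (∃ u < x.n, i = x.idx 0 1 0 u) ∨
    (∃ u < x.n, x.term u ≠ 0 ∧ i = x.idx 0 (2 ^ (rank x.term u + 1)) 0 u) ∨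
    ∃ u < x.n, x.root u ≠ 0 ∧ i = x.idx (x.startCode + 1) 0 u u
  start : ∀ u < x.n, x.n + 1 ≤ D (x.idx 0 1 0 u)
  term : ∀ u < x.n, x.term u ≠ 0 → x.n + 1 ≤ D (x.idx 0 (2 ^ (rank x.term u + 1)) 0 u)
  root : ∃ u < x.n, x.root u ≠ 0 ∧ x.n + 1 ≤ D (x.idx (x.startCode + 1) 0 u u)

/-- One round of the computation of the largest entry of the table that belongs to a final
position. -/
def bestProg : Prog :=
  .seq (.set 27 (.load 3 (idxExpr (.reg 5 * .reg 8 + .const 1) (.reg 2 - .const 1)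
    (.reg 5) (.reg 5)))) <|
  .seq (.cond ((Expr.reg 25).less (.reg 27)) (.set 25 (.reg 27)) .skip) <|
  .set 5 (.reg 5 + .const 1)

/-- The part of the program that sets up the table and the constants. -/
def setupProg : Prog :=
  .seq (.set 6 (.const 1)) <| .seq (.set 2 (.const 2)) <|
  .seq (.loop ((Expr.reg 5).less (.reg 0)) readProg) <|
  .seq (.set 7 (.reg 7 + .reg 7 * .reg 6)) <| .seq (.set 8 (.reg 8 + .reg 8 * .reg 6)) <|
  .seq (.set 6 (.reg 6 * .reg 6)) <|
  .seq (.set 4 ((.reg 6 + .const 1) * .reg 2 * .reg 0 * .reg 0 * .reg 0 * .reg 2)) <|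
  .seq (.set 3 (.reg 4 * (.const 49 * .reg 0 * .reg 0 * .reg 0 * .reg 0))) <|
  .seq (.store 3 (idxExpr (.reg 7 + .const 1) (.const 0) (.reg 9) (.reg 9))
    (.reg 0 + .const 1)) <|
  .seq (.set 5 (.const 0)) <|
  .loop ((Expr.reg 5).less (.reg 2 * .reg 2)) unionProg

/-- The algorithm. The number of steps in register `3` is `49 n⁴` times the number of different
steps: whatever the token game achieves in `49 n⁴` rounds has then been entered into the table. -/
def steinerProg : Prog :=
  .seq setupProg <| .seq (.set 5 (.const 0)) <|
  .seq (.loop ((Expr.reg 5).less (.reg 3)) stepProg) <|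
  .seq (.set 5 (.const 0)) <| .seq (.set 25 (.const 0)) <|
  .seq (.loop ((Expr.reg 5).less (.reg 0)) bestProg) <|
  .seq (.set 1 (.reg 0 + .const 1 - .reg 25)) <| .set 0 ((Expr.const 0).less (.reg 25))

/-- The number of vertices, roots, and masks; the last includes the artificial bit `0`. -/
noncomputable def ctxOf (n : ℕ) (adj root term union : ℕ → ℕ) : Ctx :=
  ⟨n, rank root n, 2 ^ (rank term n + 1), adj, root, term, union⟩

theorem enc_double {n k : ℕ} (d : ℕ → ℕ) :
    enc n (k + k) (fun i => d (if i < k then i else i - k)) = enc n k d + enc n k d * n ^ k := by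
  rw [enc_add, mul_comm (n ^ k)]
  congr 1
  · exact enc_congr fun i hi => by rw [if_pos hi]
  · congr 1
    exact enc_congr fun i hi => by rw [if_neg (by omega), Nat.add_sub_cancel_left]

/-- The union table is correct. -/
def Ctx.Unions (x : Ctx) : Prop := ∀ M < x.E, ∀ M' < x.E, x.union (M * x.E + M') = M ||| M'

theorem bounds_of_size {n q E N B : ℕ} (hn : 0 < n) (hE : 0 < E) (hN : 0 < N) (hq : q ≤ n)
    (hB : (N + 1) * E * n * n * n * E * (49 * n * n * n * n) = B) :
    (N + 1) * E * n * n ≤ B ∧ n + 1 ≤ B ∧ q + q ≤ B ∧ N ≤ B ∧ E * E ≤ B ∧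
      (N + 1) * E * n * n * n * E ≤ B ∧ N + N ≤ B := by
  have key : ∀ {a b : ℕ}, 0 < b → a ≤ a * b := fun hb => Nat.le_mul_of_pos_right _ hb
  have e1 : B = (N + 1) * E * n * n * (n * E * (49 * n * n * n * n)) := by rw [← hB]; ring
  have e2 : B = n * 49 * ((N + 1) * E * n * n * n * E * (n * n * n)) := by rw [← hB]; ring
  have e3 : B = N * 49 * (E * n * n * n * E * (n * n * n * n)) + 49 * (E * n * n * n * E *
    (n * n * n * n)) := by rw [← hB]; ring
  have e4 : B = E * E * ((N + 1) * n * n * n * (49 * n * n * n * n)) := by rw [← hB]; ring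
  have h1 : (N + 1) * E * n * n ≤ B := by rw [e1]; exact key (by positivity)
  have h2 : n * 49 ≤ B := by rw [e2]; exact key (by positivity)
  have h3 : N * 49 ≤ B := by rw [e3]; exact le_add_right (key (by positivity))
  have h4 : E * E ≤ B := by rw [e4]; exact key (by positivity)
  have h5 : (N + 1) * E * n * n * n * E ≤ B := by rw [← hB]; exact key (by positivity)
  exact ⟨h1, by omega, by omega, by omega, h4, h5, by omega⟩

theorem setupProg_spec {n : ℕ} {adj root term : ℕ → ℕ} {s : State} {P B : ℕ} (hn : 0 < n)
    (hq : rank root n ≠ 0) (h0 : ∀ r, s.reg r = if r = 0 then n else 0) (hadj : s.arr 0 = adj)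
    (hroot : s.arr 1 = root) (hterm : s.arr 2 = term) (h3 : s.arr 3 = fun _ => 0)
    (h4 : s.arr 4 = fun _ => 0) (hP : ∀ U, (ctxOf n adj root term U).period = P)
    (hB : P * (49 * n * n * n * n) = B) :
    Ends B setupProg s (n * 13 + 2 ^ (rank term n + 1) * 2 ^ (rank term n + 1) * 5 + 11) fun s' =>
      ∃ U, (ctxOf n adj root term U).Unions ∧ (ctxOf n adj root term U).Bound B ∧
        Ready (ctxOf n adj root term U) s' ∧ (ctxOf n adj root term U).Started (s'.arr 3) ∧
        s'.reg 3 = B ∧ s'.reg 4 = P ∧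
        s'.reg 8 = enc n (rank root n + rank root n) (fun _ => 1) := by
  set q := rank root n with hqdef
  set E := 2 ^ (rank term n + 1) with hEdef
  have hE0 : 0 < E := by rw [hEdef]; positivity
  have hP' : P = (n ^ (q + q) + 1) * E * n * n * n * E := (hP adj).symm
  have hpow : 0 < n ^ (q + q) := by positivity
  obtain ⟨b1, b2, b3, b4, b5, b6, b7⟩ := bounds_of_size (q := q) hn hE0 hpow (rank_le _ _)
    (by rw [← hP', hB])
  have hEB : E ≤ B := (Nat.le_mul_of_pos_left E hE0).trans b5
  have hE2 : 2 ≤ E := by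
    rw [hEdef, pow_succ]
    have : 0 < 2 ^ rank term n := by positivity
    omega
  have hpowq : n ^ q ≤ n ^ (q + q) := Nat.pow_le_pow_right hn (by omega)
  have hpow2 : n ^ q * n ^ q = n ^ (q + q) := (pow_add _ _ _).symm
  unfold setupProg
  refine Ends.mono
    (k := n * (12 + 1) + 1 + (E * E * (4 + 1) + 1 + 1 + 1 + 1 + 1 + 1 + 1 + 1) + 1 + 1) ?_
    (by omega) fun _ h => h
  refine Ends.set_seq (by simp; omega) (Ends.set_seq (by simp; omega) (Ends.seq ?_))
  refine (Ends.loop (I := ReadInv n adj root term) (fun j s' hj h => ⟨?_, readProg_spec h hj b2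
    (hpowq.trans b4) hEB⟩) (fun s' h => ?_) ?_).mono le_rfl ?_
  · simp [h.pos, h.size, hj]
  · simp [h.pos, h.size]
  · constructor <;> simp [h0, rank, hadj, hroot, hterm, h3, h4, enc]
    constructor <;> simp
  intro s₁ h
  have hdig : ∀ i < q, marked root i < n := fun i hi => marked_lt hi
  set σ := enc n q (marked root) with hσ
  have e1 : enc n (q + q) (fun i => marked root (if i < q then i else i - q)) = σ + σ * n ^ q :=
    enc_double _
  have hσlt : σ + σ * n ^ q < n ^ (q + q) := by
    rw [← e1]
    refine enc_lt fun i hi => ?_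
    split_ifs
    exacts [hdig _ (by omega), hdig _ (by omega)]
  set ρ := enc n q (fun _ => 1) with hρ
  have e2 : enc n (q + q) (fun _ => 1) = ρ + ρ * n ^ q := enc_double fun _ => 1
  have hρB : ρ + ρ * n ^ q ≤ B := by
    rw [← e2]
    rcases Nat.lt_or_ge 1 n with h1 | h1
    · exact (enc_lt fun _ _ => h1).le.trans b4
    · obtain rfl : n = 1 := by omega
      simpa [enc] using b3
  refine Ends.set_seq (by simp [h.code, h.pw, ← hσ, ← hqdef]; omega) ?_
  refine Ends.set_seq (by simpa [h.rep, h.pw] using hρB) ?_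
  refine Ends.set_seq (by simpa [h.pw, hpow2, ← hqdef] using b4) ?_
  refine Ends.set_seq (by simpa [h.pw, hpow2, h.size, h.masks, ← hqdef, ← hEdef] using b6) ?_
  refine Ends.set_seq (by
    simpa [h.pw, hpow2, h.size, h.masks, ← hqdef, ← hEdef, ← hP'] using hB.le) ?_
  refine Ends.store_seq (by simpa [h.size] using b2) ?_
  refine Ends.set_seq (by simp) ?_
  generalize hs₂ : State.setReg _ 5 _ = s₂
  have c0 : s₂.reg 0 = n := by rw [← hs₂]; simp [h.size]
  have c1 : s₂.reg 1 = q := by rw [← hs₂]; simp [h.roots, hqdef]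
  have c2 : s₂.reg 2 = E := by rw [← hs₂]; simp [h.masks, hEdef]
  have c3 : s₂.reg 3 = B := by
    rw [← hs₂]; simp [h.pw, hpow2, h.size, h.masks, ← hqdef, ← hEdef, ← hP', hB]
  have c4 : s₂.reg 4 = P := by
    rw [← hs₂]; simp [h.pw, hpow2, h.size, h.masks, ← hqdef, ← hEdef, ← hP']
  have c5 : s₂.reg 5 = 0 := by rw [← hs₂]; simp
  have c8 : s₂.reg 8 = ρ + ρ * n ^ q := by rw [← hs₂]; simp [h.pw, h.rep, hρ, hqdef]
  have a0 : s₂.arr 0 = adj := by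
    rw [← hs₂, setReg_arr, setArr_arr_of_ne _ _ _ (by norm_num)]; exact h.adjArr
  have a1 : s₂.arr 1 = root := by
    rw [← hs₂, setReg_arr, setArr_arr_of_ne _ _ _ (by norm_num)]; exact h.rootArr
  have a2 : s₂.arr 2 = term := by
    rw [← hs₂, setReg_arr, setArr_arr_of_ne _ _ _ (by norm_num)]; exact h.termArr
  have a4 : s₂.arr 4 = fun _ => 0 := by
    rw [← hs₂, setReg_arr, setArr_arr_of_ne _ _ _ (by norm_num)]; exact h.union
  have a3 : s₂.arr 3 = relaxAt (s₁.arr 3)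
      ((((σ + σ * n ^ q + 1) * E + 0) * n + s₁.reg 9) * n + s₁.reg 9) (n + 1) := by
    rw [← hs₂, setReg_arr]
    have hidx : ∀ D : ℕ → ℕ, ∀ s' : State, s'.arr 3 = D → (∀ i, D i ≤ n + 1) → s'.reg 0 = n →
        s'.reg 2 = E → s'.reg 7 = σ + σ * n ^ q → s'.reg 9 = s₁.reg 9 →
        (s'.setArr 3 ((idxExpr (.reg 7 + .const 1) (.const 0) (.reg 9) (.reg 9)).val s')
          ((Expr.reg 0 + .const 1).val s')).arr 3 = relaxAt D
          ((((σ + σ * n ^ q + 1) * E + 0) * n + s₁.reg 9) * n + s₁.reg 9) (n + 1) := by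
      intro D s' hD hle g0 g2 g7 g9
      simp only [idxExpr, val_add, val_mul, val_reg, val_const, g0, g2, g7, g9]
      exact setArr_eq_relaxAt hD hle
    refine hidx _ _ rfl h.seeded.le ?_ ?_ ?_ ?_
    · simp [h.size]
    · simp [h.masks, hEdef]
    · simp [h.code, h.pw, hσ, hqdef]
    · simp
  refine (Ends.loop (I := fun j s' => (∀ r < 10, r ≠ 5 → s'.reg r = s₂.reg r) ∧ s'.reg 5 = j ∧
    (∀ a, a ≠ 4 → s'.arr a = s₂.arr a) ∧ s'.arr 4 0 = 0 ∧
    ∀ a < E, ∀ b < E, a * E + b < j → s'.arr 4 (a * E + b) = a ||| b) ?_ ?_ ?_).mono le_rfl ?_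
  · rintro j s' hj ⟨hf, g5, ha, hU0, hU⟩
    have g2 := (hf 2 (by norm_num) (by norm_num)).trans c2
    refine ⟨by simp [g5, g2, hj], (unionProg_spec hEdef g2 g5 hj b5 hU0 hU).mono le_rfl ?_⟩
    rintro s'' ⟨hf', g5', ha', hU'⟩
    exact ⟨fun r hr hr5 => (hf' r hr hr5).trans (hf r hr hr5), g5',
      fun a h4 => (ha' a h4).trans (ha a h4), hU'⟩
  · rintro s' ⟨hf, g5, -⟩
    simp [g5, (hf 2 (by norm_num) (by norm_num)).trans c2]
  · exact ⟨fun _ _ _ => rfl, c5, fun _ _ => rfl, by rw [a4], fun a ha b hb h => by omega⟩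
  rintro s' ⟨hf, -, ha, -, hU⟩
  have hlt : ∀ a < E, ∀ b < E, a * E + b < E * E := by
    intro a ha b hb
    have := Nat.mul_le_mul_right E (Nat.succ_le_of_lt ha)
    rw [Nat.succ_mul] at this
    omega
  have hroot9 : root (s₁.reg 9) ≠ 0 ∧ s₁.reg 9 < n := h.last hq
  refine ⟨s'.arr 4, fun a ha b hb => hU a ha b hb (hlt a ha b hb), ⟨b1, hE0, b2, b3, b4⟩,
    ⟨(hf 0 (by norm_num) (by norm_num)).trans c0, (hf 1 (by norm_num) (by norm_num)).trans c1,
      (hf 2 (by norm_num) (by norm_num)).trans c2, (ha 0 (by norm_num)).trans a0,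
      (ha 1 (by norm_num)).trans a1, (ha 2 (by norm_num)).trans a2, rfl⟩, ?_,
    (hf 3 (by norm_num) (by norm_num)).trans c3, (hf 4 (by norm_num) (by norm_num)).trans c4,
    ((hf 8 (by norm_num) (by norm_num)).trans c8).trans e2.symm⟩
  rw [ha 3 (by norm_num), a3]
  have hidx : (((σ + σ * n ^ q + 1) * E + 0) * n + s₁.reg 9) * n + s₁.reg 9 =
      (ctxOf n adj root term (s'.arr 4)).idx ((ctxOf n adj root term (s'.arr 4)).startCode + 1) 0
        (s₁.reg 9) (s₁.reg 9) := by
    rw [← e1]; rfl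
  refine ⟨relaxAt_le h.seeded.le le_rfl, fun i hi => ?_, fun u hu => ?_, fun u hu hut => ?_,
    s₁.reg 9, hroot9.2, hroot9.1, ?_⟩
  · by_cases hi1 : i = (((σ + σ * n ^ q + 1) * E + 0) * n + s₁.reg 9) * n + s₁.reg 9
    · exact .inr (.inr ⟨s₁.reg 9, hroot9.2, hroot9.1, hi1.trans hidx⟩)
    · rw [relaxAt, if_neg hi1] at hi
      rcases h.seeded.sound i hi with ⟨u, hu, h1⟩ | ⟨u, hu, hut, h1⟩
      · exact .inl ⟨u, hu, by rw [Ctx.idx_zero]; exact h1⟩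
      · exact .inr (.inl ⟨u, hu, hut, by rw [Ctx.idx_zero]; exact h1⟩)
  · rw [Ctx.idx_zero]
    exact (h.seeded.start u hu).trans (le_relaxAt _ _ _ _)
  · rw [Ctx.idx_zero]
    exact (h.seeded.term u hu hut).trans (le_relaxAt _ _ _ _)
  · rw [← hidx]
    exact le_relaxAt_self _ _ _

/-- The final positions: all tokens and the carrier are on `v`, and all terminals are covered. -/
def Ctx.goal (x : Ctx) (v : ℕ) : ℕ :=
  x.idx (v * enc x.n (x.q + x.q) (fun _ => 1) + 1) (x.E - 1) v v

theorem steinerProg_spec {n : ℕ} {adj root term : ℕ → ℕ} {s : State} {P B : ℕ} (hn : 0 < n)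
    (hq : rank root n ≠ 0) (h0 : ∀ r, s.reg r = if r = 0 then n else 0) (hadj : s.arr 0 = adj)
    (hroot : s.arr 1 = root) (hterm : s.arr 2 = term) (h3 : s.arr 3 = fun _ => 0)
    (h4 : s.arr 4 = fun _ => 0) (hP : ∀ U, (ctxOf n adj root term U).period = P)
    (hB : P * (49 * n * n * n * n) = B) :
    Ends B steinerProg s (n * 18 + 2 ^ (rank term n + 1) * 2 ^ (rank term n + 1) * 5 +
        B * (rank root n * 56 + 66) + 18) fun s' =>
      ∃ U D best, (ctxOf n adj root term U).Unions ∧ (ctxOf n adj root term U).Started D ∧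
        (∀ v < n, (ctxOf n adj root term U).table D B ((ctxOf n adj root term U).goal v) ≤ best) ∧
        (best = 0 ∨ ∃ v < n,
          (ctxOf n adj root term U).table D B ((ctxOf n adj root term U).goal v) = best) ∧
        s'.reg 1 = n + 1 - best ∧ s'.reg 0 = if 0 < best then 1 else 0 := by
  unfold steinerProg
  refine Ends.mono (k := n * 13 + 2 ^ (rank term n + 1) * 2 ^ (rank term n + 1) * 5 + 11 +
    (B * (rank root n * 56 + 65 + 1) + 1 + ((n * (4 + 1) + 1 + (1 + 1)) + 1 + 1) + 1)) (Ends.seq ?_)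
    (by ring_nf; omega) fun _ h => h
  refine (setupProg_spec hn hq h0 hadj hroot hterm h3 h4 hP hB).mono le_rfl ?_
  rintro s₁ ⟨U, hU, hbd, hrdy, hst, r3, r4, r8⟩
  set x := ctxOf n adj root term U with hx
  have hxn : x.n = n := rfl
  have hxE : 0 < x.E := hbd.one_le
  have hnB : n + 1 ≤ B := hbd.n_lt
  have hUlt : ∀ M < x.E, ∀ M' < x.E, x.union (M * x.E + M') < x.E := by
    intro M hM M' hM'
    rw [hU M hM M' hM']
    exact Nat.or_lt_two_pow hM hM'
  refine Ends.set_seq (by simp) (Ends.seq ?_)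
  refine (Ends.loop (I := fun j s' => (∀ r < 10, r ≠ 5 → s'.reg r = s₁.reg r) ∧ s'.reg 5 = j ∧
    (∀ a, a ≠ 3 → s'.arr a = s₁.arr a) ∧ s'.arr 3 = x.table (s₁.arr 3) j) ?_ ?_ ?_).mono le_rfl ?_
  · rintro j s' hj ⟨hf, g5, ha, hD⟩
    refine ⟨by simp [g5, (hf 3 (by norm_num) (by norm_num)).trans r3, hj], ?_⟩
    have hr' : Ready x s' := ⟨(hf 0 (by norm_num) (by norm_num)).trans hrdy.n,
      (hf 1 (by norm_num) (by norm_num)).trans hrdy.q,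
      (hf 2 (by norm_num) (by norm_num)).trans hrdy.E, (ha 0 (by norm_num)).trans hrdy.adj,
      (ha 1 (by norm_num)).trans hrdy.root, (ha 2 (by norm_num)).trans hrdy.term,
      (ha 4 (by norm_num)).trans hrdy.union⟩
    refine (stepProg_spec hbd hr' ((hf 4 (by norm_num) (by norm_num)).trans r4) g5 (hP U).symm hn
      (by omega) hD (x.table_le hst.le j) hUlt).mono le_rfl ?_
    rintro s'' ⟨hf', ha', g5', hD'⟩
    refine ⟨fun r hr hr5 => (hf' r hr hr5).trans (hf r hr hr5), g5',
      fun a h3 => (ha' a h3).trans (ha a h3), ?_⟩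
    rw [hD', ← hP U]
    rfl
  · rintro s' ⟨hf, g5, -⟩
    simp [g5, (hf 3 (by norm_num) (by norm_num)).trans r3]
  · refine ⟨fun r _ hr => ?_, by simp, fun _ _ => rfl, rfl⟩
    rw [setReg_reg, if_neg hr]
  rintro s₂ ⟨hf, -, ha, hD⟩
  set D := x.table (s₁.arr 3) B with hDdef
  have hle : ∀ i, D i ≤ n + 1 := x.table_le hst.le B
  have g0 : s₂.reg 0 = n := (hf 0 (by norm_num) (by norm_num)).trans hrdy.n
  have g2 : s₂.reg 2 = x.E := (hf 2 (by norm_num) (by norm_num)).trans hrdy.E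
  have g8 : s₂.reg 8 = enc x.n (x.q + x.q) fun _ => 1 :=
    (hf 8 (by norm_num) (by norm_num)).trans r8
  refine Ends.set_seq (by simp) (Ends.set_seq (by simp)
    (Ends.seq (k := n * (4 + 1) + 1) (k' := 1 + 1) ?_))
  refine (Ends.loop (I := fun j s' => s'.reg 0 = n ∧ s'.reg 2 = x.E ∧
    s'.reg 8 = enc x.n (x.q + x.q) (fun _ => 1) ∧ s'.reg 5 = j ∧ s'.arr 3 = D ∧
    (∀ v < j, D (x.goal v) ≤ s'.reg 25) ∧ (s'.reg 25 = 0 ∨ ∃ v < j, D (x.goal v) = s'.reg 25))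
    ?_ ?_ ?_).mono le_rfl ?_
  · rintro j s' hj ⟨f0, f2, f8, f5, h3, hall, hex⟩
    refine ⟨by simp [f5, f0, hj], ?_⟩
    have hval : (Expr.load 3 (idxExpr (.reg 5 * .reg 8 + .const 1) (.reg 2 - .const 1)
        (.reg 5) (.reg 5))).val s' = D (x.goal j) := by
      simp only [idxExpr, val_load, val_add, val_mul, val_reg, val_const, val_sub, f5, f8, f2, f0,
        h3]
      rfl
    refine Ends.set_seq (by rw [hval]; exact (hle _).trans hnB) ?_
    rw [hval]
    have b25 : D (x.goal j) ≤ B := (hle _).trans hnB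
    refine Ends.mono (k := 1 + 1 + 1) (Ends.seq ?_) (by norm_num) fun _ h => h
    refine Ends.mono (k := 1 + 1) (P := fun s'' => (∀ r, r ≠ 25 → r ≠ 27 → s''.reg r = s'.reg r) ∧
      s''.arr = s'.arr ∧ s''.reg 25 = max (s'.reg 25) (D (x.goal j))) (Ends.cond ?_ ?_) le_rfl ?_
    · intro hlt
      have hlt' : s'.reg 25 < D (x.goal j) := by simpa using hlt
      refine Ends.set (by simpa using b25) ⟨fun r h1 h2 => by simp [h1, h2], rfl, ?_⟩
      simp [max_eq_right hlt'.le]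
    · intro hlt
      have hlt' : D (x.goal j) ≤ s'.reg 25 := by simpa using hlt
      refine Ends.skip ⟨fun r h1 h2 => by simp [h2], rfl, ?_⟩
      simp [max_eq_left hlt']
    rintro s'' ⟨hf'', ha'', h25⟩
    refine Ends.set (by simp [hf'', f5]; omega) ⟨by simp [hf'', f0], by simp [hf'', f2],
      by simp [hf'', f8], by simp [hf'', f5], by simp [ha'', h3], fun v hv => ?_, ?_⟩
    · simp only [setReg_reg, h25]
      norm_num only [if_false]
      rcases Nat.lt_succ_iff_lt_or_eq.1 hv with hv | rfl
      exacts [(hall v hv).trans (le_max_left _ _), le_max_right _ _]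
    · simp only [setReg_reg, h25]
      norm_num only [if_false]
      rcases le_total (s'.reg 25) (D (x.goal j)) with h1 | h1
      · exact .inr ⟨j, by omega, (max_eq_right h1).symm⟩
      · rw [max_eq_left h1]
        rcases hex with h2 | ⟨v, hv, h2⟩
        exacts [.inl h2, .inr ⟨v, by omega, h2⟩]
  · rintro s' ⟨f0, -, -, f5, -⟩
    simp [f5, f0]
  · refine ⟨by simp [g0], by simp [g2], by simp [g8], by simp, by simp [hD], fun v hv => by omega,
      by simp⟩
  rintro s₃ ⟨f0, -, -, -, -, hall, hex⟩
  refine Ends.set_seq (by simp [f0]; omega) (Ends.set ?_ ?_)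
  · simp only [val_less, val_const, val_reg, setReg_reg]
    split_ifs <;> omega
  · refine ⟨U, s₁.arr 3, s₃.reg 25, hU, hst, hall, hex, by simp [f0], by simp⟩

/-! ### Every entry of the table is realised by a set of vertices -/

/-- The edges of the graph. -/
def Ctx.edge (x : Ctx) (u v : ℕ) : Prop := x.adj (u * x.n + v) ≠ 0

/-- The vertices that are for free: roots and terminals. -/
def Ctx.free (x : Ctx) : Finset ℕ := (Finset.range x.n).filter fun u => x.root u + x.term u ≠ 0

/-- `W` contains all roots and terminals and at most `c` other vertices. -/
structure Ctx.Cheap (x : Ctx) (W : Finset ℕ) (c : ℕ) : Prop where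
  free_sub : x.free ⊆ W
  sub_range : W ⊆ Finset.range x.n
  card_le : (W \ x.free).card ≤ c

/-- The set `W`, together with `z`, contains paths from `z` to all terminals in the mask `M`. -/
def Ctx.TreeIn (x : Ctx) (W : Finset ℕ) (M z : ℕ) : Prop :=
  ∀ u < x.n, x.term u ≠ 0 → M.testBit (rank x.term u + 1) →
    ReachIn x.edge (insert z W : Finset ℕ) z u

/-- The set `W` contains what a position of the token game promises. The forward tokens are on
`d i` and the backward tokens on `d (q + i)`, for `i < q`. Inside `W`, all roots reach forward
tokens, and the collected terminals, the forward tokens and the carrier's origin `o` are reached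
from backward tokens, while `o` reaches the carrier `z`. -/
structure Ctx.PlayIn (x : Ctx) (W : Finset ℕ) (d : ℕ → ℕ) (M o z : ℕ) : Prop where
  mem : ∀ i < x.q + x.q, d i ∈ W
  roots : ∀ u < x.n, x.root u ≠ 0 → ∃ i < x.q, ReachIn x.edge W u (d i)
  origin : ∃ j < x.q, ReachIn x.edge W (d (x.q + j)) o
  carrier : ReachIn x.edge W o z
  forward : ∀ i < x.q, ∃ j < x.q, ReachIn x.edge W (d (x.q + j)) (d i)
  terms : ∀ u < x.n, x.term u ≠ 0 → M.testBit (rank x.term u + 1) →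
    ∃ j < x.q, ReachIn x.edge W (d (x.q + j)) u
  rigid : M = 0 → (∀ i < x.q, d (x.q + i) = d i) ∧ o = z ∧ ∃ j < x.q, d j = z

section Correctness

variable {x : Ctx}

theorem Ctx.Cheap.add_vertex {W : Finset ℕ} {c p k : ℕ} (h : x.Cheap W c) (hp : p < x.n)
    (hk : p ∈ W ∨ x.weight p ≤ k) : x.Cheap (insert p W) (c + k) := by
  refine ⟨h.free_sub.trans (Finset.subset_insert _ _), ?_, ?_⟩
  · exact Finset.insert_subset (Finset.mem_range.2 hp) h.sub_range
  · have h1 := h.card_le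
    by_cases hpW : p ∈ W
    · rw [Finset.insert_eq_of_mem hpW]; omega
    have hw := hk.resolve_left hpW
    by_cases hpf : p ∈ x.free
    · exact absurd (h.free_sub hpf) hpW
    · have h2 : x.weight p = 1 := by
        rw [Ctx.weight, if_pos]
        by_contra h0
        exact hpf (Finset.mem_filter.2 ⟨Finset.mem_range.2 hp, h0⟩)
      rw [Finset.insert_sdiff_of_notMem _ hpf]
      exact (Finset.card_insert_le _ _).trans (by omega)

theorem Ctx.Cheap.mono {W : Finset ℕ} {c c' : ℕ} (h : x.Cheap W c) (hc : c ≤ c') : x.Cheap W c' :=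
  ⟨h.free_sub, h.sub_range, h.card_le.trans hc⟩

theorem Ctx.Cheap.union {W W' : Finset ℕ} {c c' : ℕ} (h : x.Cheap W c) (h' : x.Cheap W' c') :
    x.Cheap (W ∪ W') (c + c') := by
  refine ⟨h.free_sub.trans Finset.subset_union_left, Finset.union_subset h.sub_range h'.sub_range,
    ?_⟩
  rw [Finset.union_sdiff_distrib]
  have := h.card_le
  have := h'.card_le
  exact (Finset.card_union_le _ _).trans (by omega)

theorem Ctx.PlayIn.congr {W : Finset ℕ} {d e : ℕ → ℕ} {M o z : ℕ} (h : x.PlayIn W d M o z)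
    (he : ∀ i < x.q + x.q, e i = d i) : x.PlayIn W e M o z := by
  have h1 : ∀ i < x.q, e i = d i := fun i hi => he i (by omega)
  have h2 : ∀ i < x.q, e (x.q + i) = d (x.q + i) := fun i hi => he _ (by omega)
  refine ⟨fun i hi => he i hi ▸ h.mem i hi, fun u hu hr => ?_, ?_, h.carrier, fun i hi => ?_,
    fun u hu ht hM => ?_, fun hM => ?_⟩
  · obtain ⟨i, hi, h3⟩ := h.roots u hu hr
    exact ⟨i, hi, h1 i hi ▸ h3⟩
  · obtain ⟨j, hj, h3⟩ := h.origin
    exact ⟨j, hj, h2 j hj ▸ h3⟩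
  · obtain ⟨j, hj, h3⟩ := h.forward i hi
    exact ⟨j, hj, by rw [h2 j hj, h1 i hi]; exact h3⟩
  · obtain ⟨j, hj, h3⟩ := h.terms u hu ht hM
    exact ⟨j, hj, h2 j hj ▸ h3⟩
  · obtain ⟨h3, h4, j, hj, h5⟩ := h.rigid hM
    exact ⟨fun i hi => by rw [h2 i hi, h1 i hi, h3 i hi], h4, j, hj, by rw [h1 j hj, h5]⟩

theorem Ctx.PlayIn.carrier_from {W : Finset ℕ} {d : ℕ → ℕ} {M o z : ℕ} (h : x.PlayIn W d M o z) :
    ∃ j < x.q, ReachIn x.edge W (d (x.q + j)) z := by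
  obtain ⟨j, hj, h1⟩ := h.origin
  exact ⟨j, hj, h1.trans h.carrier⟩

theorem Ctx.PlayIn.mono {W W' : Finset ℕ} {d : ℕ → ℕ} {M o z : ℕ} (h : x.PlayIn W d M o z)
    (hW : W ⊆ W') : x.PlayIn W' d M o z := by
  have hW' : (W : Set ℕ) ⊆ W' := Finset.coe_subset.2 hW
  refine ⟨fun i hi => hW (h.mem i hi), fun u hu hr => ?_, ?_, h.carrier.mono hW', fun i hi => ?_,
    fun u hu ht hM => ?_, h.rigid⟩
  · obtain ⟨i, hi, h3⟩ := h.roots u hu hr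
    exact ⟨i, hi, h3.mono hW'⟩
  · obtain ⟨j, hj, h3⟩ := h.origin
    exact ⟨j, hj, h3.mono hW'⟩
  · obtain ⟨j, hj, h3⟩ := h.forward i hi
    exact ⟨j, hj, h3.mono hW'⟩
  · obtain ⟨j, hj, h3⟩ := h.terms u hu ht hM
    exact ⟨j, hj, h3.mono hW'⟩

theorem Ctx.PlayIn.reset {W : Finset ℕ} {d : ℕ → ℕ} {M o z p : ℕ} (h : x.PlayIn W d M o z)
    (hp : ∃ i < x.q + x.q, d i = p) : x.PlayIn W d M p p := by
  obtain ⟨i, hi, rfl⟩ := hp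
  refine ⟨h.mem, h.roots, ?_, .refl (by exact_mod_cast h.mem i hi), h.forward, h.terms,
    fun hM => ⟨(h.rigid hM).1, rfl, ?_⟩⟩
  · rcases Nat.lt_or_ge i x.q with hiq | hiq
    · exact h.forward i hiq
    · refine ⟨i - x.q, by omega, ?_⟩
      rw [Nat.add_sub_cancel' hiq]
      exact .refl (by exact_mod_cast h.mem i hi)
  · rcases Nat.lt_or_ge i x.q with hiq | hiq
    · exact ⟨i, hiq, rfl⟩
    · refine ⟨i - x.q, by omega, ?_⟩
      rw [← (h.rigid hM).1 _ (by omega), Nat.add_sub_cancel' hiq]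

theorem Ctx.PlayIn.gather {W : Finset ℕ} {d e : ℕ → ℕ} {o z p : ℕ} (h : x.PlayIn W d 0 o z)
    (hp : p ∈ W) (hzp : x.edge z p) (he : ∀ i < x.q + x.q, e i = if d i = z then p else d i) :
    x.PlayIn W e 0 p p := by
  obtain ⟨h1, h2, j, hj, h3⟩ := h.rigid rfl
  have hz : ReachIn x.edge W z p :=
    .single (h.carrier.right_mem) (by exact_mod_cast hp) hzp
  have hmem : ∀ i < x.q + x.q, e i ∈ W := by
    intro i hi
    rw [he i hi]
    split_ifs
    exacts [hp, h.mem i hi]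
  have hej : e j = p := by rw [he j (by omega), if_pos h3]
  have heq : ∀ i < x.q, e (x.q + i) = e i := fun i hi => by
    rw [he _ (by omega), he _ (by omega), h1 i hi]
  refine ⟨hmem, fun u hu hr => ?_, ⟨j, hj, ?_⟩, .refl (by exact_mod_cast hp),
    fun i hi => ⟨i, hi, ?_⟩, fun u _ _ hM => by simp at hM, fun _ => ⟨heq, rfl, j, hj, hej⟩⟩
  · obtain ⟨i, hi, h4⟩ := h.roots u hu hr
    refine ⟨i, hi, ?_⟩
    rw [he i (by omega)]
    split_ifs with h5
    exacts [(h5 ▸ h4).trans hz, h4]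
  · rw [heq j hj, hej]
    exact .refl (by exact_mod_cast hp)
  · rw [heq i hi]
    exact .refl (by exact_mod_cast hmem i (by omega))

theorem Ctx.PlayIn.step {W : Finset ℕ} {d e : ℕ → ℕ} {M o z p : ℕ} (h : x.PlayIn W d M o z)
    (hM : M ≠ 0) (hp : p ∈ W) (hzp : x.edge z p)
    (he : ∀ i < x.q, e i = if d i = z then p else d i)
    (he' : ∀ i < x.q, e (x.q + i) = d (x.q + i)) :
    x.PlayIn W e M o p := by
  have hz : ReachIn x.edge W z p :=
    .single (h.carrier.right_mem) (by exact_mod_cast hp) hzp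
  refine ⟨fun i hi => ?_, fun u hu hr => ?_, ?_, h.carrier.trans hz, fun i hi => ?_,
    fun u hu ht hb => ?_, fun h0 => absurd h0 hM⟩
  · rcases Nat.lt_or_ge i x.q with hiq | hiq
    · rw [he i hiq]
      split_ifs
      exacts [hp, h.mem i hi]
    · have h1 := he' (i - x.q) (by omega)
      rw [Nat.add_sub_cancel' hiq] at h1
      rw [h1]; exact h.mem i hi
  · obtain ⟨i, hi, h4⟩ := h.roots u hu hr
    refine ⟨i, hi, ?_⟩
    rw [he i hi]
    split_ifs with h5
    exacts [(h5 ▸ h4).trans hz, h4]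
  · obtain ⟨j, hj, h4⟩ := h.origin
    exact ⟨j, hj, (he' j hj).symm ▸ h4⟩
  · rw [he i hi]
    split_ifs with h5
    · obtain ⟨j, hj, h4⟩ := h.carrier_from
      exact ⟨j, hj, (he' j hj).symm ▸ h4.trans hz⟩
    · obtain ⟨j, hj, h4⟩ := h.forward i hi
      exact ⟨j, hj, (he' j hj).symm ▸ h4⟩
  · obtain ⟨j, hj, h4⟩ := h.terms u hu ht hb
    exact ⟨j, hj, (he' j hj).symm ▸ h4⟩

/-- Replacing the backward tokens on `z` by tokens on a vertex that reaches `z`. -/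
theorem Ctx.PlayIn.back {W : Finset ℕ} {d e : ℕ → ℕ} {M o z p : ℕ} (h : x.PlayIn W d M o z)
    (hpz : ReachIn x.edge W p z) (hM : M = 0 → p = z) (he : ∀ i < x.q, e i = d i)
    (he' : ∀ i < x.q, e (x.q + i) = if d (x.q + i) = z then p else d (x.q + i)) :
    x.PlayIn W e M o z := by
  have key : ∀ j < x.q, ∀ y, ReachIn x.edge W (d (x.q + j)) y →
      ReachIn x.edge W (e (x.q + j)) y := by
    intro j hj y hy
    rw [he' j hj]
    split_ifs with h1
    exacts [hpz.trans (h1 ▸ hy), hy]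
  refine ⟨fun i hi => ?_, fun u hu hr => ?_, ?_, h.carrier, fun i hi => ?_, fun u hu ht hb => ?_,
    fun h0 => ?_⟩
  · rcases Nat.lt_or_ge i x.q with hiq | hiq
    · rw [he i hiq]; exact h.mem i hi
    · have h1 := he' (i - x.q) (by omega)
      rw [Nat.add_sub_cancel' hiq] at h1
      rw [h1]
      split_ifs
      exacts [by exact_mod_cast hpz.1, h.mem i hi]
  · obtain ⟨i, hi, h4⟩ := h.roots u hu hr
    exact ⟨i, hi, (he i hi).symm ▸ h4⟩
  · obtain ⟨j, hj, h4⟩ := h.origin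
    exact ⟨j, hj, key j hj _ h4⟩
  · obtain ⟨j, hj, h4⟩ := h.forward i hi
    exact ⟨j, hj, key j hj _ ((he i hi).symm ▸ h4)⟩
  · obtain ⟨j, hj, h4⟩ := h.terms u hu ht hb
    exact ⟨j, hj, key j hj _ h4⟩
  · obtain ⟨h1, h2, j, hj, h3⟩ := h.rigid h0
    refine ⟨fun i hi => ?_, h2, j, hj, by rw [he j hj, h3]⟩
    rw [he' i hi, he i hi, hM h0]
    split_ifs with h4
    exacts [by rw [← h1 i hi, h4], h1 i hi]

theorem Ctx.PlayIn.collect {W : Finset ℕ} {d : ℕ → ℕ} {M M' o z : ℕ} (h : x.PlayIn W d M o z)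
    (hT : x.TreeIn W M' z) : x.PlayIn W d (M ||| M') o z := by
  refine ⟨h.mem, h.roots, h.origin, h.carrier, h.forward, fun u hu ht hb => ?_, fun h0 =>
    h.rigid (Nat.or_eq_zero_iff.1 h0).1⟩
  rw [Nat.testBit_or, Bool.or_eq_true] at hb
  rcases hb with hb | hb
  · exact h.terms u hu ht hb
  · have h1 := hT u hu ht hb
    have hz : z ∈ W := by exact_mod_cast h.carrier.right_mem
    rw [Finset.insert_eq_of_mem hz] at h1
    obtain ⟨j, hj, h4⟩ := h.carrier_from
    exact ⟨j, hj, h4.trans h1⟩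

theorem Ctx.TreeIn.mono {W W' : Finset ℕ} {M z : ℕ} (h : x.TreeIn W M z) (hW : W ⊆ W') :
    x.TreeIn W' M z := fun u hu ht hb =>
  (h u hu ht hb).mono (Finset.coe_subset.2 (Finset.insert_subset_insert _ hW))

theorem Ctx.TreeIn.merge {W : Finset ℕ} {M M' z : ℕ} (h : x.TreeIn W M z) (h' : x.TreeIn W M' z) :
    x.TreeIn W (M ||| M') z := by
  intro u hu ht hb
  rw [Nat.testBit_or, Bool.or_eq_true] at hb
  exact hb.elim (h u hu ht) (h' u hu ht)

theorem Ctx.TreeIn.grow {W : Finset ℕ} {M z p : ℕ} (h : x.TreeIn W M z) (hpz : x.edge p z) :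
    x.TreeIn (insert z W) M p := fun u hu ht hb =>
  .head (by simp) hpz ((h u hu ht hb).mono (Finset.coe_subset.2 (Finset.subset_insert _ _)))

/-- What the items with number `σ` stand for, see `Ctx.idx`. -/
def Ctx.Valid (x : Ctx) (σ M o z c : ℕ) : Prop :=
  ∃ W, x.Cheap W c ∧ (σ = 0 → x.TreeIn W M z) ∧
    ∀ τ, σ = τ + 1 → x.PlayIn W (dig x.n τ) M o z

/-- The entries of a table are `n + 1 - c` for an item of cost `c`; larger costs are irrelevant. -/
def Ctx.Sound (x : Ctx) (D : ℕ → ℕ) : Prop :=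
  (∀ i, D i ≤ x.n + 1) ∧ ∀ σ M o z, M < x.E → o < x.n → z < x.n → ∀ c ≤ x.n,
    x.n + 1 ≤ D (x.idx σ M o z) + c → x.Valid σ M o z c

theorem Ctx.Sound.relax {D : ℕ → ℕ} {σ M o z v : ℕ} (h : x.Sound D) (hM : M < x.E) (ho : o < x.n)
    (hz : z < x.n) (hv : v ≤ x.n + 1) (hval : ∀ c ≤ x.n, x.n + 1 ≤ v + c → x.Valid σ M o z c) :
    x.Sound (relaxAt D (x.idx σ M o z) v) := by
  refine ⟨relaxAt_le h.1 hv, fun σ' M' o' z' hM' ho' hz' c hc hle => ?_⟩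
  rw [relaxAt] at hle
  split_ifs at hle with heq
  · obtain ⟨rfl, rfl, rfl, rfl⟩ := x.idx_inj hM' ho' hz' hM ho hz heq
    rcases le_total (D (x.idx σ' M' o' z')) v with h1 | h1
    · rw [max_eq_right h1] at hle
      exact hval c hc hle
    · rw [max_eq_left h1] at hle
      exact h.2 _ _ _ _ hM' ho' hz' c hc hle
  · exact h.2 _ _ _ _ hM' ho' hz' c hc hle

/-- A relaxation that derives an item from another one at price `e` is sound if the derivation is
valid; nothing has to be shown if the price exceeds `n`. -/
theorem Ctx.Sound.relax_sub {D : ℕ → ℕ} {σ M o z σ' M' o' z' e : ℕ} (h : x.Sound D) (hM : M < x.E)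
    (ho : o < x.n) (hz : z < x.n) (hM' : M' < x.E) (ho' : o' < x.n) (hz' : z' < x.n)
    (hval : e ≤ x.n → ∀ c, x.Valid σ M o z c → x.Valid σ' M' o' z' (c + e)) :
    x.Sound (relaxAt D (x.idx σ' M' o' z') (D (x.idx σ M o z) - e)) := by
  have h1 := h.1 (x.idx σ M o z)
  refine h.relax hM' ho' hz' (by omega) fun c hc hle => ?_
  have h2 : c - e + e = c := by omega
  rw [← h2]
  exact hval (by omega) _ (h.2 σ M o z hM ho hz _ (by omega) (by omega))

theorem edgeCost_le {n a : ℕ} (h : edgeCost n a ≤ n) : a ≠ 0 := by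
  rintro rfl
  simp [edgeCost] at h

theorem Ctx.Cheap.enter {W : Finset ℕ} {c p τ : ℕ} (h : x.Cheap W c) (hp : p < x.n)
    (hmem : ∀ i < x.q + x.q, dig x.n τ i ∈ W) : x.Cheap (insert p W) (c + x.enter τ p) := by
  refine h.add_vertex hp ?_
  rw [Ctx.enter]
  split_ifs with h1
  · exact .inr (by rw [one_mul])
  · left
    by_contra hpW
    refine h1 (Finset.sum_eq_zero fun i hi => if_neg ?_)
    rintro rfl
    exact hpW (hmem i (Finset.mem_range.1 hi))

theorem dig_moveCode {n q τ z A C i : ℕ} (hA : A < n) (hC : C < n) (hi : i < q + q) :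
    dig n (moveCode n q τ z A C) i =
      if dig n τ i = z then (if i < q then A else C) else dig n τ i := by
  refine dig_enc (fun i _ => ?_) hi
  split_ifs
  exacts [hA, hC, dig_lt (by omega) _ _]

theorem valid_succ {τ M o z c : ℕ} :
    x.Valid (τ + 1) M o z c ↔ ∃ W, x.Cheap W c ∧ x.PlayIn W (dig x.n τ) M o z := by
  constructor
  · rintro ⟨W, h1, -, h2⟩
    exact ⟨W, h1, h2 τ rfl⟩
  · rintro ⟨W, h1, h2⟩
    exact ⟨W, h1, fun h => by omega, fun τ' h => by rwa [← Nat.succ_injective h]⟩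

theorem valid_zero {M o z c : ℕ} :
    x.Valid 0 M o z c ↔ ∃ W, x.Cheap W c ∧ x.TreeIn W M z := by
  constructor
  · rintro ⟨W, h1, h2, -⟩
    exact ⟨W, h1, h2 rfl⟩
  · rintro ⟨W, h1, h2⟩
    exact ⟨W, h1, fun _ => h2, fun τ' h => by omega⟩

theorem Ctx.Sound.moves {D : ℕ → ℕ} {τ M o z p : ℕ} (h : x.Sound D) (hM : M < x.E) (ho : o < x.n)
    (hz : z < x.n) (hp : p < x.n) : x.Sound (x.moves τ M o z p D) := by
  have hn : 0 < x.n := by omega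
  have h1 := h.relax_sub (σ := τ + 1) (σ' := moveCode x.n x.q τ z z z + 1) (M' := M) (o' := p)
    (z' := p) (e := (if occCount x.n x.q τ p = 0 then 1 else 0) * (x.n + 1)) hM ho hz hM hp hp
    fun he c hv => by
      rw [valid_succ] at hv ⊢
      obtain ⟨W, hW, hPl⟩ := hv
      split_ifs at he with h0
      · omega
      rw [if_neg h0, zero_mul, add_zero]
      refine ⟨W, hW, (hPl.reset ?_).congr fun i hi => ?_⟩
      · by_contra hne
        push Not at hne
        exact h0 (Finset.sum_eq_zero fun i hi => if_neg (hne i (Finset.mem_range.1 hi)))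
      · rw [dig_moveCode hz hz hi]
        split_ifs with h2
        exacts [h2.symm, h2.symm, rfl]
  have h2 := h1.relax_sub (σ := τ + 1)
    (σ' := moveCode x.n x.q τ z p (if M = 0 then p else z) + 1) (M' := M)
    (o' := if M = 0 then p else o) (z' := p)
    (e := x.enter τ p + edgeCost x.n (x.adj (z * x.n + p))) hM ho hz hM
    (by split_ifs <;> assumption) hp fun he c hv => by
      rw [valid_succ] at hv ⊢
      obtain ⟨W, hW, hPl⟩ := hv
      have hedge : x.edge z p := edgeCost_le (n := x.n) (by omega)
      refine ⟨insert p W, (hW.enter hp hPl.mem).mono (by omega), ?_⟩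
      have hPl' := hPl.mono (Finset.subset_insert p W)
      split_ifs with h0
      · subst h0
        refine hPl'.gather (by simp) hedge fun i hi => ?_
        rw [dig_moveCode hp hp hi, ite_self]
      · refine hPl'.step h0 (by simp) hedge (fun i hi => ?_) fun i hi => ?_
        · rw [dig_moveCode hp hz (by omega), if_pos hi]
        · rw [dig_moveCode hp hz (by omega), if_neg (show ¬ x.q + i < x.q by omega)]
          split_ifs with h2
          exacts [h2.symm, rfl]
  have h3 := h2.relax_sub (σ := τ + 1)
    (σ' := moveCode x.n x.q τ z z p + 1) (M' := M) (o' := o) (z' := z)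
    (e := x.enter τ p + edgeCost x.n (x.adj (p * x.n + z)) +
      (if M = 0 then 1 else 0) * (x.n + 1)) hM ho hz hM ho hz fun he c hv => by
      rw [valid_succ] at hv ⊢
      obtain ⟨W, hW, hPl⟩ := hv
      have hedge : x.edge p z := edgeCost_le (n := x.n) (by omega)
      refine ⟨insert p W, (hW.enter hp hPl.mem).mono (by omega), ?_⟩
      have hPl' := hPl.mono (Finset.subset_insert p W)
      have h0 : M ≠ 0 := by
        rintro rfl
        simp at he
        omega
      refine hPl'.back (.single (by simp) hPl'.carrier.right_mem hedge) (fun h => absurd h h0)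
        (fun i hi => ?_) fun i hi => ?_
      · rw [dig_moveCode hz hp (by omega), if_pos hi]
        split_ifs with h2
        exacts [h2.symm, rfl]
      · rw [dig_moveCode hz hp (by omega), if_neg (show ¬ x.q + i < x.q by omega)]
  exact h3.relax_sub (σ := τ + 1)
    (σ' := moveCode x.n x.q τ z z o + 1) (M' := M) (o' := o) (z' := z)
    (e := 0) hM ho hz hM ho hz fun he c hv => by
      rw [valid_succ] at hv ⊢
      obtain ⟨W, hW, hPl⟩ := hv
      refine ⟨W, hW, hPl.back hPl.carrier (fun h => (hPl.rigid h).2.1) (fun i hi => ?_)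
        fun i hi => ?_⟩
      · rw [dig_moveCode hz ho (by omega), if_pos hi]
        split_ifs with h2
        exacts [h2.symm, rfl]
      · rw [dig_moveCode hz ho (by omega), if_neg (show ¬ x.q + i < x.q by omega)]

theorem Ctx.Sound.grow {D : ℕ → ℕ} {M o z p : ℕ} (h : x.Sound D) (hM : M < x.E) (ho : o < x.n)
    (hz : z < x.n) (hp : p < x.n) : x.Sound (x.grow M o z p D) := by
  refine h.relax_sub hM ho hz hM ho hp fun he c hv => ?_
  rw [valid_zero] at hv ⊢
  obtain ⟨W, hW, hT⟩ := hv
  exact ⟨insert z W, (hW.add_vertex hz (.inr le_rfl)).mono (by omega),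
    hT.grow (edgeCost_le (n := x.n) (by omega))⟩

theorem Ctx.Sound.join {D : ℕ → ℕ} {σ M o z M' : ℕ} (h : x.Sound D) (hU : x.Unions)
    (hlt : ∀ M < x.E, ∀ M' < x.E, M ||| M' < x.E) (hM : M < x.E) (ho : o < x.n)
    (hz : z < x.n) (hM' : M' < x.E) : x.Sound (x.join σ M o z M' D) := by
  have h1 := h.1 (x.idx σ M o z)
  have h2 := h.1 (x.idx 0 M' 0 z)
  rw [Ctx.join, hU M hM M' hM']
  refine h.relax (hlt M hM M' hM') ho hz (by omega) fun c hc hle => ?_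
  obtain ⟨W, hW, hT, hPl⟩ := h.2 σ M o z hM ho hz (x.n + 1 - D (x.idx σ M o z))
    (by omega) (by omega)
  obtain ⟨W', hW', hT'⟩ := valid_zero.1 (h.2 0 M' 0 z hM' (by omega) hz
    (x.n + 1 - D (x.idx 0 M' 0 z)) (by omega) (by omega))
  have hT'' := hT'.mono (Finset.subset_union_right (s₁ := W))
  exact ⟨W ∪ W', (hW.union hW').mono (by omega),
    fun h0 => ((hT h0).mono Finset.subset_union_left).merge hT'',
    fun τ hτ => ((hPl τ hτ).mono Finset.subset_union_left).collect hT''⟩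

theorem Ctx.Sound.table {D : ℕ → ℕ} (h : x.Sound D) (hU : x.Unions) (hn : 0 < x.n) (hE : 0 < x.E)
    (hlt : ∀ M < x.E, ∀ M' < x.E, M ||| M' < x.E) (j : ℕ) : x.Sound (x.table D j) := by
  induction j with
  | zero => exact h
  | succ j ih =>
    refine Ctx.Sound.join ?_ hU hlt (Nat.mod_lt _ hE) (Nat.mod_lt _ hn) (Nat.mod_lt _ hn)
      (Nat.mod_lt _ hE)
    split_ifs
    · exact ih.grow (Nat.mod_lt _ hE) (Nat.mod_lt _ hn) (Nat.mod_lt _ hn) (Nat.mod_lt _ hn)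
    · exact ih.moves (Nat.mod_lt _ hE) (Nat.mod_lt _ hn) (Nat.mod_lt _ hn) (Nat.mod_lt _ hn)

/-! ### The table finds everything that the token game reaches -/

theorem Ctx.le_pass (σ M o z p M' : ℕ) (D : ℕ → ℕ) (i : ℕ) : D i ≤ x.pass σ M o z p M' D i := by
  refine le_trans ?_ (le_relaxAt _ _ _ _)
  split_ifs
  · exact le_relaxAt _ _ _ _
  · exact (le_relaxAt _ _ _ _).trans ((le_relaxAt _ _ _ _).trans
      ((le_relaxAt _ _ _ _).trans (le_relaxAt _ _ _ _)))

theorem Ctx.table_mono (D : ℕ → ℕ) {j l : ℕ} (h : j ≤ l) (i : ℕ) :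
    x.table D j i ≤ x.table D l i := by
  induction l, h using Nat.le_induction with
  | base => exact le_rfl
  | succ l _ ih => exact ih.trans (x.le_pass _ _ _ _ _ _ _ _)

/-- In every round of `period` steps, every update is carried out. -/
theorem Ctx.exists_pass (D : ℕ → ℕ) (k : ℕ) {σ M o z p M' : ℕ} (hσ : σ ≤ x.n ^ (x.q + x.q))
    (hM : M < x.E) (ho : o < x.n) (hz : z < x.n) (hp : p < x.n) (hM' : M' < x.E) :
    ∃ T : ℕ → ℕ, (∀ i, x.table D (k * x.period) i ≤ T i) ∧
      ∀ i, x.pass σ M o z p M' T i ≤ x.table D ((k + 1) * x.period) i := by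
  have key : ∀ {a b c m : ℕ}, a < m → b < c → a * c + b < m * c := by
    intro a b c m ha hb
    have := Nat.mul_le_mul_right c (Nat.succ_le_of_lt ha)
    rw [Nat.succ_mul] at this
    omega
  have hlt : x.code σ M o z p M' < x.period := key (key (x.idx_lt hσ hM ho hz) hp) hM'
  refine ⟨x.table D (k * x.period + x.code σ M o z p M'), x.table_mono D (by omega), fun i => ?_⟩
  refine le_trans (le_of_eq ?_) (x.table_mono D
    (j := k * x.period + x.code σ M o z p M' + 1) (by rw [Nat.succ_mul]; omega) i)
  rw [Ctx.table, Nat.add_mod, Nat.mul_mod_left, zero_add, Nat.mod_mod, Nat.mod_eq_of_lt hlt,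
    x.passAt_code hM ho hz hp hM']

theorem Ctx.moves_reset (τ M o z p : ℕ) (D : ℕ → ℕ) :
    D (x.idx (τ + 1) M o z) - (if occCount x.n x.q τ p = 0 then 1 else 0) * (x.n + 1) ≤
      x.moves τ M o z p D (x.idx (moveCode x.n x.q τ z z z + 1) M p p) :=
  (le_relaxAt_self _ _ _).trans ((le_relaxAt _ _ _ _).trans
    ((le_relaxAt _ _ _ _).trans (le_relaxAt _ _ _ _)))

theorem Ctx.moves_step (τ M o z p : ℕ) (D : ℕ → ℕ) :
    D (x.idx (τ + 1) M o z) - (x.enter τ p + edgeCost x.n (x.adj (z * x.n + p))) ≤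
      x.moves τ M o z p D (x.idx (moveCode x.n x.q τ z p (if M = 0 then p else z) + 1) M
        (if M = 0 then p else o) p) :=
  (Nat.sub_le_sub_right (le_relaxAt _ _ _ _) _).trans ((le_relaxAt_self _ _ _).trans
    ((le_relaxAt _ _ _ _).trans (le_relaxAt _ _ _ _)))

theorem Ctx.moves_back (τ M o z p : ℕ) (D : ℕ → ℕ) :
    D (x.idx (τ + 1) M o z) - (x.enter τ p + edgeCost x.n (x.adj (p * x.n + z)) +
      (if M = 0 then 1 else 0) * (x.n + 1)) ≤
      x.moves τ M o z p D (x.idx (moveCode x.n x.q τ z z p + 1) M o z) :=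
  (Nat.sub_le_sub_right ((le_relaxAt _ _ _ _).trans (le_relaxAt _ _ _ _)) _).trans
    ((le_relaxAt_self _ _ _).trans (le_relaxAt _ _ _ _))

theorem Ctx.moves_pull (τ M o z p : ℕ) (D : ℕ → ℕ) :
    D (x.idx (τ + 1) M o z) ≤
      x.moves τ M o z p D (x.idx (moveCode x.n x.q τ z z o + 1) M o z) :=
  ((le_relaxAt _ _ _ _).trans ((le_relaxAt _ _ _ _).trans (le_relaxAt _ _ _ _))).trans
    (le_relaxAt_self _ _ _)

theorem Ctx.moves_le_pass (τ M o z p M' : ℕ) (D : ℕ → ℕ) (i : ℕ) :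
    x.moves τ M o z p D i ≤ x.pass (τ + 1) M o z p M' D i :=
  le_relaxAt _ _ _ _

/-- The tokens in a row: first the forward tokens, then the backward tokens. -/
def tokens {q : ℕ} (f b : Fin q → ℕ) (i : ℕ) : ℕ :=
  if h : i < q then f ⟨i, h⟩ else if h : i - q < q then b ⟨i - q, h⟩ else 0

/-- The number of a position of the tokens. -/
def tokenCode (n : ℕ) {q : ℕ} (f b : Fin q → ℕ) : ℕ := enc n (q + q) (tokens f b)

section Tokens

variable {n q : ℕ} {f b : Fin q → ℕ}

theorem tokens_lt (h : ∀ i, f i < n ∧ b i < n) {i : ℕ} (hi : i < q + q) : tokens f b i < n := by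
  unfold tokens
  split_ifs with h1 h2
  exacts [(h _).1, (h _).2, by omega]

theorem moveCode_tokenCode (h : ∀ i, f i < n ∧ b i < n) (z A C : ℕ) :
    moveCode n q (tokenCode n f b) z A C = tokenCode n (move z A f) (move z C b) := by
  refine enc_congr fun i hi => ?_
  rw [tokenCode, dig_enc (fun i hi => tokens_lt h hi) hi]
  unfold tokens move
  split_ifs <;> first | rfl | omega

theorem move_self {ι : Type*} (z : ℕ) (f : ι → ℕ) : move z z f = f := by
  funext i
  unfold move
  split_ifs with h
  exacts [h.symm, rfl]

theorem occCount_tokenCode (h : ∀ i, f i < n ∧ b i < n) (p : ℕ) :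
    occCount n q (tokenCode n f b) p = 0 ↔ ¬ Occ f b p := by
  rw [occCount, Finset.sum_eq_zero_iff]
  constructor
  · rintro h0 ⟨i, hi⟩
    have key : ∀ j < q + q, tokens f b j ≠ p := by
      intro j hj hjp
      have := h0 j (Finset.mem_range.2 hj)
      rw [tokenCode, dig_enc (fun i hi => tokens_lt h hi) hj, if_pos hjp] at this
      omega
    rcases hi with hi | hi
    · exact key i (by omega) (by simp [tokens, hi])
    · exact key (q + i) (by omega) (by simp [tokens, hi])
  · intro h0 j hj
    rw [Finset.mem_range] at hj
    rw [tokenCode, dig_enc (fun i hi => tokens_lt h hi) hj, if_neg]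
    intro hjp
    unfold tokens at hjp
    split_ifs at hjp with h1 h2
    · exact h0 ⟨_, .inl hjp⟩
    · exact h0 ⟨_, .inr hjp⟩
    · omega

theorem tokenCode_lt (h : ∀ i, f i < n ∧ b i < n) : tokenCode n f b < n ^ (q + q) :=
  enc_lt fun _ hi => tokens_lt h hi

end Tokens

/-- The edges between vertices. -/
def Ctx.arc (x : Ctx) (u v : ℕ) : Prop := u < x.n ∧ v < x.n ∧ x.edge u v

/-- The table contains a position of the token game after `k` rounds. -/
def Ctx.Play (x : Ctx) (D : ℕ → ℕ) (k : ℕ) (f b : Fin x.q → ℕ) (M o z c : ℕ) : Prop :=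
  (∀ i, f i < x.n ∧ b i < x.n) ∧ M < x.E ∧ o < x.n ∧ z < x.n ∧
    x.n + 1 ≤ x.table D (k * x.period) (x.idx (tokenCode x.n f b + 1) M o z) + c

/-- The table contains an out-tree after `k` rounds. -/
def Ctx.Tree (x : Ctx) (D : ℕ → ℕ) (k u M c : ℕ) : Prop :=
  u < x.n → M < x.E ∧ x.n + 1 ≤ x.table D (k * x.period) (x.idx 0 M 0 u) + c

theorem edgeCost_eq_zero {n a : ℕ} (h : a ≠ 0) : edgeCost n a = 0 := by
  rw [edgeCost, Nat.sub_eq_zero_of_le (by omega), zero_mul]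

theorem Ctx.enter_eq {f b : Fin x.q → ℕ} (h : ∀ i, f i < x.n ∧ b i < x.n) (p : ℕ) :
    x.enter (tokenCode x.n f b) p = enterCost x.weight f b p := by
  rw [enter, enterCost]
  by_cases h1 : Occ f b p
  · rw [if_neg fun h0 => (occCount_tokenCode h p).1 h0 h1, if_pos h1, zero_mul]
  · rw [if_pos ((occCount_tokenCode h p).2 h1), if_neg h1, one_mul]

theorem move_lt {ι : Type*} {n z p : ℕ} {f : ι → ℕ} (hp : p < n) {i : ι} (h : f i < n) :
    move z p f i < n := by
  unfold move
  split_ifs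
  exacts [hp, h]

theorem Ctx.rules {D : ℕ → ℕ} (hD : ∀ u < x.n, x.n + 1 ≤ D (x.idx 0 1 0 u)) (hE : 1 < x.E)
    (hU : x.Unions) (hlt : ∀ M < x.E, ∀ M' < x.E, M ||| M' < x.E) :
    Rules x.arc x.weight (x.Play D) (x.Tree D) := by
  have hE0 : 0 < x.E := by omega
  constructor
  · rintro k l f b M o z c c' hk hc ⟨h1, h2, h3, h4, h5⟩
    have := x.table_mono D (Nat.mul_le_mul_right x.period hk)
      (x.idx (tokenCode x.n f b + 1) M o z)
    exact ⟨h1, h2, h3, h4, by omega⟩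
  · rintro k f b M o z c p ⟨h1, h2, h3, h4, h5⟩ hocc
    have hp : p < x.n := by
      obtain ⟨i, rfl | rfl⟩ := hocc
      exacts [(h1 i).1, (h1 i).2]
    obtain ⟨T, hT, hT'⟩ := x.exists_pass D k (tokenCode_lt h1) h2 h3 h4 hp hE0
    refine ⟨h1, h2, hp, hp, ?_⟩
    have e1 := hT (x.idx (tokenCode x.n f b + 1) M o z)
    have e2 := x.moves_reset (tokenCode x.n f b) M o z p T
    rw [if_neg fun h0 => (occCount_tokenCode h1 p).1 h0 hocc, moveCode_tokenCode h1, move_self,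
      move_self] at e2
    have e3 := (x.moves_le_pass _ M o z p 0 T _).trans (hT' (x.idx (tokenCode x.n f b + 1) M p p))
    omega
  · rintro k f b o z c p ⟨h1, h2, h3, h4, h5⟩ ⟨-, hp, he⟩
    obtain ⟨T, hT, hT'⟩ := x.exists_pass D k (tokenCode_lt h1) h2 h3 h4 hp hE0
    refine ⟨fun i => ⟨move_lt hp (h1 i).1, move_lt hp (h1 i).2⟩, h2, hp, hp, ?_⟩
    have e1 := hT (x.idx (tokenCode x.n f b + 1) 0 o z)
    have e2 := x.moves_step (tokenCode x.n f b) 0 o z p T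
    rw [if_pos rfl, if_pos rfl, moveCode_tokenCode h1, x.enter_eq h1, edgeCost_eq_zero he] at e2
    have e3 := (x.moves_le_pass _ 0 o z p 0 T _).trans
      (hT' (x.idx (tokenCode x.n (move z p f) (move z p b) + 1) 0 p p))
    omega
  · rintro k f b M o z c p ⟨h1, h2, h3, h4, h5⟩ hM ⟨-, hp, he⟩
    obtain ⟨T, hT, hT'⟩ := x.exists_pass D k (tokenCode_lt h1) h2 h3 h4 hp hE0
    refine ⟨fun i => ⟨move_lt hp (h1 i).1, (h1 i).2⟩, h2, h3, hp, ?_⟩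
    have e1 := hT (x.idx (tokenCode x.n f b + 1) M o z)
    have e2 := x.moves_step (tokenCode x.n f b) M o z p T
    rw [if_neg hM, if_neg hM, moveCode_tokenCode h1, x.enter_eq h1, edgeCost_eq_zero he,
      move_self] at e2
    have e3 := (x.moves_le_pass _ M o z p 0 T _).trans
      (hT' (x.idx (tokenCode x.n (move z p f) b + 1) M o p))
    omega
  · rintro k f b M o z c p ⟨h1, h2, h3, h4, h5⟩ hM ⟨hp, -, he⟩
    obtain ⟨T, hT, hT'⟩ := x.exists_pass D k (tokenCode_lt h1) h2 h3 h4 hp hE0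
    refine ⟨fun i => ⟨(h1 i).1, move_lt hp (h1 i).2⟩, h2, h3, h4, ?_⟩
    have e1 := hT (x.idx (tokenCode x.n f b + 1) M o z)
    have e2 := x.moves_back (tokenCode x.n f b) M o z p T
    rw [if_neg hM, moveCode_tokenCode h1, x.enter_eq h1, edgeCost_eq_zero he, move_self] at e2
    have e3 := (x.moves_le_pass _ M o z p 0 T _).trans
      (hT' (x.idx (tokenCode x.n f (move z p b) + 1) M o z))
    omega
  · rintro k f b M o z c ⟨h1, h2, h3, h4, h5⟩
    obtain ⟨T, hT, hT'⟩ := x.exists_pass D k (tokenCode_lt h1) h2 h3 h4 h4 hE0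
    refine ⟨fun i => ⟨(h1 i).1, move_lt h3 (h1 i).2⟩, h2, h3, h4, ?_⟩
    have e1 := hT (x.idx (tokenCode x.n f b + 1) M o z)
    have e2 := x.moves_pull (tokenCode x.n f b) M o z z T
    rw [moveCode_tokenCode h1, move_self] at e2
    have e3 := (x.moves_le_pass _ M o z z 0 T _).trans
      (hT' (x.idx (tokenCode x.n f (move z o b) + 1) M o z))
    omega
  · rintro k f b M o z c M' c' ⟨h1, h2, h3, h4, h5⟩ hT
    obtain ⟨h6, h7⟩ := hT h4
    obtain ⟨T, hT, hT'⟩ := x.exists_pass D k (σ := tokenCode x.n f b + 1)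
      (tokenCode_lt h1) h2 h3 h4 h4 h6
    refine ⟨h1, hlt M h2 M' h6, h3, h4, ?_⟩
    have e1 := hT (x.idx (tokenCode x.n f b + 1) M o z)
    have e2 := hT (x.idx 0 M' 0 z)
    have e3 := hT' (x.idx (tokenCode x.n f b + 1) (M ||| M') o z)
    rw [Ctx.pass, if_neg (show tokenCode x.n f b + 1 ≠ 0 by omega), Ctx.join, hU M h2 M' h6] at e3
    have e4 := (le_relaxAt_self _ _ _).trans e3
    have e5 : ∀ i, T i ≤ x.moves (tokenCode x.n f b + 1 - 1) M o z z T i := fun i =>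
      (le_relaxAt _ _ _ _).trans ((le_relaxAt _ _ _ _).trans
        ((le_relaxAt _ _ _ _).trans (le_relaxAt _ _ _ _)))
    have e6 := e5 (x.idx (tokenCode x.n f b + 1) M o z)
    have e7 := e5 (x.idx 0 M' 0 z)
    omega
  · intro k l u M c c' hk hc h hu
    have := x.table_mono D (Nat.mul_le_mul_right x.period hk) (x.idx 0 M 0 u)
    obtain ⟨h1, h2⟩ := h hu
    exact ⟨h1, by omega⟩
  · rintro k u p M c h ⟨hp, hu, he⟩ -
    obtain ⟨h1, h2⟩ := h hu
    obtain ⟨T, hT, hT'⟩ := x.exists_pass D k (o := 0) (Nat.zero_le _) h1 (by omega) hu hp hE0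
    refine ⟨h1, ?_⟩
    have e1 := hT (x.idx 0 M 0 u)
    have e2 := hT' (x.idx 0 M 0 p)
    rw [Ctx.pass, if_pos rfl] at e2
    have e3 := (le_relaxAt_self T (x.idx 0 M 0 p) _).trans ((le_relaxAt _ _ _ _).trans e2)
    rw [edgeCost_eq_zero he] at e3
    omega
  · intro k u M c M' c' h h' hu
    obtain ⟨h1, h2⟩ := h hu
    obtain ⟨h3, h4⟩ := h' hu
    obtain ⟨T, hT, hT'⟩ := x.exists_pass D k (o := 0) (Nat.zero_le _) h1 (by omega) hu hu h3
    refine ⟨hlt M h1 M' h3, ?_⟩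
    have e1 := hT (x.idx 0 M 0 u)
    have e2 := hT (x.idx 0 M' 0 u)
    have e3 := hT' (x.idx 0 (M ||| M') 0 u)
    rw [Ctx.pass, if_pos rfl, Ctx.join, hU M h1 M' h3] at e3
    have e4 := (le_relaxAt_self _ _ _).trans e3
    have e5 : ∀ i, T i ≤ x.grow M 0 u u T i := fun i => le_relaxAt _ _ _ _
    have e6 := e5 (x.idx 0 M 0 u)
    have e7 := e5 (x.idx 0 M' 0 u)
    omega
  · intro k u hu
    have := hD u hu
    have := x.table_mono D (Nat.zero_le (k * x.period)) (x.idx 0 1 0 u)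
    exact ⟨hE, by rw [Ctx.table] at this; omega⟩

/-! ### The table is correct -/

theorem rank_lt {c : ℕ → ℕ} {u n : ℕ} (hu : u < n) (hc : c u ≠ 0) : rank c u < rank c n :=
  Nat.count_strict_mono (p := fun v => c v ≠ 0) hc hu

theorem rank_injective {c : ℕ → ℕ} {u v : ℕ} (hu : c u ≠ 0) (hv : c v ≠ 0)
    (h : rank c u = rank c v) : u = v :=
  Nat.count_injective (p := fun v => c v ≠ 0) hu hv h

theorem exists_rank_eq {c : ℕ → ℕ} {i n : ℕ} (h : i < rank c n) : ∃ j, c j ≠ 0 ∧ rank c j = i := by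
  induction n with
  | zero => simp [rank] at h
  | succ n ih =>
    rw [rank_succ] at h
    split_ifs at h with hc
    · rcases Nat.lt_succ_iff_lt_or_eq.1 h with h1 | h1
      exacts [ih h1, ⟨n, hc, h1.symm⟩]
    · exact ih h

theorem marked_ne_zero {c : ℕ → ℕ} {i n : ℕ} (h : i < rank c n) : c (marked c i) ≠ 0 := by
  obtain ⟨j, hj, rfl⟩ := exists_rank_eq h
  rwa [marked_rank hj]

theorem rank_marked {c : ℕ → ℕ} {i n : ℕ} (h : i < rank c n) : rank c (marked c i) = i := by
  obtain ⟨j, hj, rfl⟩ := exists_rank_eq h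
  rw [marked_rank hj]

theorem Ctx.cheap_free (c : ℕ) : x.Cheap x.free c :=
  ⟨subset_rfl, Finset.filter_subset _ _, by simp⟩

theorem Ctx.mem_free_of_root {u : ℕ} (hu : u < x.n) (h : x.root u ≠ 0) : u ∈ x.free :=
  Finset.mem_filter.2 ⟨Finset.mem_range.2 hu, by omega⟩

theorem Ctx.dig_startCode (hq : x.q = rank x.root x.n) {i : ℕ} (hi : i < x.q + x.q) :
    dig x.n x.startCode i = marked x.root (if i < x.q then i else i - x.q) := by
  refine dig_enc (fun i hi => marked_lt ?_) hi
  split_ifs <;> omega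

theorem Ctx.Started.sound' {D : ℕ → ℕ} (h : x.Started D) (hq : x.q = rank x.root x.n)
    (hE : x.E = 2 ^ (rank x.term x.n + 1)) : x.Sound D := by
  refine ⟨h.le, fun σ M o z hM ho hz c hc hle => ?_⟩
  have hE0 : 0 < x.E := by rw [hE]; positivity
  have hE1 : 1 < x.E := by
    rw [hE, pow_succ]
    have : 0 < 2 ^ rank x.term x.n := by positivity
    omega
  rcases h.sound (x.idx σ M o z) (by omega) with ⟨u, hu, h1⟩ | ⟨u, hu, hut, h1⟩ | ⟨u, hu, hur, h1⟩
  · obtain ⟨rfl, rfl, rfl, rfl⟩ := x.idx_inj hM ho hz hE1 (by omega) hu h1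
    exact valid_zero.2 ⟨x.free, x.cheap_free c, fun u hu ht hb => by
      simp [Nat.testBit_one_eq_true_iff_self_eq_zero] at hb⟩
  · have hlt : 2 ^ (rank x.term u + 1) < x.E := by
      rw [hE]
      exact Nat.pow_lt_pow_right (by norm_num) (by have := rank_lt hu hut; omega)
    obtain ⟨rfl, rfl, rfl, rfl⟩ := x.idx_inj hM ho hz hlt (by omega) hu h1
    refine valid_zero.2 ⟨x.free, x.cheap_free c, fun u hu ht hb => ?_⟩
    rw [Nat.testBit_two_pow] at hb
    have hb' : rank x.term z = rank x.term u := by simpa using hb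
    rw [rank_injective ht hut hb'.symm]
    exact .refl (by simp)
  · obtain ⟨rfl, rfl, rfl, rfl⟩ := x.idx_inj hM ho hz hE0 hu hu h1
    have hmem : ∀ i < x.q, marked x.root i ∈ x.free := fun i hi =>
      x.mem_free_of_root (marked_lt (by omega)) (marked_ne_zero (n := x.n) (by omega))
    have hdig : ∀ i < x.q, dig x.n x.startCode i = marked x.root i := fun i hi => by
      rw [Ctx.dig_startCode hq (by omega), if_pos hi]
    have hdig' : ∀ i < x.q, dig x.n x.startCode (x.q + i) = marked x.root i := fun i hi => by
      rw [Ctx.dig_startCode hq (by omega), if_neg (by omega), Nat.add_sub_cancel_left]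
    have hofree := x.mem_free_of_root hu hur
    have hrank : rank x.root z < x.q := by rw [hq]; exact rank_lt hu hur
    refine valid_succ.2 ⟨x.free, x.cheap_free c, fun i hi => ?_, fun u hu hr => ?_,
      ⟨rank x.root z, hrank, ?_⟩, .refl (by exact_mod_cast hofree), fun i hi => ⟨i, hi, ?_⟩,
      fun u _ _ hb => by simp at hb, fun _ => ⟨fun i hi => by rw [hdig' i hi, hdig i hi], rfl,
        rank x.root z, hrank, by rw [hdig _ hrank, marked_rank hur]⟩⟩
    · rw [Ctx.dig_startCode hq hi]
      exact hmem _ (by split_ifs <;> omega)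
    · have hr' : rank x.root u < x.q := by rw [hq]; exact rank_lt hu hr
      refine ⟨rank x.root u, hr', ?_⟩
      rw [hdig _ hr', marked_rank hr]
      exact .refl (by exact_mod_cast x.mem_free_of_root hu hr)
    · rw [hdig' _ hrank, marked_rank hur]
      exact .refl (by exact_mod_cast hofree)
    · rw [hdig' i hi, hdig i hi]
      exact .refl (by exact_mod_cast hmem i hi)

/-- A vertex set `W` is a solution with trunk `v`. -/
structure Ctx.Solves (x : Ctx) (W : Finset ℕ) (v : ℕ) : Prop where
  trunk : v ∈ W
  roots : ∀ u < x.n, x.root u ≠ 0 → ReachIn x.edge W u v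
  terms : ∀ u < x.n, x.term u ≠ 0 → ReachIn x.edge W v u

theorem Ctx.or_lt {t : ℕ} (hE : x.E = 2 ^ t) : ∀ M < x.E, ∀ M' < x.E, M ||| M' < x.E := by
  rw [hE]
  exact fun M hM M' hM' => Nat.or_lt_two_pow hM hM'

theorem enc_const (n k v : ℕ) : enc n k (fun _ => v) = v * enc n k fun _ => 1 := by
  rw [enc, enc, Finset.mul_sum]
  exact Finset.sum_congr rfl fun i _ => by rw [one_mul]

/-- Soundness: a nonzero entry of a final position comes from a solution. -/
theorem Ctx.exists_solution {D : ℕ → ℕ} (h : x.Started D) (hU : x.Unions)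
    (hq : x.q = rank x.root x.n) (hE : x.E = 2 ^ (rank x.term x.n + 1)) {j v c : ℕ}
    (hv : v < x.n) (hc : c ≤ x.n) (hle : x.n + 1 ≤ x.table D j (x.goal v) + c) :
    ∃ W, x.Cheap W c ∧ x.Solves W v := by
  have hE0 : 0 < x.E := by rw [hE]; positivity
  have h1 := ((h.sound' hq hE).table hU (by omega) hE0 (x.or_lt hE) j).2 _ _ _ _ (by omega) hv hv
    c hc hle
  obtain ⟨W, hW, hP⟩ := valid_succ.1 h1
  have hdig : ∀ i < x.q + x.q, dig x.n (v * enc x.n (x.q + x.q) fun _ => 1) i = v := by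
    intro i hi
    rw [← enc_const]
    exact dig_enc (fun _ _ => hv) hi
  refine ⟨W, hW, by exact_mod_cast hP.carrier.right_mem, fun u hu hr => ?_, fun u hu ht => ?_⟩
  · obtain ⟨i, hi, h2⟩ := hP.roots u hu hr
    rwa [hdig i (by omega)] at h2
  · obtain ⟨j, hj, h2⟩ := hP.terms u hu ht (by
      rw [hE, Nat.testBit_two_pow_sub_one]
      have := rank_lt hu ht
      simpa using this)
    rwa [hdig _ (by omega)] at h2

theorem reachIn_arc {W : Finset ℕ} (hW : W ⊆ Finset.range x.n) {u v : ℕ}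
    (h : ReachIn x.edge W u v) : ReachIn x.arc W u v := by
  obtain ⟨h1, h2⟩ := h
  induction h2 with
  | refl => exact .refl h1
  | tail _ h3 ih =>
    exact ih.tail ⟨Finset.mem_range.1 (hW ih.right_mem), Finset.mem_range.1 (hW h3.2), h3.1⟩ h3.2

/-- The number of rounds that `play_complete` needs. -/
theorem rounds_le {n : ℕ} (hn : 0 < n) :
    2 * n + 1 + 2 * n + 1 + 2 * (n * (n ^ 2 + 1) + n ^ 2) * (3 * n + 4) + 1 ≤
      49 * n * n * n * n := by
  have h1 : n ≤ n * n := Nat.le_mul_of_pos_left n hn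
  have h2 : n * n ≤ n * n * n := Nat.le_mul_of_pos_right _ hn
  have h3 : n * n * n ≤ n * n * n * n := Nat.le_mul_of_pos_right _ hn
  have e : 2 * n + 1 + 2 * n + 1 + 2 * (n * (n ^ 2 + 1) + n ^ 2) * (3 * n + 4) + 1 =
      6 * (n * n * n * n) + 14 * (n * n * n) + 14 * (n * n) + 12 * n + 3 := by ring
  have e' : 49 * n * n * n * n = 49 * (n * n * n * n) := by ring
  rw [e, e']
  omega

/-- Completeness: for every solution, some final position has at least the corresponding entry. -/
theorem Ctx.exists_entry {D : ℕ → ℕ} (h : x.Started D) (hU : x.Unions)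
    (hq : x.q = rank x.root x.n) (hq0 : 0 < x.q) (hE : x.E = 2 ^ (rank x.term x.n + 1))
    {W : Finset ℕ} {v : ℕ} (hW : W ⊆ Finset.range x.n) (hS : x.Solves W v) :
    ∃ v' < x.n, x.n + 1 ≤ x.table D (x.period * (49 * x.n * x.n * x.n * x.n)) (x.goal v') +
      ∑ u ∈ W, x.weight u := by
  have hvn : v < x.n := Finset.mem_range.1 (hW hS.trunk)
  have hE0 : 0 < x.E := by rw [hE]; positivity
  have hE1 : 1 < x.E := by
    rw [hE, pow_succ]
    have : 0 < 2 ^ rank x.term x.n := by positivity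
    omega
  have hR := x.rules h.start hE1 hU (x.or_lt hE)
  let g : Fin x.q → ℕ := fun i => marked x.root i
  let m : ℕ → ℕ := fun u => if u < x.n ∧ x.term u ≠ 0 then 2 ^ (rank x.term u + 1) else 0
  have hg : ∀ i, g i < x.n := fun i => marked_lt (by have := i.2; omega)
  have hm : ∀ u, m u ≠ 0 → u < x.n ∧ x.term u ≠ 0 := by
    intro u hu
    by_contra h0
    exact hu (if_neg h0)
  obtain ⟨r, hr, -, hr'⟩ := h.root
  have hstart : tokenCode x.n g g = x.startCode := by
    refine enc_congr fun i hi => ?_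
    unfold tokens
    split_ifs
    exacts [rfl, rfl, by omega]
  obtain ⟨M, v', c, ⟨-, hM, hv', -, hle⟩, -, h0, hbits, hc⟩ := play_complete (N := x.n) (g := g)
    (o := r) (z := r) (m := m) hR hq0
    (by simpa using Finset.card_le_card hW) hS.trunk
    (fun i => reachIn_arc hW (hS.roots _ (hg i) (marked_ne_zero (n := x.n) (by
      have := i.2
      omega))))
    (fun u hu => reachIn_arc hW (hS.terms u (hm u hu).1 (hm u hu).2))
    (fun u => by
      by_cases hu : m u = 0
      · exact .inl hu
      · obtain ⟨h1, h2⟩ := hm u hu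
        right
        intro _
        have hmu : m u = 2 ^ (rank x.term u + 1) := if_pos ⟨h1, h2⟩
        rw [hmu, Nat.zero_mul, Ctx.table]
        refine ⟨?_, (h.term u h1 h2).trans (Nat.le_add_right _ _)⟩
        rw [hE]
        exact Nat.pow_lt_pow_right (by norm_num) (by have := rank_lt h1 h2; omega))
    ⟨fun i => ⟨hg i, hg i⟩, hE0, hr, hr, by
      rw [Nat.zero_mul, hstart]
      exact hr'.trans (Nat.le_add_right _ _)⟩
  refine ⟨v', hv', ?_⟩
  have hMfull : M = x.E - 1 := by
    refine Nat.eq_of_testBit_eq fun i => ?_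
    rw [hE, Nat.testBit_two_pow_sub_one]
    rcases Nat.lt_or_ge i (rank x.term x.n + 1) with hi | hi
    · rw [decide_eq_true hi]
      rcases Nat.eq_zero_or_pos i with rfl | hi0
      · exact h0
      · have h1 : i - 1 < rank x.term x.n := by omega
        refine hbits (marked x.term (i - 1)) i ?_
        have h2 : m (marked x.term (i - 1)) = 2 ^ i := by
          simp only [m]
          rw [if_pos ⟨marked_lt h1, marked_ne_zero h1⟩, rank_marked h1, Nat.sub_add_cancel hi0]
        rw [h2, Nat.testBit_two_pow_self]
    · rw [decide_eq_false (by omega)]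
      refine Nat.testBit_lt_two_pow (hM.trans_le ?_)
      rw [hE]
      exact Nat.pow_le_pow_right (by norm_num) hi
  have hcode : tokenCode x.n (fun _ : Fin x.q => v') (fun _ => v') =
      v' * enc x.n (x.q + x.q) fun _ => 1 := by
    rw [← enc_const]
    refine enc_congr fun i hi => ?_
    unfold tokens
    split_ifs
    exacts [rfl, rfl, by omega]
  rw [hMfull, hcode] at hle
  have hmono := x.table_mono D (Nat.mul_le_mul_right x.period (rounds_le (n := x.n) (by omega)))
    (x.goal v')
  rw [mul_comm x.period]
  change _ ≤ x.table D _ (x.goal v') + c at hle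
  omega

end Correctness

/-! ### From the machine to instances -/

namespace Instance

variable (x : Instance)

theorem init_adj (u v : Fin x.n) : x.init.arr 0 (u * x.n + v) ≠ 0 ↔ x.G.Adj u v := by
  have key : (∃ u' v' : Fin x.n, x.G.Adj u' v' ∧ (u * x.n + v : ℕ) = u' * x.n + v') ↔
      x.G.Adj u v := by
    constructor
    · rintro ⟨u', v', h, he⟩
      have hn : 0 < x.n := u.pos
      have h1 := congrArg (· / x.n) he
      have h2 := congrArg (· % x.n) he
      simp only [mul_comm _ x.n, Nat.mul_add_div hn, Nat.mul_add_mod, Nat.div_eq_of_lt v.2,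
        Nat.div_eq_of_lt v'.2, Nat.mod_eq_of_lt v.2, Nat.mod_eq_of_lt v'.2, add_zero] at h1 h2
      rwa [Fin.ext h1, Fin.ext h2]
    · exact fun h => ⟨u, v, h, rfl⟩
  simp [init, key]

theorem init_root (u : Fin x.n) : x.init.arr 1 u ≠ 0 ↔ u ∈ x.R := by
  have key : (∃ u' ∈ x.R, (u : ℕ) = u') ↔ u ∈ x.R :=
    ⟨fun ⟨u', h, he⟩ => Fin.ext he ▸ h, fun h => ⟨u, h, rfl⟩⟩
  simp [init, key]

theorem init_term (u : Fin x.n) : x.init.arr 2 u ≠ 0 ↔ u ∈ x.T := by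
  have key : (∃ u' ∈ x.T, (u : ℕ) = u') ↔ u ∈ x.T :=
    ⟨fun ⟨u', h, he⟩ => Fin.ext he ▸ h, fun h => ⟨u, h, rfl⟩⟩
  simp [init, key]

theorem rank_eq_card {n : ℕ} {c : ℕ → ℕ} {X : Finset (Fin n)} (h : ∀ u : Fin n, c u ≠ 0 ↔ u ∈ X) :
    rank c n = X.card := by
  rw [rank, Nat.count_eq_card_filter_range, ← X.card_map Fin.valEmbedding]
  congr 1
  ext u
  simp only [Finset.mem_filter, Finset.mem_range, Finset.mem_map, Fin.valEmbedding_apply]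
  constructor
  · rintro ⟨hu, hc⟩
    exact ⟨⟨u, hu⟩, (h ⟨u, hu⟩).1 hc, rfl⟩
  · rintro ⟨u, hu, rfl⟩
    exact ⟨u.2, (h u).2 hu⟩

/-- The constants of the dynamic program for an instance. -/
noncomputable def ctx (U : ℕ → ℕ) : Ctx :=
  ctxOf x.n (x.init.arr 0) (x.init.arr 1) (x.init.arr 2) U

variable {x} {U : ℕ → ℕ} {X : Finset (Fin x.n)} {W : Finset ℕ}

theorem reachIn_of_hasPath (hX : ∀ u : Fin x.n, u ∈ X ↔ (u : ℕ) ∈ W)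
    {a b : {u : Fin x.n | u ∈ X}} (h : HasPath (induced x.G {u | u ∈ X}) a b) :
    ReachIn (x.ctx U).edge W (a.1 : ℕ) (b.1 : ℕ) := by
  unfold HasPath at h
  induction h with
  | refl => exact .refl (by exact_mod_cast (hX a.1).1 a.2)
  | @tail b c _ hbc ih =>
    exact ih.tail ((x.init_adj b.1 c.1).2 hbc) (by exact_mod_cast (hX c.1).1 c.2)

theorem hasPath_of_reachIn (hX : ∀ u : Fin x.n, u ∈ X ↔ (u : ℕ) ∈ W) (hW : W ⊆ Finset.range x.n)
    {a' b' : ℕ} (h : ReachIn (x.ctx U).edge W a' b') (a b : {u : Fin x.n | u ∈ X})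
    (ha : (a.1 : ℕ) = a') (hb : (b.1 : ℕ) = b') : HasPath (induced x.G {u | u ∈ X}) a b := by
  obtain ⟨h1, h2⟩ := h
  unfold HasPath
  induction h2 generalizing b with
  | refl =>
    obtain rfl : a = b := Subtype.ext (Fin.ext (ha.trans hb.symm))
    exact .refl
  | @tail c d h3 h4 ih =>
    have hc : c ∈ W := by exact_mod_cast ReachIn.right_mem (r := (x.ctx U).edge) ⟨h1, h3⟩
    have hcn := Finset.mem_range.1 (hW hc)
    let c' : {u : Fin x.n | u ∈ X} := ⟨⟨c, hcn⟩, (hX ⟨c, hcn⟩).2 hc⟩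
    refine (ih c' rfl).tail ?_
    change x.G.Adj c'.1 b.1
    rw [← x.init_adj, hb]
    exact h4.1

theorem isSolution_iff {S : Finset (Fin x.n)} (hS : ∀ u : Fin x.n, u ∈ x.R ∪ S ∪ x.T ↔ (u : ℕ) ∈ W)
    (hW : W ⊆ Finset.range x.n) : x.IsSolution S ↔ ∃ v, (x.ctx U).Solves W v := by
  constructor
  · rintro ⟨v, h1, h2⟩
    refine ⟨v.1, (hS v.1).1 v.2, fun u hu hr => ?_, fun u hu ht => ?_⟩
    · have hR : (⟨u, hu⟩ : Fin x.n) ∈ x.R := (x.init_root ⟨u, hu⟩).1 hr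
      exact reachIn_of_hasPath hS (h1 ⟨⟨u, hu⟩, by simp [hR]⟩ hR)
    · have hT : (⟨u, hu⟩ : Fin x.n) ∈ x.T := (x.init_term ⟨u, hu⟩).1 ht
      exact reachIn_of_hasPath hS (h2 ⟨⟨u, hu⟩, by simp [hT]⟩ hT)
  · rintro ⟨v, hv, h1, h2⟩
    have hvn := Finset.mem_range.1 (hW hv)
    refine ⟨⟨⟨v, hvn⟩, (hS ⟨v, hvn⟩).2 hv⟩, fun r hr => ?_, fun t ht => ?_⟩
    · exact hasPath_of_reachIn hS hW (h1 r.1 r.1.2 ((x.init_root r.1).2 hr)) _ _ rfl rfl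
    · exact hasPath_of_reachIn hS hW (h2 t.1 t.1.2 ((x.init_term t.1).2 ht)) _ _ rfl rfl

theorem mem_free {u : Fin x.n} : (u : ℕ) ∈ (x.ctx U).free ↔ u ∈ x.R ∪ x.T := by
  rw [Finset.mem_union, ← x.init_root, ← x.init_term]
  refine Finset.mem_filter.trans ⟨fun h => ?_, fun h => ⟨Finset.mem_range.2 u.2, ?_⟩⟩
  · have h2 : x.init.arr 1 u + x.init.arr 2 u ≠ 0 := h.2
    omega
  · change x.init.arr 1 u + x.init.arr 2 u ≠ 0
    omega

/-- The final table determines the optimum. -/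
theorem isCorrectOutput {s : State} {D : ℕ → ℕ} {best j : ℕ} (h : (x.ctx U).Started D)
    (hU : (x.ctx U).Unions) (hq : x.R.card ≠ 0)
    (hj : j = (x.ctx U).period * (49 * x.n * x.n * x.n * x.n))
    (hall : ∀ v < x.n, (x.ctx U).table D j ((x.ctx U).goal v) ≤ best)
    (hex : best = 0 ∨ ∃ v < x.n, (x.ctx U).table D j ((x.ctx U).goal v) = best)
    (h1 : s.reg 1 = x.n + 1 - best) (h0 : s.reg 0 = if 0 < best then 1 else 0) :
    x.IsCorrectOutput s := by
  classical
  have hq0 : 0 < (x.ctx U).q := by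
    have h2 : (x.ctx U).q = x.R.card := rank_eq_card x.init_root
    rw [h2]
    exact Nat.pos_of_ne_zero hq
  have hlower : ∀ S, x.IsSolution S → x.n + 1 ≤ best + S.card := by
    intro S hS
    let W : Finset ℕ := (x.R ∪ S ∪ x.T).map Fin.valEmbedding
    have hSW : ∀ u : Fin x.n, u ∈ x.R ∪ S ∪ x.T ↔ (u : ℕ) ∈ W := by
      intro u
      constructor
      · exact fun h => Finset.mem_map.2 ⟨u, h, rfl⟩
      · intro h
        obtain ⟨u', h1, h2⟩ := Finset.mem_map.1 h
        exact Fin.ext h2 ▸ h1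
    have hW : W ⊆ Finset.range x.n := by
      intro u hu
      obtain ⟨u', -, rfl⟩ := Finset.mem_map.1 hu
      exact Finset.mem_range.2 u'.2
    obtain ⟨v, hv⟩ := (isSolution_iff (U := U) hSW hW).1 hS
    obtain ⟨v', hv', hle⟩ := Ctx.exists_entry h hU rfl hq0 rfl hW hv
    have hsum : ∑ u ∈ W, (x.ctx U).weight u ≤ S.card := by
      rw [Finset.sum_map]
      calc ∑ u ∈ x.R ∪ S ∪ x.T, (x.ctx U).weight u
          ≤ ∑ u ∈ x.R ∪ S ∪ x.T, if u ∈ S then 1 else 0 := by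
            refine Finset.sum_le_sum fun u hu => ?_
            rw [Ctx.weight]
            split_ifs with h3 h4
            · exact le_rfl
            · have h5 : u ∉ x.R := fun h =>
                (x.init_root u).2 h (Nat.eq_zero_of_add_eq_zero_right h3)
              have h6 : u ∉ x.T := fun h => (x.init_term u).2 h (Nat.eq_zero_of_add_eq_zero_left h3)
              simp [h4, h5, h6] at hu
            · exact Nat.zero_le _
            · exact Nat.zero_le _
        _ ≤ S.card := by
            rw [Finset.sum_boole]
            refine Finset.card_le_card fun u hu => (Finset.mem_filter.1 hu).2
    have := hall v' hv'
    have hle' : x.n + 1 ≤ (x.ctx U).table D j ((x.ctx U).goal v') +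
        ∑ u ∈ W, (x.ctx U).weight u := by rw [hj]; exact hle
    omega
  have hupper : 0 < best → ∃ S, x.IsSolution S ∧ S.card ≤ x.n + 1 - best := by
    intro hb
    obtain ⟨v, hv, hbest⟩ := hex.resolve_left (by omega)
    obtain ⟨W, hW, hs⟩ := Ctx.exists_solution (c := x.n + 1 - best) h hU rfl rfl (j := j) hv
      (by change _ ≤ x.n; omega) (by rw [hbest]; change x.n + 1 ≤ _; omega)
    let S : Finset (Fin x.n) := Finset.univ.filter fun u => (u : ℕ) ∈ W \ (x.ctx U).free
    have hmem : ∀ u : Fin x.n, u ∈ x.R ∪ S ∪ x.T ↔ (u : ℕ) ∈ W := by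
      intro u
      have h2 : u ∈ S ↔ (u : ℕ) ∈ W ∧ (u : ℕ) ∉ (x.ctx U).free := by simp [S]
      have h3 := @mem_free x U u
      have h4 := @hW.free_sub u
      simp only [Finset.mem_union] at h3 ⊢
      rw [h2]
      tauto
    refine ⟨S, (isSolution_iff hmem hW.sub_range).2 ⟨v, hs⟩, le_trans ?_ hW.card_le⟩
    rw [← S.card_map Fin.valEmbedding]
    refine Finset.card_le_card fun u hu => ?_
    obtain ⟨u', h2, rfl⟩ := Finset.mem_map.1 hu
    exact (Finset.mem_filter.1 h2).2
  have hcard : ∀ S : Finset (Fin x.n), S.card ≤ x.n := fun S => by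
    simpa using Finset.card_le_univ S
  constructor
  · rintro ⟨S, hS⟩
    have hb : 0 < best := by
      have := hlower S hS
      have := hcard S
      omega
    obtain ⟨S', hS', hc⟩ := hupper hb
    refine ⟨by rw [h0, if_pos hb], ⟨S', hS', ?_⟩, ?_⟩
    · have := hlower S' hS'
      omega
    · rintro k ⟨S'', hS'', rfl⟩
      have := hlower S'' hS''
      omega
  · intro hno
    rw [h0, if_neg]
    intro hb
    obtain ⟨S, hS, -⟩ := hupper hb
    exact hno ⟨S, hS⟩

end Instance

/-! ### The running time -/

theorem size_pow_le (a k : ℕ) : (a ^ k).size ≤ k * a.size + 1 := by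
  induction k with
  | zero => simp
  | succ k ih =>
    rw [pow_succ, Nat.succ_mul]
    exact (size_mul_le _ _).trans (by omega)

theorem size_le_self (n : ℕ) : n.size ≤ n := Nat.size_le.2 Nat.lt_two_pow_self

/-- The bound on the number of steps times the length of the numbers. -/
theorem time_le {n q t B K : ℕ} (hn : 0 < n) (hq : q ≤ n) (ht : t ≤ n)
    (hB : B = (n ^ (q + q) + 1) * 2 ^ (t + 1) * n * n * n * 2 ^ (t + 1) * (49 * n * n * n * n)) :
    (n * 18 + 2 ^ (t + 1) * 2 ^ (t + 1) * 5 + B * (q * 56 + 66) + 18) * (K * B.size) ≤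
      392 * 163 * 22 * K * (2 ^ (2 * q + 4 * t) * n ^ (3 * q + 10)) := by
  have hpow : 1 ≤ n ^ (q + q) := Nat.one_le_pow _ _ hn
  obtain ⟨-, b2, -, -, b5, -⟩ := bounds_of_size (q := q) hn (E := 2 ^ (t + 1)) (by positivity)
    hpow hq hB.symm
  have h1 : B ≤ 392 * (n ^ (2 * q + 7) * 2 ^ (2 * t)) := by
    calc B ≤ (n ^ (q + q) + n ^ (q + q)) * 2 ^ (t + 1) * n * n * n * 2 ^ (t + 1) *
          (49 * n * n * n * n) := by rw [hB]; gcongr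
      _ = 392 * (n ^ (2 * q + 7) * 2 ^ (2 * t)) := by ring
  have h2 : n * 18 + 2 ^ (t + 1) * 2 ^ (t + 1) * 5 + B * (q * 56 + 66) + 18 ≤ B * (163 * n) := by
    have h3 : B * (q * 56 + 66) ≤ B * (n * 56 + 66 * n) :=
      Nat.mul_le_mul_left _ (by omega)
    have h4 : B ≤ B * n := Nat.le_mul_of_pos_right _ hn
    have h5 : B * (163 * n) = B * (n * 56 + 66 * n) + 41 * (B * n) := by ring
    omega
  have h3 : B.size ≤ 22 * n ^ 2 := by
    refine (Nat.size_le_size h1).trans ((size_mul_le _ _).trans ?_)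
    have h4 := size_mul_le (n ^ (2 * q + 7)) (2 ^ (2 * t))
    have h5 := size_pow_le n (2 * q + 7)
    have h6 : (2 ^ (2 * t)).size = 2 * t + 1 := Nat.size_pow
    have h7 : (392 : ℕ).size = 9 := by decide
    have h8 : (2 * q + 7) * n.size ≤ (2 * n + 7) * n :=
      Nat.mul_le_mul (by omega) (size_le_self n)
    nlinarith
  calc _ ≤ B * (163 * n) * (K * (22 * n ^ 2)) := Nat.mul_le_mul h2 (Nat.mul_le_mul_left _ h3)
    _ ≤ 392 * (n ^ (2 * q + 7) * 2 ^ (2 * t)) * (163 * n) * (K * (22 * n ^ 2)) := by gcongr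
    _ = 392 * 163 * 22 * K * (2 ^ (2 * t) * n ^ (2 * q + 10)) := by ring
    _ ≤ _ := Nat.mul_le_mul_left _ (Nat.mul_le_mul
      (Nat.pow_le_pow_right (by norm_num) (by omega)) (Nat.pow_le_pow_right hn (by omega)))

/-- The algorithm solves all instances with at least one root within the stated time. -/
theorem steinerProg_solves (x : Instance) (hq : x.R.card ≠ 0) :
    SolvesWithin steinerProg x (392 * 163 * 22 * steinerProg.weight *
      (2 ^ (2 * x.R.card + 4 * x.T.card) * x.n ^ (3 * x.R.card + 10))) := by
  have hR : rank (x.init.arr 1) x.n = x.R.card := Instance.rank_eq_card x.init_root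
  have hT : rank (x.init.arr 2) x.n = x.T.card := Instance.rank_eq_card x.init_term
  have hn : 0 < x.n := by
    obtain ⟨u, -⟩ := Finset.card_ne_zero.1 hq
    exact u.pos
  have hRn := rank_le (x.init.arr 1) x.n
  have hTn := rank_le (x.init.arr 2) x.n
  set B := (x.ctx 0).period * (49 * x.n * x.n * x.n * x.n) with hB
  have hB' : B = (x.n ^ (x.R.card + x.R.card) + 1) * 2 ^ (x.T.card + 1) * x.n * x.n * x.n *
      2 ^ (x.T.card + 1) * (49 * x.n * x.n * x.n * x.n) := by
    rw [hB, ← hR, ← hT]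
    rfl
  obtain ⟨-, b2, -⟩ := bounds_of_size (q := x.R.card) hn (E := 2 ^ (x.T.card + 1)) (by positivity)
    (Nat.one_le_pow _ _ hn) (by omega) hB'.symm
  obtain ⟨s, k, hrun, hk, U, D, best, hU, hD, hall, hex, h1, h0⟩ :=
    steinerProg_spec (s := x.init) (P := (x.ctx 0).period) hn (by rw [hR]; exact hq)
      (fun _ => rfl) rfl rfl rfl (by funext i; simp [Instance.init])
      (by funext i; simp [Instance.init]) (fun _ => rfl) hB.symm
  have hbdd : x.init.Bdd B := by
    constructor
    · intro r
      simp only [Instance.init]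
      split_ifs <;> omega
    · intro a i
      simp only [Instance.init]
      split_ifs <;> omega
  obtain ⟨-, c, hc, hck⟩ := hrun.exec (by omega) hbdd _ le_rfl
  refine ⟨s, c, hc, hck.trans ((Nat.mul_le_mul_right _ hk).trans ?_),
    Instance.isCorrectOutput (U := U) hD hU hq rfl hall hex h1 h0⟩
  rw [hR, hT]
  exact time_le hn (by omega) (by omega) hB'

theorem computable_bound (C q : ℕ) : Computable fun t : ℕ => C * 2 ^ (2 * q + 4 * t) := by
  have h1 : Primrec fun t : ℕ => 2 ^ (2 * q + 4 * t) := by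
    have hstep : Primrec₂ fun _ y : ℕ => y * 16 :=
      Primrec.nat_mul.comp Primrec.snd (Primrec.const 16)
    have h2 := Primrec.nat_rec₁ (2 ^ (2 * q)) hstep
    refine h2.of_eq fun t => ?_
    induction t with
    | zero => simp
    | succ t ih =>
      simp only [ih]
      ring
  exact (Primrec.nat_mul.comp (Primrec.const C) h1).to_comp

end SteinerTrunk

theorem theorem3 :
    (∀ q : ℕ, 1 ≤ q → SteinerTrunk.IsFPT q) ∧
    (∃ (p : SteinerTrunk.Prog) (C b : ℕ), ∀ q : ℕ, 1 ≤ q →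
      ∀ x : SteinerTrunk.Instance, x.R.card = q →
        SteinerTrunk.SolvesWithin p x
          (C * (2 ^ (2 * q + 4 * x.T.card) * x.n ^ (3 * q + b)))) := by
  constructor
  · intro q hq
    refine ⟨SteinerTrunk.steinerProg, _, 3 * q + 10,
      SteinerTrunk.computable_bound (392 * 163 * 22 * SteinerTrunk.steinerProg.weight) q, ?_⟩
    rintro x rfl
    simpa only [mul_assoc] using SteinerTrunk.steinerProg_solves x (by omega)
  · refine ⟨SteinerTrunk.steinerProg, 392 * 163 * 22 * SteinerTrunk.steinerProg.weight, 10, ?_⟩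
    rintro q hq x rfl
    exact SteinerTrunk.steinerProg_solves x (by omega)
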